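/- Let $d\ge 2$, $0<s<\frac d2$ and $1<q<\frac{d}{2s}$. All functions are real valued. Let $\mathring H^{s}(\mathbb R^d)$ be the space of all $u\in L^{\frac{2d}{d-2s}}(\mathbb R^d)$ whose Fourier transform $\mathscr F[u]$ is a function with $\|u\|_{\mathring H^s}^2=\int_{\mathbb R^d}|\xi|^{2s}|\mathscr F[u](\xi)|^2\,d\xi<\infty$ (here $\mathscr F[u](\xi)=(2\pi)^{-d/2}\int e^{-ix\cdot\xi}u(x)\,dx$), with the corresponding inner product $\langle\cdot,\cdot\rangle_{\mathring H^s}$, and let $\mathring H^{-s}(\mathbb R^d)$ be its dual. Let $T\in \mathring H^{-s}(\mathbb R^d)\cap L^{q}(\mathbb R^d)$, that is, $T\in L^q(\mathbb R^d)$ and $T$ is identified with a continuous linear functional on $\mathring H^{s}(\mathbb R^d)$ such that $\langle T,\varphi\rangle=\int_{\mathbb R^d} T\varphi\,dx$ for all $\varphi\in C_c^\infty(\mathbb R^d)$. Let $$I_{2s}(x)=A_{2s}|x|^{2s-d},\qquad A_{2s}=\frac{\Gamma\big(\frac{d-2s}{2}\big)}{\pi^{d/2}\,2^{2s}\,\Gamma(s)}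 .$$ Then the Riesz potential $(I_{2s}*T)(x)=\int_{\mathbb R^d} I_{2s}(x-y)T(y)\,dy$ converges absolutely for a.e. $x\in\mathbb R^d$. There is exactly one weak solution $U_T\in\mathring H^s(\mathbb R^d)$ of $(-\Delta)^su=T$, that is, one element with $$\langle T,\varphi\rangle=\langle U_T,\varphi\rangle_{\mathring H^s}\qquad\text{for all }\varphi\in\mathring H^s(\mathbb R^d),$$ and $$U_T=I_{2s}*T\quad\text{a.e. in }\mathbb R^d .$$ Moreover, $I_{2s}*T$ is a distributional solution of $(-\Delta)^su=T$ in $\mathbb R^d$, and every distributional solution $u\in\mathring H^s(\mathbb R^d)$ of this equation equals $I_{2s}*T$ a.e. Here $u$ is a distributional solution if $u\in L^1_{loc}(\mathbb R^d)$, $\int_{\mathbb R^d}\frac{|u(x)|}{(1+|x|)^{d+2s}}dx<\infty$ and $\int_{\mathbb R^d} u\,(-\Delta)^s\varphi\,dx=\int_{\mathbb R^d} T\varphi\,dx$ for all $\varphi\in C_c^\infty(\mathbb R^d)$, where $(-\Delta)^s\varphi=\mathscr F^{-1}\big[|\cdot|^{2s}\mathscr F[\varphi]\big]$. -/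

import Mathlib

open MeasureTheory
open scoped ENNReal SchwartzMap FourierTransform ContDiff

noncomputable section

/-- `g` is the (distributional) Fourier transform of the real function `u`: both are locally
integrable functions defining tempered distributions, and `⟨g, φ⟩ = ⟨u, 𝓕 φ⟩` for every Schwartz
function `φ`. As everywhere in Mathlib, `𝓕 φ ξ = ∫ exp (-2πi x·ξ) φ x dx`. -/
structure IsFourierTransformOf {d : ℕ} (g : EuclideanSpace ℝ (Fin d) → ℂ)
    (u : EuclideanSpace ℝ (Fin d) → ℝ) : Prop where
  locallyIntegrable_fun : LocallyIntegrable u volume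
  locallyIntegrable : LocallyIntegrable g volume
  integrable_fun_mul : ∀ φ : 𝓢(EuclideanSpace ℝ (Fin d), ℂ),
    Integrable (fun x => (u x : ℂ) * φ x) volume
  integrable_mul : ∀ φ : 𝓢(EuclideanSpace ℝ (Fin d), ℂ), Integrable (fun ξ => g ξ * φ ξ) volume
  integral_eq : ∀ φ : 𝓢(EuclideanSpace ℝ (Fin d), ℂ),
    ∫ ξ, g ξ * φ ξ = ∫ x, (u x : ℂ) * (𝓕 φ) x

namespace IsFourierTransformOf

variable {d : ℕ} {g h : EuclideanSpace ℝ (Fin d) → ℂ} {u v : EuclideanSpace ℝ (Fin d) → ℝ}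

theorem congr_fun (H : IsFourierTransformOf g u) (huv : u =ᵐ[volume] v) :
    IsFourierTransformOf g v where
  locallyIntegrable_fun := H.locallyIntegrable_fun.congr huv
  locallyIntegrable := H.locallyIntegrable
  integrable_fun_mul φ := (H.integrable_fun_mul φ).congr (by
    filter_upwards [huv] with x hx
    rw [hx])
  integrable_mul := H.integrable_mul
  integral_eq φ := by
    rw [H.integral_eq φ]
    refine integral_congr_ae ?_
    filter_upwards [huv] with x hx
    rw [hx]

theorem zero : IsFourierTransformOf (0 : EuclideanSpace ℝ (Fin d) → ℂ) 0 where
  locallyIntegrable_fun := locallyIntegrable_zero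
  locallyIntegrable := locallyIntegrable_zero
  integrable_fun_mul φ := by simp
  integrable_mul φ := by simp
  integral_eq φ := by simp

theorem add (H : IsFourierTransformOf g u) (K : IsFourierTransformOf h v) :
    IsFourierTransformOf (g + h) (u + v) where
  locallyIntegrable_fun := H.locallyIntegrable_fun.add K.locallyIntegrable_fun
  locallyIntegrable := H.locallyIntegrable.add K.locallyIntegrable
  integrable_fun_mul φ := by
    refine ((H.integrable_fun_mul φ).add (K.integrable_fun_mul φ)).congr ?_
    exact Filter.Eventually.of_forall fun x => by simp [add_mul]
  integrable_mul φ := by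
    refine ((H.integrable_mul φ).add (K.integrable_mul φ)).congr ?_
    exact Filter.Eventually.of_forall fun ξ => by simp [add_mul]
  integral_eq φ := by
    simp only [Pi.add_apply, Complex.ofReal_add, add_mul]
    rw [integral_add (H.integrable_mul φ) (K.integrable_mul φ),
      integral_add (H.integrable_fun_mul _) (K.integrable_fun_mul _), H.integral_eq, K.integral_eq]

theorem smul (c : ℝ) (H : IsFourierTransformOf g u) : IsFourierTransformOf (c • g) (c • u) where
  locallyIntegrable_fun := H.locallyIntegrable_fun.smul c
  locallyIntegrable := H.locallyIntegrable.smul c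
  integrable_fun_mul φ := by
    simpa [mul_assoc] using (H.integrable_fun_mul φ).const_mul (c : ℂ)
  integrable_mul φ := by simpa [mul_assoc] using (H.integrable_mul φ).const_mul (c : ℂ)
  integral_eq φ := by
    simp only [Pi.smul_apply, smul_eq_mul, Complex.real_smul, Complex.ofReal_mul, mul_assoc]
    rw [integral_const_mul, integral_const_mul, H.integral_eq]

/-- The Fourier transform is unique up to a null set. -/
theorem ae_eq (H : IsFourierTransformOf g u) (K : IsFourierTransformOf h u) :
    g =ᵐ[volume] h := by
  refine ae_eq_of_integral_contDiff_smul_eq H.locallyIntegrable K.locallyIntegrable ?_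
  intro φ hφ hc
  have hc' : HasCompactSupport (fun x => (φ x : ℂ)) := hc.comp_left Complex.ofReal_zero
  have hφ' : ContDiff ℝ ∞ (fun x => (φ x : ℂ)) := Complex.ofRealCLM.contDiff.comp hφ
  have e := (H.integral_eq (hc'.toSchwartzMap hφ')).trans
    (K.integral_eq (hc'.toSchwartzMap hφ')).symm
  simpa [Complex.real_smul, mul_comm] using e

end IsFourierTransformOf

/-- The critical Sobolev exponent `2d / (d - 2s)`, for `0 < s < d / 2`. -/
def sobolevExponent (d : ℕ) (s : ℝ) : ℝ≥0∞ := ENNReal.ofReal (2 * d / (d - 2 * s))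

/-- The weighted transform `ξ ↦ (2π|ξ|)^s g(ξ)`. With Mathlib's Fourier transform `g = 𝓕 u` this is
`ξ ↦ |ξ|^s û(ξ)` for the unitary transform `û` with kernel `(2π)^(-d/2) exp (-i x·ξ)`, up
to the change of variables `ξ ↦ 2πξ`, which preserves `L²` norms and inner products. -/
def sobolevWeight {d : ℕ} (s : ℝ) (g : EuclideanSpace ℝ (Fin d) → ℂ) :
    EuclideanSpace ℝ (Fin d) → ℂ :=
  fun ξ => (((2 * Real.pi * ‖ξ‖) ^ s : ℝ) : ℂ) * g ξ

/-- The homogeneous fractional Sobolev space of order `s`, as a real vector space: the (classes of)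
real functions `u ∈ L^{2d/(d-2s)}(ℝ^d)` whose Fourier transform is a function with
`∫ |ξ|^{2s} |û(ξ)|² dξ < ∞`. -/
def homSobolevSubmodule (d : ℕ) (s : ℝ) :
    Submodule ℝ (Lp ℝ (sobolevExponent d s) (volume : Measure (EuclideanSpace ℝ (Fin d)))) where
  carrier := {u | ∃ g : EuclideanSpace ℝ (Fin d) → ℂ,
    IsFourierTransformOf g u ∧ MemLp (sobolevWeight s g) 2 volume}
  zero_mem' := by
    refine ⟨0, IsFourierTransformOf.zero.congr_fun (Lp.coeFn_zero _ _ _).symm, ?_⟩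
    have : sobolevWeight s (0 : EuclideanSpace ℝ (Fin d) → ℂ) = 0 := by
      funext ξ; simp [sobolevWeight]
    rw [this]
    exact MemLp.zero
  add_mem' := by
    rintro u v ⟨g, hg, hg'⟩ ⟨h, hh, hh'⟩
    refine ⟨g + h, (hg.add hh).congr_fun (Lp.coeFn_add u v).symm, ?_⟩
    have : sobolevWeight s (g + h) = sobolevWeight s g + sobolevWeight s h := by
      funext ξ; simp [sobolevWeight, mul_add]
    rw [this]
    exact hg'.add hh'
  smul_mem' := by
    rintro c u ⟨g, hg, hg'⟩
    refine ⟨c • g, (hg.smul c).congr_fun (Lp.coeFn_smul c u).symm, ?_⟩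
    have : sobolevWeight s (c • g) = c • sobolevWeight s g := by
      funext ξ; simp [sobolevWeight, mul_left_comm]
    rw [this]
    exact hg'.const_smul c

/-- The homogeneous fractional Sobolev space of order `s` on `ℝ^d`. It is a type of its own, so that
it carries the Sobolev inner product below and not the norm of `L^{2d/(d-2s)}`. -/
def HomSobolev (d : ℕ) (s : ℝ) : Type := homSobolevSubmodule d s

namespace HomSobolev

variable {d : ℕ} {s : ℝ}

instance : AddCommGroup (HomSobolev d s) := inferInstanceAs (AddCommGroup (homSobolevSubmodule d s))

instance : Module ℝ (HomSobolev d s) := inferInstanceAs (Module ℝ (homSobolevSubmodule d s))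

/-- The underlying class in `L^{2d/(d-2s)}`. -/
def toLp (u : HomSobolev d s) :
    Lp ℝ (sobolevExponent d s) (volume : Measure (EuclideanSpace ℝ (Fin d))) :=
  Subtype.val u

instance : CoeFun (HomSobolev d s) fun _ => EuclideanSpace ℝ (Fin d) → ℝ :=
  ⟨fun u => u.toLp⟩

/-- The Fourier transform of an element of the space (a function, unique up to a null set). -/
def fourier (u : HomSobolev d s) : EuclideanSpace ℝ (Fin d) → ℂ := Classical.choose u.2

theorem isFourierTransformOf (u : HomSobolev d s) : IsFourierTransformOf u.fourier u :=
  (Classical.choose_spec u.2).1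

theorem memLp_sobolevWeight (u : HomSobolev d s) : MemLp (sobolevWeight s u.fourier) 2 volume :=
  (Classical.choose_spec u.2).2

theorem fourier_add (u v : HomSobolev d s) :
    (u + v).fourier =ᵐ[volume] u.fourier + v.fourier :=
  (u + v).isFourierTransformOf.ae_eq
    ((u.isFourierTransformOf.add v.isFourierTransformOf).congr_fun
      (Lp.coeFn_add u.toLp v.toLp).symm)

theorem fourier_smul (c : ℝ) (u : HomSobolev d s) :
    (c • u).fourier =ᵐ[volume] c • u.fourier :=
  (c • u).isFourierTransformOf.ae_eq
    ((u.isFourierTransformOf.smul c).congr_fun (Lp.coeFn_smul c u.toLp).symm)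

/-- The inner product `∫ |ξ|^{2s} û(ξ) conj(v̂(ξ)) dξ`, written with Mathlib's Fourier transform as
`∫ (2π|ξ|)^s 𝓕u(ξ) · conj ((2π|ξ|)^s 𝓕v(ξ)) dξ`. For real functions this integral is real; the real
part makes its value a real number by definition. -/
def sobolevInner (u v : HomSobolev d s) : ℝ :=
  ∫ ξ, (sobolevWeight s u.fourier ξ * (starRingEnd ℂ) (sobolevWeight s v.fourier ξ)).re

theorem integrable_sobolevInner (u v : HomSobolev d s) :
    Integrable (fun ξ => (sobolevWeight s u.fourier ξ *
      (starRingEnd ℂ) (sobolevWeight s v.fourier ξ)).re) volume :=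
  (u.memLp_sobolevWeight.integrable_mul v.memLp_sobolevWeight.star).re

/-- The Sobolev inner product satisfies the axioms of a positive semidefinite inner product. (It is
definite in all dimensions `d ≥ 1`.) -/
abbrev innerCore : PreInnerProductSpace.Core ℝ (HomSobolev d s) where
  inner u v := sobolevInner u v
  conj_inner_symm u v := by
    simp only [sobolevInner, conj_trivial]
    refine integral_congr_ae (Filter.Eventually.of_forall fun ξ => ?_)
    simp only [Complex.mul_re, Complex.conj_re, Complex.conj_im]
    ring
  re_inner_nonneg u := by
    refine integral_nonneg fun ξ => ?_
    simp only [Pi.zero_apply, Complex.mul_re, Complex.conj_re, Complex.conj_im]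
    nlinarith [mul_self_nonneg (sobolevWeight s u.fourier ξ).re,
      mul_self_nonneg (sobolevWeight s u.fourier ξ).im]
  add_left u v w := by
    simp only [sobolevInner]
    rw [← integral_add (integrable_sobolevInner u w) (integrable_sobolevInner v w)]
    refine integral_congr_ae ?_
    filter_upwards [fourier_add u v] with ξ hξ
    simp only [sobolevWeight, hξ, Pi.add_apply, mul_add, add_mul, Complex.add_re]
  smul_left u v c := by
    simp only [sobolevInner, conj_trivial]
    rw [← integral_const_mul]
    refine integral_congr_ae ?_
    filter_upwards [fourier_smul c u] with ξ hξ
    simp only [sobolevWeight, hξ, Pi.smul_apply, Complex.real_smul]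
    rw [mul_left_comm, mul_assoc, Complex.re_ofReal_mul]

instance : SeminormedAddCommGroup (HomSobolev d s) :=
  @InnerProductSpace.Core.toSeminormedAddCommGroup ℝ _ _ _ _ innerCore

instance : InnerProductSpace ℝ (HomSobolev d s) := InnerProductSpace.ofCore innerCore

end HomSobolev

/-- The functional `τ` on the homogeneous Sobolev space is the regular distribution given by the
function `T`: `⟨τ, φ⟩ = ∫ T φ` for all `φ ∈ C_c^∞(ℝ^d)`. -/
def IsRegularDistribution {d : ℕ} {s : ℝ} (τ : StrongDual ℝ (HomSobolev d s))
    (T : EuclideanSpace ℝ (Fin d) → ℝ) : Prop :=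
  ∀ (φ : EuclideanSpace ℝ (Fin d) → ℝ) (ψ : HomSobolev d s), ContDiff ℝ ∞ φ →
    HasCompactSupport φ → ψ =ᵐ[volume] φ → τ ψ = ∫ x, T x * φ x

/-- `U` is a weak solution of `(-Δ)^s u = τ`: `⟨τ, φ⟩ = ⟨U, φ⟩` for all `φ` in the space. -/
def IsWeakSolution {d : ℕ} {s : ℝ} (τ : StrongDual ℝ (HomSobolev d s)) (U : HomSobolev d s) :
    Prop :=
  ∀ φ : HomSobolev d s, τ φ = inner ℝ U φ

/-- The fractional Laplacian `(-Δ)^s φ = 𝓕⁻¹ (|ξ|^{2s} 𝓕 φ)` of a real test function; in Mathlib's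
normalization of `𝓕` the symbol is `(2π|ξ|)^{2s}`. -/
def fracLaplacian {d : ℕ} (s : ℝ) (φ : EuclideanSpace ℝ (Fin d) → ℝ) :
    EuclideanSpace ℝ (Fin d) → ℝ :=
  fun x => (𝓕⁻ (fun ξ : EuclideanSpace ℝ (Fin d) =>
    (((2 * Real.pi * ‖ξ‖) ^ (2 * s) : ℝ) : ℂ) *
      𝓕 (fun y : EuclideanSpace ℝ (Fin d) => (φ y : ℂ)) ξ) x).re

/-- `u` is a distributional solution of `(-Δ)^s u = T` on `ℝ^d`: `u` is locally integrable with
`∫ |u(x)| / (1 + |x|)^{d+2s} dx < ∞`, and `∫ u (-Δ)^s φ = ∫ T φ` for all `φ ∈ C_c^∞(ℝ^d)`. -/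
structure IsDistributionalSolution {d : ℕ} (s : ℝ) (T u : EuclideanSpace ℝ (Fin d) → ℝ) :
    Prop where
  locallyIntegrable : LocallyIntegrable u volume
  integrable_weighted : Integrable (fun x => |u x| / (1 + ‖x‖) ^ ((d : ℝ) + 2 * s)) volume
  integral_eq : ∀ φ : EuclideanSpace ℝ (Fin d) → ℝ, ContDiff ℝ ∞ φ → HasCompactSupport φ →
    ∫ x, u x * fracLaplacian s φ x = ∫ x, T x * φ x

/-- The Riesz kernel `I_α(x) = A_α |x|^{α-d}`, with
`A_α = Γ((d-α)/2) / (π^{d/2} 2^α Γ(α/2))`, for `0 < α < d`. -/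
def rieszKernel (d : ℕ) (α : ℝ) (x : EuclideanSpace ℝ (Fin d)) : ℝ :=
  Real.Gamma ((d - α) / 2) / (Real.pi ^ ((d : ℝ) / 2) * 2 ^ α * Real.Gamma (α / 2)) *
    ‖x‖ ^ (α - d)

/-- The Riesz potential `I_α * T`, a convolution. -/
def rieszPotential {d : ℕ} (α : ℝ) (T : EuclideanSpace ℝ (Fin d) → ℝ) :
    EuclideanSpace ℝ (Fin d) → ℝ :=
  convolution (rieszKernel d α) T (ContinuousLinearMap.mul ℝ ℝ) volume

end

/-!
The Riesz representation theorem produces the weak solution `U`. Among test functions, those of the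
form `φ` with its low frequencies removed have a Riesz potential in the homogeneous Sobolev space
that decays fast enough for Fubini, so `U` and `I_{2s} * T` have the same pairing with them. Hence
the Fourier transform of `U - I_{2s} * T` is supported at the origin, and a function of weighted
growth less than that of a constant whose Fourier transform lives at the origin vanishes.
Distributional solutions are weak solutions, since the fractional Laplacian of a test function is
the limit of Fourier multipliers that are cut off near the origin.
-/

open Filter Topology Module

section Weights

variable {V : Type*} [NormedAddCommGroup V]

theorem rpow_neg_mul_rpow_neg_le_of_le {p q c A B Y : ℝ} (hc : 0 ≤ c) (hcq : c ≤ q)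
    (hA : 0 < A) (hAB : A ≤ B) (hY : 0 < Y) (hYAB : Y ≤ A + B) :
    A ^ (-p) * B ^ (-q) ≤ (Y / 2) ^ (-c) * A ^ (-(p + q - c)) := by
  have hB : 0 < B := hA.trans_le hAB
  have hBY : B ^ (-c) ≤ (Y / 2) ^ (-c) :=
    Real.rpow_le_rpow_of_nonpos (by positivity) (by linarith) (by linarith)
  have hBA : B ^ (c - q) ≤ A ^ (c - q) := Real.rpow_le_rpow_of_nonpos hA hAB (by linarith)
  calc A ^ (-p) * B ^ (-q) = A ^ (-p) * (B ^ (-c) * B ^ (c - q)) := by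
        rw [← Real.rpow_add hB]; ring_nf
    _ ≤ A ^ (-p) * ((Y / 2) ^ (-c) * A ^ (c - q)) := by gcongr
    _ = (Y / 2) ^ (-c) * (A ^ (-p) * A ^ (c - q)) := by ring
    _ = (Y / 2) ^ (-c) * A ^ (-(p + q - c)) := by rw [← Real.rpow_add hA]; ring_nf

theorem rpow_neg_mul_rpow_neg_le {p q c A B Y : ℝ} (hc : 0 ≤ c) (hcp : c ≤ p) (hcq : c ≤ q)
    (hA : 0 < A) (hB : 0 < B) (hY : 0 < Y) (hYAB : Y ≤ A + B) :
    A ^ (-p) * B ^ (-q) ≤ (Y / 2) ^ (-c) * (A ^ (-(p + q - c)) + B ^ (-(p + q - c))) := by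
  rcases le_total A B with h | h
  · refine (rpow_neg_mul_rpow_neg_le_of_le hc hcq hA h hY hYAB).trans ?_
    gcongr
    exact le_add_of_nonneg_right (by positivity)
  · rw [mul_comm, add_comm p q]
    refine (rpow_neg_mul_rpow_neg_le_of_le hc hcp hB h hY (by linarith)).trans ?_
    gcongr
    exact le_add_of_nonneg_left (by positivity)

theorem one_add_norm_sub_rpow_neg_le {a : ℝ} (ha : 0 ≤ a) (x y : V) :
    (1 + ‖x - y‖) ^ (-a) ≤ (1 + ‖x‖) ^ (-a) * (1 + ‖y‖) ^ a := by
  have h : 1 + ‖x‖ ≤ (1 + ‖x - y‖) * (1 + ‖y‖) := by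
    nlinarith [norm_sub_norm_le x y, norm_nonneg (x - y), norm_nonneg y]
  have hpow : (1 + ‖x‖) ^ a ≤ (1 + ‖x - y‖) ^ a * (1 + ‖y‖) ^ a := by
    rw [← Real.mul_rpow (by positivity) (by positivity)]
    exact Real.rpow_le_rpow (by positivity) h ha
  rw [Real.rpow_neg (by positivity), Real.rpow_neg (by positivity), inv_mul_eq_div,
    inv_eq_one_div, div_le_div_iff₀ (by positivity) (by positivity), one_mul, mul_comm]
  exact hpow

theorem norm_smul_le_of_norm_le {F : Type*} [NormedAddCommGroup F] [NormedSpace ℝ F] (v : V → ℝ)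
    {ψ : V → F} {a C : ℝ} (hC : ∀ x, ‖ψ x‖ ≤ C * (1 + ‖x‖) ^ (-a)) (x : V) :
    ‖v x • ψ x‖ ≤ C * ‖v x * (1 + ‖x‖) ^ (-a)‖ := by
  rw [norm_smul, norm_mul, Real.norm_of_nonneg (r := (1 + ‖x‖) ^ (-a)) (by positivity),
    mul_left_comm]
  gcongr
  exact hC x

theorem continuous_one_add_norm_rpow (a : ℝ) : Continuous fun x : V => (1 + ‖x‖) ^ a :=
  (continuous_const.add continuous_norm).rpow_const fun x =>
    Or.inl (by positivity : (0 : ℝ) < 1 + ‖x‖).ne'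

theorem norm_rpow_neg_le_indicator_add {b : ℝ} (hb : 0 ≤ b) (z : V) :
    ‖z‖ ^ (-b) ≤
      (Metric.ball (0 : V) 1).indicator (fun w => ‖w‖ ^ (-b)) z + 2 ^ b * (1 + ‖z‖) ^ (-b) := by
  by_cases hz : z ∈ Metric.ball (0 : V) 1
  · rw [Set.indicator_of_mem hz]
    exact le_add_of_nonneg_right (by positivity)
  · have hz1 : 1 ≤ ‖z‖ := by simpa using hz
    rw [Set.indicator_of_notMem hz, zero_add]
    calc ‖z‖ ^ (-b) ≤ ((1 + ‖z‖) / 2) ^ (-b) :=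
          Real.rpow_le_rpow_of_nonpos (by positivity) (by linarith) (by linarith)
      _ = 2 ^ b * (1 + ‖z‖) ^ (-b) := by
          rw [Real.div_rpow (by positivity) zero_le_two, Real.rpow_neg zero_le_two,
            div_inv_eq_mul, mul_comm]

theorem indicator_ball_sub_mul_le {f : V → ℝ} (hf : ∀ x, 0 ≤ f x) {a : ℝ} (ha : 0 ≤ a) (x y : V) :
    (Metric.ball (0 : V) 1).indicator f (y - x) * (1 + ‖x‖) ^ (-a) ≤
      2 ^ a * (1 + ‖y‖) ^ (-a) * (Metric.ball (0 : V) 1).indicator f (y - x) := by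
  by_cases hxy : y - x ∈ Metric.ball (0 : V) 1
  · rw [Set.indicator_of_mem hxy, mul_comm]
    have hnorm : ‖y - x‖ < 1 := by simpa using hxy
    gcongr
    · exact hf _
    calc (1 + ‖x‖) ^ (-a) ≤ (1 + ‖y‖) ^ (-a) * (1 + ‖y - x‖) ^ a := by
          simpa using one_add_norm_sub_rpow_neg_le ha y (y - x)
      _ ≤ (1 + ‖y‖) ^ (-a) * 2 ^ a := by
          gcongr
          linarith
      _ = 2 ^ a * (1 + ‖y‖) ^ (-a) := mul_comm _ _
  · simp [Set.indicator_of_notMem hxy]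

variable [NormedSpace ℝ V] [FiniteDimensional ℝ V] [MeasurableSpace V] [BorelSpace V]

theorem memLp_one_add_norm_rpow_neg (μ : Measure V) [μ.IsAddHaarMeasure] {a p : ℝ} (hp : 0 < p)
    (ha : finrank ℝ V < a * p) :
    MemLp (fun x : V => (1 + ‖x‖) ^ (-a)) (ENNReal.ofReal p) μ := by
  rw [← integrable_norm_rpow_iff (continuous_one_add_norm_rpow _).aestronglyMeasurable
    (by simpa using hp) ENNReal.ofReal_ne_top, ENNReal.toReal_ofReal hp.le]
  refine (integrable_one_add_norm (μ := μ) ha).congr (Eventually.of_forall fun x => ?_)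
  beta_reduce
  rw [Real.norm_of_nonneg (by positivity), ← Real.rpow_mul (by positivity), neg_mul]

theorem integrableOn_ball_norm_rpow_neg (μ : Measure V) [μ.IsAddHaarMeasure] {b : ℝ}
    (hV : 1 ≤ finrank ℝ V) (hb : b < finrank ℝ V) (r : ℝ) :
    IntegrableOn (fun x : V => ‖x‖ ^ (-b)) (Metric.ball 0 r) μ := by
  refine integrableOn_ball_of_norm_le_rpow (C := 1) (α := b) hV hb ?_
    (measurable_norm.pow_const _).aestronglyMeasurable
  refine Eventually.of_forall fun x => ?_
  rw [Real.norm_of_nonneg (by positivity), one_mul]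

variable (μ : Measure V) [μ.IsAddHaarMeasure]

theorem exists_integral_one_add_norm_conv_le {p q c : ℝ} (hc : 0 ≤ c) (hcp : c ≤ p) (hcq : c ≤ q)
    (h : finrank ℝ V < p + q - c) :
    ∃ C, ∀ y : V, Integrable (fun x => (1 + ‖y - x‖) ^ (-p) * (1 + ‖x‖) ^ (-q)) μ ∧
      ∫ x, (1 + ‖y - x‖) ^ (-p) * (1 + ‖x‖) ^ (-q) ∂μ ≤ C * (1 + ‖y‖) ^ (-c) := by
  set w : V → ℝ := fun x => (1 + ‖x‖) ^ (-(p + q - c))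
  have hw : Integrable w μ := integrable_one_add_norm h
  refine ⟨2 ^ c * (2 * ∫ x, w x ∂μ), fun y => ?_⟩
  have hle (x : V) : (1 + ‖y - x‖) ^ (-p) * (1 + ‖x‖) ^ (-q) ≤
      ((1 + ‖y‖) / 2) ^ (-c) * (w (y - x) + w x) :=
    rpow_neg_mul_rpow_neg_le hc hcp hcq (by positivity) (by positivity) (by positivity)
      (by linarith [norm_sub_norm_le y x])
  have hbd : Integrable (fun x => ((1 + ‖y‖) / 2) ^ (-c) * (w (y - x) + w x)) μ :=
    ((hw.comp_sub_left y).add hw).const_mul _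
  have hint : Integrable (fun x => (1 + ‖y - x‖) ^ (-p) * (1 + ‖x‖) ^ (-q)) μ := by
    refine hbd.mono' ?_ (Eventually.of_forall fun x => ?_)
    · exact (((continuous_one_add_norm_rpow _).comp (continuous_const.sub continuous_id)).mul
        (continuous_one_add_norm_rpow _)).aestronglyMeasurable
    · rw [Real.norm_of_nonneg (by positivity)]
      exact hle x
  refine ⟨hint, (integral_mono hint hbd hle).trans_eq ?_⟩
  rw [integral_const_mul, integral_add (hw.comp_sub_left y) hw, integral_sub_left_eq_self w μ y,
    Real.div_rpow (by positivity) zero_le_two, Real.rpow_neg zero_le_two, div_inv_eq_mul]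
  ring

theorem exists_integral_norm_rpow_conv_one_add_norm_le {a b c : ℝ} (hb : 0 ≤ b)
    (hbn : b < finrank ℝ V) (hc : 0 ≤ c) (hcb : c ≤ b) (hcab : c + finrank ℝ V < a + b) :
    ∃ C, ∀ y : V, Integrable (fun x => ‖y - x‖ ^ (-b) * (1 + ‖x‖) ^ (-a)) μ ∧
      ∫ x, ‖y - x‖ ^ (-b) * (1 + ‖x‖) ^ (-a) ∂μ ≤ C * (1 + ‖y‖) ^ (-c) := by
  have hca : c ≤ a := by linarith
  have ha : 0 ≤ a := hc.trans hca
  have hV : 1 ≤ finrank ℝ V := by exact_mod_cast hb.trans_lt hbn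
  obtain ⟨C, hC⟩ := exists_integral_one_add_norm_conv_le μ (p := b) (q := a) hc hcb hca
    (by linarith)
  set k : V → ℝ := (Metric.ball (0 : V) 1).indicator fun x => ‖x‖ ^ (-b)
  have hk : Integrable k μ := (integrableOn_ball_norm_rpow_neg μ hV hbn 1).integrable_indicator
    Metric.isOpen_ball.measurableSet
  have hk0 (x : V) : 0 ≤ k x := Set.indicator_nonneg (fun x _ => by positivity) x
  refine ⟨2 ^ a * ∫ x, k x ∂μ + 2 ^ b * C, fun y => ?_⟩
  obtain ⟨hfar, hfar_le⟩ := hC y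
  have hle (x : V) : ‖y - x‖ ^ (-b) * (1 + ‖x‖) ^ (-a) ≤ 2 ^ a * (1 + ‖y‖) ^ (-a) * k (y - x) +
      2 ^ b * ((1 + ‖y - x‖) ^ (-b) * (1 + ‖x‖) ^ (-a)) :=
    calc ‖y - x‖ ^ (-b) * (1 + ‖x‖) ^ (-a)
        ≤ (k (y - x) + 2 ^ b * (1 + ‖y - x‖) ^ (-b)) * (1 + ‖x‖) ^ (-a) := by
          gcongr
          exact norm_rpow_neg_le_indicator_add hb _
      _ = k (y - x) * (1 + ‖x‖) ^ (-a) + 2 ^ b * ((1 + ‖y - x‖) ^ (-b) * (1 + ‖x‖) ^ (-a)) := by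
          ring
      _ ≤ _ := by
          gcongr ?_ + _
          exact indicator_ball_sub_mul_le (fun x => by positivity) ha x y
  have hnear := (hk.comp_sub_left y).const_mul (2 ^ a * (1 + ‖y‖) ^ (-a))
  have hbd := hnear.add (hfar.const_mul (2 ^ b))
  have hint : Integrable (fun x => ‖y - x‖ ^ (-b) * (1 + ‖x‖) ^ (-a)) μ := by
    refine hbd.mono' (by fun_prop) (Eventually.of_forall fun x => ?_)
    rw [Real.norm_of_nonneg (by positivity)]
    exact hle x
  refine ⟨hint, ?_⟩
  calc ∫ x, ‖y - x‖ ^ (-b) * (1 + ‖x‖) ^ (-a) ∂μ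
      ≤ 2 ^ a * (1 + ‖y‖) ^ (-a) * (∫ x, k x ∂μ) +
          2 ^ b * ∫ x, (1 + ‖y - x‖) ^ (-b) * (1 + ‖x‖) ^ (-a) ∂μ := by
        refine (integral_mono hint hbd hle).trans_eq ?_
        rw [integral_add' hnear (hfar.const_mul _), integral_const_mul, integral_const_mul,
          integral_sub_left_eq_self k μ y]
    _ ≤ 2 ^ a * (1 + ‖y‖) ^ (-c) * (∫ x, k x ∂μ) + 2 ^ b * (C * (1 + ‖y‖) ^ (-c)) := by
        gcongr
        · exact integral_nonneg hk0
        · linarith [norm_nonneg y]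
    _ = _ := by ring

end Weights

section WeightedIntegrable

variable {V : Type*} [NormedAddCommGroup V] [MeasurableSpace V] {μ : Measure V} {v w : V → ℝ}
  {a b : ℝ}

/-- Integrability against the weight `(1 + ‖x‖)^(-a)`. For `a = d + 2s` this is the growth condition
under which the fractional Laplacian of order `s` makes sense distributionally. -/
def WeightedIntegrable (a : ℝ) (v : V → ℝ) (μ : Measure V) : Prop :=
  Integrable (fun x => v x * (1 + ‖x‖) ^ (-a)) μ

namespace WeightedIntegrable

theorem sub (hv : WeightedIntegrable a v μ) (hw : WeightedIntegrable a w μ) :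
    WeightedIntegrable a (fun x => v x - w x) μ :=
  (Integrable.sub hv hw).congr (Eventually.of_forall fun _ => (sub_mul _ _ _).symm)

theorem integrable_abs_div (hv : WeightedIntegrable a v μ) :
    Integrable (fun x => |v x| / (1 + ‖x‖) ^ a) μ := by
  refine (Integrable.norm hv).congr (Eventually.of_forall fun x => ?_)
  beta_reduce
  rw [norm_mul, Real.norm_eq_abs, Real.norm_of_nonneg (by positivity),
    Real.rpow_neg (by positivity), div_eq_mul_inv]

variable [BorelSpace V]

theorem aestronglyMeasurable (hv : WeightedIntegrable a v μ) : AEStronglyMeasurable v μ := by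
  refine (Integrable.aestronglyMeasurable hv |>.mul
    (continuous_one_add_norm_rpow a).measurable.aestronglyMeasurable).congr
    (Eventually.of_forall fun x => ?_)
  simp only [Pi.mul_apply]
  rw [mul_assoc, ← Real.rpow_add (by positivity), neg_add_cancel, Real.rpow_zero, mul_one]

section Pairing

variable {F : Type*} [NormedAddCommGroup F] [NormedSpace ℝ F]

theorem integrable_smul {ψ : V → F} {C : ℝ} (hv : WeightedIntegrable a v μ)
    (hψ : AEStronglyMeasurable ψ μ) (hC : ∀ x, ‖ψ x‖ ≤ C * (1 + ‖x‖) ^ (-a)) :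
    Integrable (fun x => v x • ψ x) μ :=
  ((Integrable.norm hv).const_mul C).mono' (hv.aestronglyMeasurable.smul hψ)
    (Eventually.of_forall (norm_smul_le_of_norm_le v hC))

theorem tendsto_integral_smul {ψ : ℕ → V → F} {ψ' : V → F} {C : ℝ} (hv : WeightedIntegrable a v μ)
    (hψ : ∀ k, AEStronglyMeasurable (ψ k) μ) (hC : ∀ k x, ‖ψ k x‖ ≤ C * (1 + ‖x‖) ^ (-a))
    (hlim : ∀ x, Tendsto (fun k => ψ k x) atTop (𝓝 (ψ' x))) :
    Tendsto (fun k => ∫ x, v x • ψ k x ∂μ) atTop (𝓝 (∫ x, v x • ψ' x ∂μ)) := by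
  refine tendsto_integral_of_dominated_convergence (fun x => C * ‖v x * (1 + ‖x‖) ^ (-a)‖)
    (fun k => (hv.integrable_smul (hψ k) (hC k)).aestronglyMeasurable)
    ((Integrable.norm hv).const_mul C)
    (fun k => Eventually.of_forall (norm_smul_le_of_norm_le v (hC k)))
    (Eventually.of_forall fun x => (hlim x).const_smul _)

end Pairing

theorem mono (hv : WeightedIntegrable a v μ) (hab : a ≤ b) : WeightedIntegrable b v μ := by
  refine (Integrable.norm hv).mono' (hv.aestronglyMeasurable.mul
    (continuous_one_add_norm_rpow _).measurable.aestronglyMeasurable)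
    (Eventually.of_forall fun x => ?_)
  rw [norm_mul, norm_mul, Real.norm_of_nonneg (r := (1 + ‖x‖) ^ (-b)) (by positivity),
    Real.norm_of_nonneg (r := (1 + ‖x‖) ^ (-a)) (by positivity)]
  gcongr
  linarith [norm_nonneg x]

theorem locallyIntegrable [LocallyCompactSpace V] (hv : WeightedIntegrable a v μ) :
    LocallyIntegrable v μ := by
  refine ((Integrable.locallyIntegrable hv).continuous_mul
    (continuous_one_add_norm_rpow a)).congr (Eventually.of_forall fun x => ?_)
  beta_reduce
  rw [mul_left_comm, ← Real.rpow_add (by positivity), add_neg_cancel, Real.rpow_zero, mul_one]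

end WeightedIntegrable

variable [NormedSpace ℝ V] [FiniteDimensional ℝ V] [BorelSpace V] [μ.IsAddHaarMeasure]

theorem weightedIntegrable_of_memLp {p : ℝ} (hv : MemLp v (ENNReal.ofReal p) μ) (hp : 1 < p)
    (ha : finrank ℝ V * (1 - 1 / p) < a) : WeightedIntegrable a v μ := by
  have hpq := Real.HolderConjugate.conjExponent hp
  have hq : 0 < p.conjExponent := hpq.symm.pos
  have : ENNReal.HolderConjugate (ENNReal.ofReal p) (ENNReal.ofReal p.conjExponent) :=
    hpq.ennrealOfReal
  refine hv.integrable_mul (memLp_one_add_norm_rpow_neg μ hq ?_)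
  rwa [one_div, hpq.one_sub_inv, ← div_eq_mul_inv, div_lt_iff₀ hq] at ha

end WeightedIntegrable

section RieszPotential

variable {d : ℕ} {α a c : ℝ} {T : EuclideanSpace ℝ (Fin d) → ℝ}

local notation "E" => EuclideanSpace ℝ (Fin d)

theorem measurable_rieszKernel (d : ℕ) (α : ℝ) : Measurable (rieszKernel d α) :=
  (measurable_norm.pow_const _).const_mul _

theorem rieszKernel_sub_comm (x y : E) : rieszKernel d α (x - y) = rieszKernel d α (y - x) := by
  simp only [rieszKernel, norm_sub_rev]

theorem rieszKernel_nonneg (hα : 0 < α) (hαd : α < d) (x : E) : 0 ≤ rieszKernel d α x := by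
  have := Real.Gamma_pos_of_pos (show 0 < (d - α) / 2 by linarith)
  have := Real.Gamma_pos_of_pos (show 0 < α / 2 by linarith)
  rw [rieszKernel]
  positivity

theorem exists_integral_rieszKernel_mul_le (hα : 0 < α) (hαd : α < d)
    (hc : 0 ≤ c) (hca : c + α < a) (hcα : c + α ≤ d) :
    ∃ C, ∀ y : E, Integrable (fun x => rieszKernel d α (x - y) * (1 + ‖x‖) ^ (-a)) ∧
      ∫ x, rieszKernel d α (x - y) * (1 + ‖x‖) ^ (-a) ≤ C * (1 + ‖y‖) ^ (-c) := by
  have hd : (finrank ℝ E : ℝ) = d := by simp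
  obtain ⟨C, hC⟩ := exists_integral_norm_rpow_conv_one_add_norm_le (volume : Measure E)
    (a := a) (b := d - α) (c := c) (by linarith) (by linarith) hc (by linarith) (by linarith)
  set A := Real.Gamma ((d - α) / 2) / (Real.pi ^ ((d : ℝ) / 2) * 2 ^ α * Real.Gamma (α / 2))
    with hA
  have hA0 : 0 ≤ A := (div_pos (Real.Gamma_pos_of_pos (by linarith))
    (mul_pos (by positivity) (Real.Gamma_pos_of_pos (by linarith)))).le
  have hker (y : E) : (fun x => rieszKernel d α (x - y) * (1 + ‖x‖) ^ (-a)) =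
      fun x => A * (‖y - x‖ ^ (-(d - α)) * (1 + ‖x‖) ^ (-a)) := by
    funext x
    rw [rieszKernel_sub_comm, rieszKernel, ← hA, neg_sub, mul_assoc]
  refine ⟨A * C, fun y => ?_⟩
  rw [hker, integral_const_mul, mul_assoc A]
  exact ⟨(hC y).1.const_mul A, mul_le_mul_of_nonneg_left (hC y).2 hA0⟩

theorem integrable_rieszKernel_mul_of_norm_le (hα : 0 < α) (hαd : α < d) (hαa : α < a)
    {ψ : E → ℂ} {C : ℝ} (hψ : AEStronglyMeasurable ψ volume)
    (hC : ∀ x, ‖ψ x‖ ≤ C * (1 + ‖x‖) ^ (-a)) (y : E) :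
    Integrable fun x => (rieszKernel d α (x - y) : ℂ) * ψ x := by
  obtain ⟨D, hD⟩ := exists_integral_rieszKernel_mul_le (d := d) (c := 0) (a := a) hα hαd
    le_rfl (by linarith) (by linarith)
  exact WeightedIntegrable.integrable_smul (hD y).1 hψ hC

theorem integrable_prod_rieszKernel_mul (hα : 0 < α) (hαd : α < d)
    (hc : 0 ≤ c) (hca : c + α < a) (hcα : c + α ≤ d) (hT : WeightedIntegrable c T volume) :
    Integrable (fun p : E × E => rieszKernel d α (p.1 - p.2) * T p.2 * (1 + ‖p.1‖) ^ (-a))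
      (volume.prod volume) := by
  obtain ⟨C, hC⟩ := exists_integral_rieszKernel_mul_le (d := d) hα hαd hc hca hcα
  have hm : AEStronglyMeasurable (fun p : E × E =>
      rieszKernel d α (p.1 - p.2) * T p.2 * (1 + ‖p.1‖) ^ (-a)) (volume.prod volume) :=
    (((measurable_rieszKernel d α).comp
      (measurable_fst.sub measurable_snd)).aestronglyMeasurable.mul
        hT.aestronglyMeasurable.comp_snd).mul
      ((continuous_one_add_norm_rpow _).measurable.comp measurable_fst).aestronglyMeasurable
  refine (integrable_prod_iff' hm).2 ⟨Eventually.of_forall fun y => ?_, ?_⟩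
  · refine ((hC y).1.mul_const (T y)).congr (Eventually.of_forall fun x => ?_)
    beta_reduce
    ring
  refine ((Integrable.norm hT).const_mul C).mono' hm.norm.prod_swap.integral_prod_right'
    (Eventually.of_forall fun y => ?_)
  have hnorm (x : E) : ‖rieszKernel d α (x - y) * T y * (1 + ‖x‖) ^ (-a)‖ =
      ‖T y‖ * (rieszKernel d α (x - y) * (1 + ‖x‖) ^ (-a)) := by
    rw [norm_mul, norm_mul, Real.norm_of_nonneg (rieszKernel_nonneg hα hαd _),
      Real.norm_of_nonneg (r := (1 + ‖x‖) ^ (-a)) (by positivity)]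
    ring
  rw [Real.norm_of_nonneg (integral_nonneg fun x => norm_nonneg _)]
  simp only [hnorm]
  rw [integral_const_mul, norm_mul, Real.norm_of_nonneg (r := (1 + ‖y‖) ^ (-c)) (by positivity),
    mul_left_comm]
  exact mul_le_mul_of_nonneg_left (hC y).2 (norm_nonneg _)

theorem rieszPotential_eq (x : E) :
    rieszPotential α T x = ∫ y, rieszKernel d α (x - y) * T y := by
  rw [rieszPotential, convolution_eq_swap]
  rfl

theorem ae_convolutionExistsAt_rieszKernel (hα : 0 < α) (hαd : α < d)
    (hc : 0 ≤ c) (hcα : c + α < d) (hT : WeightedIntegrable c T volume) :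
    ∀ᵐ x ∂(volume : Measure E),
      ConvolutionExistsAt (rieszKernel d α) T x (ContinuousLinearMap.mul ℝ ℝ) volume := by
  filter_upwards [(integrable_prod_rieszKernel_mul hα hαd hc hcα hcα.le hT).prod_right_ae] with x hx
  rw [convolutionExistsAt_iff_integrable_swap]
  have hweight : IsUnit ((1 + ‖x‖) ^ (-(d : ℝ))) := isUnit_iff_ne_zero.2 (by positivity)
  exact (integrable_mul_const_iff hweight _).1 hx

theorem weightedIntegrable_rieszPotential (hα : 0 < α) (hαd : α < d)
    (hc : 0 ≤ c) (hca : c + α < a) (hcα : c + α ≤ d) (hT : WeightedIntegrable c T volume) :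
    WeightedIntegrable a (rieszPotential α T) volume := by
  refine (integrable_prod_rieszKernel_mul hα hαd hc hca hcα hT).integral_prod_left.congr
    (Eventually.of_forall fun x => ?_)
  simp only [integral_mul_const, rieszPotential_eq]

theorem integral_rieszPotential_mul (hα : 0 < α) (hαd : α < d)
    (hc : 0 ≤ c) (hca : c + α < a) (hcα : c + α ≤ d) (hT : WeightedIntegrable c T volume)
    {ψ : E → ℝ} {C : ℝ} (hψ : AEStronglyMeasurable ψ volume)
    (hC : ∀ x, ‖ψ x‖ ≤ C * (1 + ‖x‖) ^ (-a)) :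
    ∫ x, rieszPotential α T x * ψ x = ∫ y, T y * ∫ x, rieszKernel d α (x - y) * ψ x := by
  have hint : Integrable (fun p : E × E => rieszKernel d α (p.1 - p.2) * T p.2 * ψ p.1)
      (volume.prod volume) := by
    refine ((integrable_prod_rieszKernel_mul hα hαd hc hca hcα hT).norm.const_mul C).mono'
      ((((measurable_rieszKernel d α).comp
        (measurable_fst.sub measurable_snd)).aestronglyMeasurable.mul
          hT.aestronglyMeasurable.comp_snd).mul hψ.comp_fst) (Eventually.of_forall fun p => ?_)
    rw [norm_mul, norm_mul _ ((1 + ‖p.1‖) ^ (-a)),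
      Real.norm_of_nonneg (r := (1 + ‖p.1‖) ^ (-a)) (by positivity), mul_left_comm]
    exact mul_le_mul_of_nonneg_left (hC p.1) (norm_nonneg _)
  calc ∫ x, rieszPotential α T x * ψ x
      = ∫ x, ∫ y, rieszKernel d α (x - y) * T y * ψ x := by
        simp only [rieszPotential_eq, integral_mul_const]
    _ = ∫ y, ∫ x, rieszKernel d α (x - y) * T y * ψ x := integral_integral_swap hint
    _ = ∫ y, T y * ∫ x, rieszKernel d α (x - y) * ψ x := by
        simp only [← integral_const_mul, mul_assoc, mul_left_comm]

end RieszPotential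

section FourierTransform

variable {V : Type*} [NormedAddCommGroup V] [InnerProductSpace ℝ V]

section Schwartz

variable {F : Type*} [NormedAddCommGroup F] [NormedSpace ℝ F]

theorem exists_norm_schwartzMap_le (f : 𝓢(V, F)) (a : ℝ) :
    ∃ C : ℝ, 0 ≤ C ∧ ∀ x, ‖f x‖ ≤ C * (1 + ‖x‖) ^ (-a) := by
  set k := ⌈a⌉₊
  refine ⟨2 ^ k * (Finset.Iic (k, 0)).sup (fun m => SchwartzMap.seminorm ℝ m.1 m.2) f,
    by positivity, fun x => ?_⟩
  have hseminorm := SchwartzMap.one_add_le_sup_seminorm_apply (𝕜 := ℝ) (m := (k, 0))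
    le_rfl le_rfl f x
  rw [norm_iteratedFDeriv_zero] at hseminorm
  have hceil : (1 + ‖x‖) ^ a ≤ (1 + ‖x‖) ^ k := by
    rw [← Real.rpow_natCast]
    exact Real.rpow_le_rpow_of_exponent_le (by linarith [norm_nonneg x]) (Nat.le_ceil a)
  rw [Real.rpow_neg (by positivity), ← div_eq_mul_inv, le_div_iff₀ (by positivity), mul_comm]
  exact (mul_le_mul_of_nonneg_right hceil (norm_nonneg _)).trans hseminorm

theorem integrable_norm_schwartzMap_mul_rpow [FiniteDimensional ℝ V] [MeasurableSpace V]
    [BorelSpace V] (f : 𝓢(V, F)) (a : ℝ) :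
    Integrable (fun x => ‖f x‖ * (1 + ‖x‖) ^ a) volume := by
  obtain ⟨C, -, hf⟩ := exists_norm_schwartzMap_le f (a + (finrank ℝ V + 1))
  have hweight : Integrable (fun x : V => C * (1 + ‖x‖) ^ (-((finrank ℝ V : ℝ) + 1))) volume :=
    (integrable_one_add_norm (by linarith)).const_mul C
  refine hweight.mono' (f.continuous.norm.mul
    (continuous_one_add_norm_rpow a)).aestronglyMeasurable (Eventually.of_forall fun x => ?_)
  rw [norm_mul, norm_norm, Real.norm_of_nonneg (by positivity)]
  refine (mul_le_mul_of_nonneg_right (hf x) (by positivity)).trans_eq ?_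
  rw [mul_assoc, ← Real.rpow_add (by positivity)]
  ring_nf

end Schwartz

variable [FiniteDimensional ℝ V] [MeasurableSpace V] [BorelSpace V]

theorem integrable_fourierChar_smul {f : V → ℂ} (hf : Integrable f) (x : V) :
    Integrable fun ξ => Real.fourierChar (inner ℝ ξ x) • f ξ := by
  refine hf.norm.mono' ?_ (Eventually.of_forall fun ξ => by rw [Circle.norm_smul])
  exact ((Real.continuous_fourierChar.comp
    (continuous_id.inner continuous_const)).aestronglyMeasurable).smul hf.aestronglyMeasurable

theorem continuous_fourierInv {f : V → ℂ} (hf : Integrable f) : Continuous (𝓕⁻ f) := by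
  rw [Real.fourierInv_eq_fourier_comp_neg]
  exact VectorFourier.fourierIntegral_continuous Real.continuous_fourierChar
    (by exact continuous_inner) hf.comp_neg

theorem fourierInv_add_apply {f g : V → ℂ} (hf : Integrable f) (hg : Integrable g) (x : V) :
    𝓕⁻ (fun ξ => f ξ + g ξ) x = 𝓕⁻ f x + 𝓕⁻ g x := by
  simp only [Real.fourierInv_eq, smul_add]
  exact integral_add (integrable_fourierChar_smul hf x) (integrable_fourierChar_smul hg x)

theorem fourierInv_const_mul_apply (c : ℂ) (f : V → ℂ) (x : V) :
    𝓕⁻ (fun ξ => c * f ξ) x = c * 𝓕⁻ f x := by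
  simp only [Real.fourierInv_eq, ← integral_const_mul]
  congr 1 with ξ
  rw [mul_smul_comm]

theorem norm_fourierInv_le (f : V → ℂ) (x : V) : ‖𝓕⁻ f x‖ ≤ ∫ ξ, ‖f ξ‖ := by
  rw [Real.fourierInv_eq]
  refine (norm_integral_le_integral_norm _).trans_eq ?_
  simp only [Circle.norm_smul]

theorem tendsto_fourierInv_of_dominated {F : ℕ → V → ℂ} {G : V → ℂ} {bound : V → ℝ}
    (hF : ∀ k, AEStronglyMeasurable (F k) volume) (hbound : Integrable bound)
    (hle : ∀ k, ∀ᵐ ξ, ‖F k ξ‖ ≤ bound ξ)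
    (hlim : ∀ᵐ ξ, Tendsto (fun k => F k ξ) atTop (𝓝 (G ξ))) (x : V) :
    Tendsto (fun k => 𝓕⁻ (F k) x) atTop (𝓝 (𝓕⁻ G x)) := by
  simp only [Real.fourierInv_eq]
  refine tendsto_integral_of_dominated_convergence bound (fun k => ?_) hbound (fun k => ?_) ?_
  · exact ((Real.continuous_fourierChar.comp
      (continuous_id.inner continuous_const)).aestronglyMeasurable).smul (hF k)
  · simpa only [Circle.norm_smul] using hle k
  · filter_upwards [hlim] with ξ hξ
    exact hξ.const_smul _

theorem conj_fourier (f : V → ℂ) (ξ : V) :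
    (starRingEnd ℂ) (𝓕 f ξ) = 𝓕⁻ (fun x => (starRingEnd ℂ) (f x)) ξ := by
  rw [Real.fourier_eq', Real.fourierInv_eq', ← integral_conj]
  congr 1 with x
  simp only [smul_eq_mul, map_mul, ← Complex.exp_conj, Complex.conj_ofReal, Complex.conj_I]
  congr 2
  push_cast
  ring

theorem conj_fourierInv (f : V → ℂ) (ξ : V) :
    (starRingEnd ℂ) (𝓕⁻ f ξ) = 𝓕 (fun x => (starRingEnd ℂ) (f x)) ξ := by
  rw [← Complex.conj_conj (𝓕 (fun x => (starRingEnd ℂ) (f x)) ξ), conj_fourier]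
  simp only [Complex.conj_conj]

theorem conj_fourier_ofReal (f : V → ℝ) (ξ : V) :
    (starRingEnd ℂ) (𝓕 (fun x => (f x : ℂ)) ξ) = 𝓕 (fun x => (f x : ℂ)) (-ξ) := by
  simp only [conj_fourier, Complex.conj_ofReal, Real.fourierInv_eq_fourier_neg]

theorem integral_fourier_mul_eq_flip {f g : V → ℂ} (hf : Integrable f) (hg : Integrable g) :
    ∫ ξ, 𝓕 f ξ * g ξ = ∫ x, f x * 𝓕 g x := by
  simpa using! VectorFourier.integral_bilin_fourierIntegral_eq_flip (.mul ℂ ℂ) (L := innerₗ V)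
    Real.continuous_fourierChar continuous_inner hf hg

theorem fourierInv_mul_fourier_eq_integral {F ψ : V → ℂ} (hF : Integrable F) (hψ : Integrable ψ)
    (x : V) : 𝓕⁻ (fun ξ => F ξ * 𝓕 ψ ξ) x = ∫ y, ψ y * 𝓕⁻ F (x - y) := by
  have hmodulated (y : V) :
      𝓕 (fun ξ => Real.fourierChar (inner ℝ ξ x) • F ξ) y = 𝓕⁻ F (x - y) := by
    rw [Real.fourier_eq, Real.fourierInv_eq]
    congr 1 with ξ
    rw [smul_smul, ← AddChar.map_add_eq_mul, inner_sub_right]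
    congr 2
    ring
  rw [Real.fourierInv_eq]
  calc ∫ ξ, Real.fourierChar (inner ℝ ξ x) • (F ξ * 𝓕 ψ ξ)
      = ∫ ξ, 𝓕 ψ ξ * (Real.fourierChar (inner ℝ ξ x) • F ξ) := by
        congr 1 with ξ
        rw [mul_comm (F ξ), mul_smul_comm]
    _ = ∫ y, ψ y * 𝓕 (fun ξ => Real.fourierChar (inner ℝ ξ x) • F ξ) y :=
        integral_fourier_mul_eq_flip hψ (integrable_fourierChar_smul hF x)
    _ = ∫ y, ψ y * 𝓕⁻ F (x - y) := by simp only [hmodulated]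

theorem fourierInv_comp_smul (F : V → ℂ) {r : ℝ} (hr : 0 < r) (x : V) :
    𝓕⁻ (fun ξ => F (r • ξ)) x = (r ^ (-(finrank ℝ V : ℝ)) : ℝ) • 𝓕⁻ F (r⁻¹ • x) := by
  rw [Real.fourierInv_eq, Real.fourierInv_eq, Real.rpow_neg hr.le, Real.rpow_natCast,
    ← abs_of_pos (a := (r ^ finrank ℝ V)⁻¹) (by positivity), ← Measure.integral_comp_smul]
  congr 1 with ξ
  rw [inner_smul_left, inner_smul_right]
  simp [hr.ne']

theorem exists_norm_fourierInv_comp_smul_le (M : 𝓢(V, ℂ)) {a : ℝ} (ha : 0 ≤ a) :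
    ∃ C : ℝ, ∀ r : ℝ, 1 ≤ r → ∀ x,
      ‖𝓕⁻ (fun ξ => M (r • ξ)) x‖ ≤ C * r ^ (a - finrank ℝ V) * (1 + ‖x‖) ^ (-a) := by
  obtain ⟨C, hC0, hC⟩ := exists_norm_schwartzMap_le (𝓕⁻ M) a
  refine ⟨C, fun r hr x => ?_⟩
  have hr0 : 0 < r := by linarith
  have hdil : (1 + ‖r⁻¹ • x‖) ^ (-a) ≤ r ^ a * (1 + ‖x‖) ^ (-a) := by
    have hle : r⁻¹ * (1 + ‖x‖) ≤ 1 + ‖r⁻¹ • x‖ := by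
      rw [norm_smul, norm_inv, Real.norm_of_nonneg hr0.le]
      linarith [inv_le_one_of_one_le₀ hr]
    refine (Real.rpow_le_rpow_of_nonpos (by positivity) hle (by linarith)).trans_eq ?_
    rw [Real.mul_rpow (by positivity) (by positivity), Real.inv_rpow hr0.le, Real.rpow_neg hr0.le,
      inv_inv]
  rw [fourierInv_comp_smul _ hr0, norm_smul, Real.norm_of_nonneg (by positivity),
    ← SchwartzMap.fourierInv_coe]
  calc r ^ (-(finrank ℝ V : ℝ)) * ‖(𝓕⁻ M) (r⁻¹ • x)‖
      ≤ r ^ (-(finrank ℝ V : ℝ)) * (C * (r ^ a * (1 + ‖x‖) ^ (-a))) := by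
        gcongr
        exact (hC _).trans (by gcongr)
    _ = C * r ^ (a - finrank ℝ V) * (1 + ‖x‖) ^ (-a) := by
        rw [sub_eq_add_neg a, Real.rpow_add hr0]
        ring

theorem norm_fourierInv_mul_fourier_le {F ψ : V → ℂ} {a C : ℝ} (ha : 0 ≤ a) (hF : Integrable F)
    (hC : ∀ z, ‖𝓕⁻ F z‖ ≤ C * (1 + ‖z‖) ^ (-a)) (hψ : Integrable ψ)
    (hψa : Integrable fun y => ‖ψ y‖ * (1 + ‖y‖) ^ a) (x : V) :
    ‖𝓕⁻ (fun ξ => F ξ * 𝓕 ψ ξ) x‖ ≤ (C * ∫ y, ‖ψ y‖ * (1 + ‖y‖) ^ a) * (1 + ‖x‖) ^ (-a) := by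
  have hC0 : 0 ≤ C := by simpa using (norm_nonneg _).trans (hC 0)
  rw [fourierInv_mul_fourier_eq_integral hF hψ]
  calc ‖∫ y, ψ y * 𝓕⁻ F (x - y)‖
      ≤ ∫ y, C * (1 + ‖x‖) ^ (-a) * (‖ψ y‖ * (1 + ‖y‖) ^ a) := by
        refine norm_integral_le_of_norm_le (hψa.const_mul _) (Eventually.of_forall fun y => ?_)
        calc ‖ψ y * 𝓕⁻ F (x - y)‖
            ≤ ‖ψ y‖ * (C * ((1 + ‖x‖) ^ (-a) * (1 + ‖y‖) ^ a)) := by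
              rw [norm_mul]
              gcongr
              exact (hC _).trans (by gcongr; exact one_add_norm_sub_rpow_neg_le ha x y)
          _ = C * (1 + ‖x‖) ^ (-a) * (‖ψ y‖ * (1 + ‖y‖) ^ a) := by ring
    _ = (C * ∫ y, ‖ψ y‖ * (1 + ‖y‖) ^ a) * (1 + ‖x‖) ^ (-a) := by
        rw [integral_const_mul]
        ring

end FourierTransform

section FrequencyCutoff

variable {V : Type*} [NormedAddCommGroup V]

/-- A smooth radial cutoff, equal to `1` for `‖ξ‖ ^ 2 ≤ 1` and to `0` for `2 ≤ ‖ξ‖ ^ 2`. -/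
noncomputable def smoothCutoff (ξ : V) : ℝ := Real.smoothTransition (2 - ‖ξ‖ ^ 2)

theorem smoothCutoff_nonneg (ξ : V) : 0 ≤ smoothCutoff ξ := Real.smoothTransition.nonneg _

theorem smoothCutoff_le_one (ξ : V) : smoothCutoff ξ ≤ 1 := Real.smoothTransition.le_one _

theorem smoothCutoff_neg (ξ : V) : smoothCutoff (-ξ) = smoothCutoff ξ := by
  simp only [smoothCutoff, norm_neg]

theorem smoothCutoff_eq_one {ξ : V} (h : ‖ξ‖ ^ 2 ≤ 1) : smoothCutoff ξ = 1 :=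
  Real.smoothTransition.one_of_one_le (by linarith)

theorem smoothCutoff_eq_zero {ξ : V} (h : 2 ≤ ‖ξ‖ ^ 2) : smoothCutoff ξ = 0 :=
  Real.smoothTransition.zero_of_nonpos (by linarith)

theorem hasCompactSupport_smoothCutoff [ProperSpace V] :
    HasCompactSupport (smoothCutoff : V → ℝ) := by
  refine HasCompactSupport.intro (isCompact_closedBall (0 : V) 2) fun ξ hξ => ?_
  refine smoothCutoff_eq_zero ?_
  rw [Metric.mem_closedBall, dist_zero_right, not_le] at hξ
  nlinarith

section NormedSpace

variable [NormedSpace ℝ V]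

theorem tendsto_smoothCutoff_pow_smul {ξ : V} (hξ : ξ ≠ 0) :
    Tendsto (fun k : ℕ => smoothCutoff ((2 : ℝ) ^ k • ξ)) atTop (𝓝 0) := by
  have h : Tendsto (fun k : ℕ => (2 : ℝ) ^ k * ‖ξ‖) atTop atTop :=
    (tendsto_pow_atTop_atTop_of_one_lt one_lt_two).atTop_mul_const (norm_pos_iff.2 hξ)
  refine tendsto_const_nhds.congr' ?_
  filter_upwards [h.eventually_ge_atTop 2] with k hk
  refine (smoothCutoff_eq_zero ?_).symm
  rw [norm_smul, norm_pow, Real.norm_of_nonneg zero_le_two]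
  nlinarith

/-- The multiplier `(2π‖ξ‖)^r` restricted smoothly to the frequencies `‖ξ‖ ≳ 2⁻ᵏ`; these are
smooth of temperate growth, and increase to `(2π‖ξ‖)^r` as `k → ∞`. -/
noncomputable def highFreqPow (r : ℝ) (k : ℕ) (ξ : V) : ℝ :=
  (1 - smoothCutoff ((2 : ℝ) ^ k • ξ)) * (2 * Real.pi * ‖ξ‖) ^ r

theorem highFreqPow_zero_exponent (k : ℕ) (ξ : V) :
    highFreqPow 0 k ξ = 1 - smoothCutoff ((2 : ℝ) ^ k • ξ) := by
  rw [highFreqPow, Real.rpow_zero, mul_one]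

theorem highFreqPow_neg (r : ℝ) (k : ℕ) (ξ : V) : highFreqPow r k (-ξ) = highFreqPow r k ξ := by
  rw [highFreqPow, smul_neg, smoothCutoff_neg, norm_neg, highFreqPow]

theorem highFreqPow_add (r t : ℝ) (k : ℕ) (ξ : V) :
    highFreqPow (r + t) k ξ = (2 * Real.pi * ‖ξ‖) ^ r * highFreqPow t k ξ := by
  rcases eq_or_ne ξ 0 with rfl | hξ
  · simp [highFreqPow, smoothCutoff_eq_one]
  · rw [highFreqPow, highFreqPow, Real.rpow_add (by positivity)]
    ring

theorem highFreqPow_nonneg (r : ℝ) (k : ℕ) (ξ : V) : 0 ≤ highFreqPow r k ξ :=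
  mul_nonneg (sub_nonneg.2 (smoothCutoff_le_one _)) (by positivity)

theorem highFreqPow_le (r : ℝ) (k : ℕ) (ξ : V) : highFreqPow r k ξ ≤ (2 * Real.pi * ‖ξ‖) ^ r :=
  mul_le_of_le_one_left (by positivity) (sub_le_self _ (smoothCutoff_nonneg _))

theorem tendsto_highFreqPow (r : ℝ) {ξ : V} (hξ : ξ ≠ 0) :
    Tendsto (fun k => highFreqPow r k ξ) atTop (𝓝 ((2 * Real.pi * ‖ξ‖) ^ r)) := by
  simpa [highFreqPow] using
    ((tendsto_smoothCutoff_pow_smul hξ).const_sub 1).mul_const ((2 * Real.pi * ‖ξ‖) ^ r)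

theorem highFreqPow_add_scale (r : ℝ) (j k : ℕ) (ξ : V) :
    highFreqPow r (j + k) ξ = 2 ^ (-(r * k)) * highFreqPow r j ((2 : ℝ) ^ k • ξ) := by
  have hnorm : 2 * Real.pi * ‖(2 : ℝ) ^ k • ξ‖ = 2 ^ (k : ℝ) * (2 * Real.pi * ‖ξ‖) := by
    rw [norm_smul, norm_pow, Real.norm_of_nonneg zero_le_two, Real.rpow_natCast]
    ring
  have hpow : (2 * Real.pi * ‖ξ‖) ^ r =
      2 ^ (-(r * k)) * (2 * Real.pi * ‖(2 : ℝ) ^ k • ξ‖) ^ r := by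
    rw [hnorm, Real.mul_rpow (x := 2 ^ (k : ℝ)) (by positivity) (by positivity),
      ← Real.rpow_mul zero_le_two, ← mul_assoc, ← Real.rpow_add two_pos, mul_comm (k : ℝ) r,
      neg_add_cancel, Real.rpow_zero, one_mul]
  rw [highFreqPow, highFreqPow, hpow, pow_add, mul_smul]
  ring

theorem hasTemperateGrowth_comp_const_smul {m : V → ℝ} (hm : m.HasTemperateGrowth) (r : ℝ) :
    Function.HasTemperateGrowth fun ξ => m (r • ξ) :=
  hm.comp (r • ContinuousLinearMap.id ℝ V).hasTemperateGrowth

end NormedSpace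

variable [InnerProductSpace ℝ V]

theorem contDiff_smoothCutoff : ContDiff ℝ ∞ (smoothCutoff : V → ℝ) :=
  Real.smoothTransition.contDiff.comp (contDiff_const.sub (contDiff_norm_sq ℝ))

theorem hasTemperateGrowth_smoothCutoff [ProperSpace V] :
    Function.HasTemperateGrowth (smoothCutoff : V → ℝ) :=
  hasCompactSupport_smoothCutoff.hasTemperateGrowth contDiff_smoothCutoff

theorem exists_contDiff_eq_one_sub_rpow (r : ℝ) :
    ∃ h : ℝ → ℝ, HasCompactSupport h ∧ ContDiff ℝ ∞ h ∧
      ∀ t ∈ Set.Icc (0 : ℝ) (1 / 2), h t = (1 - t) ^ r := by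
  let χ : ContDiffBump (0 : ℝ) := ⟨1 / 2, 3 / 4, by norm_num, by norm_num⟩
  refine ⟨fun t => χ t * (1 - t) ^ r, χ.hasCompactSupport.mul_right,
    contDiff_iff_contDiffAt.2 fun t => ?_, fun t ht => ?_⟩
  · rcases ne_or_eq t 1 with ht | rfl
    · exact χ.contDiff.contDiffAt.mul
        ((contDiffAt_const.sub contDiffAt_id).rpow_const_of_ne (sub_ne_zero.2 ht.symm))
    · refine (contDiffAt_const (c := (0 : ℝ))).congr_of_eventuallyEq ?_
      filter_upwards [Ioi_mem_nhds (show (3 / 4 : ℝ) < 1 by norm_num)] with u hu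
      have hχ : χ u = 0 := χ.zero_of_le_dist (by
        rw [Real.dist_eq, sub_zero]
        exact (le_of_lt hu).trans (le_abs_self u))
      rw [hχ, zero_mul]
  · have hχ : χ t = 1 := χ.one_of_mem_closedBall (by
      rw [Metric.mem_closedBall, Real.dist_eq, sub_zero, abs_of_nonneg ht.1]
      exact ht.2)
    simp only [hχ, one_mul]

variable (V) in
/-- The function is `‖ξ‖ ^ r = (1 + ‖ξ‖ ^ 2) ^ (r / 2) * (1 - t) ^ (r / 2)` with
`t = (1 + ‖ξ‖ ^ 2)⁻¹`, and `t` stays away from the singularity `t = 1` on the support. -/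
theorem hasTemperateGrowth_one_sub_smoothCutoff_mul_norm_rpow [ProperSpace V] (r : ℝ) :
    Function.HasTemperateGrowth fun ξ : V => (1 - smoothCutoff ξ) * ‖ξ‖ ^ r := by
  obtain ⟨h, hsupp, hsmooth, hh⟩ := exists_contDiff_eq_one_sub_rpow (r / 2)
  have hcomp : Function.HasTemperateGrowth fun ξ : V => h ((1 + ‖ξ‖ ^ 2) ^ (-1 : ℝ)) :=
    (hsupp.hasTemperateGrowth hsmooth).comp
      (Function.hasTemperateGrowth_one_add_norm_sq_rpow V (-1))
  have heq : (fun ξ : V => (1 - smoothCutoff ξ) * ‖ξ‖ ^ r) = fun ξ =>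
      (1 - smoothCutoff ξ) * ((1 + ‖ξ‖ ^ 2) ^ (r / 2) * h ((1 + ‖ξ‖ ^ 2) ^ (-1 : ℝ))) := by
    funext ξ
    rcases le_or_gt (‖ξ‖ ^ 2) 1 with hξ | hξ
    · simp only [smoothCutoff_eq_one hξ, sub_self, zero_mul]
    · have hone : (1 + ‖ξ‖ ^ 2) * (1 - (1 + ‖ξ‖ ^ 2)⁻¹) = ‖ξ‖ ^ 2 := by
        have : 1 + ‖ξ‖ ^ 2 ≠ 0 := by positivity
        field_simp
        ring
      have hhalf : (1 + ‖ξ‖ ^ 2)⁻¹ ≤ 1 / 2 := by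
        rw [one_div]
        exact inv_anti₀ two_pos (by linarith)
      rw [Real.rpow_neg_one, hh _ ⟨by positivity, hhalf⟩,
        ← Real.mul_rpow (by positivity) (by linarith), hone, ← Real.rpow_natCast,
        ← Real.rpow_mul (norm_nonneg _), Nat.cast_ofNat, mul_div_cancel₀ r two_ne_zero]
  rw [heq]
  exact ((Function.HasTemperateGrowth.const 1).sub hasTemperateGrowth_smoothCutoff).mul
    ((Function.hasTemperateGrowth_one_add_norm_sq_rpow V (r / 2)).mul hcomp)

theorem hasTemperateGrowth_highFreqPow [ProperSpace V] (r : ℝ) (k : ℕ) :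
    Function.HasTemperateGrowth (highFreqPow r k : V → ℝ) := by
  have hscale : (highFreqPow r k : V → ℝ) = fun ξ => (2 ^ (-(r * k)) * (2 * Real.pi) ^ r) *
      ((1 - smoothCutoff ((2 : ℝ) ^ k • ξ)) * ‖(2 : ℝ) ^ k • ξ‖ ^ r) := by
    funext ξ
    rw [← Nat.zero_add k, highFreqPow_add_scale, Nat.zero_add, highFreqPow,
      Real.mul_rpow (by positivity) (norm_nonneg _), pow_zero, one_smul]
    ring
  rw [hscale]
  exact (Function.HasTemperateGrowth.const _).mul (hasTemperateGrowth_comp_const_smul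
    (hasTemperateGrowth_one_sub_smoothCutoff_mul_norm_rpow V r) _)

end FrequencyCutoff

section FourierMultiplier

variable {V : Type*} [NormedAddCommGroup V] [InnerProductSpace ℝ V]

/-- A real test function as a Schwartz function with values in `ℂ`, the form in which Mathlib's
Fourier transform applies to it. -/
noncomputable def toSchwartzComplex (φ : V → ℝ) (hc : HasCompactSupport φ) (hφ : ContDiff ℝ ∞ φ) :
    𝓢(V, ℂ) :=
  (hc.comp_left (g := Complex.ofReal) Complex.ofReal_zero).toSchwartzMap
    (Complex.ofRealCLM.contDiff.comp hφ)

@[simp]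
theorem toSchwartzComplex_apply (φ : V → ℝ) (hc : HasCompactSupport φ) (hφ : ContDiff ℝ ∞ φ)
    (x : V) : toSchwartzComplex φ hc hφ x = φ x := rfl

variable [FiniteDimensional ℝ V] [MeasurableSpace V] [BorelSpace V]

/-- The Fourier multiplier operator `f ↦ 𝓕⁻¹ (m 𝓕 f)` with real symbol `m`, on functions; unlike
`SchwartzMap.fourierMultiplierCLM`, it makes sense for symbols that are not smooth, such as
`‖ξ‖ ^ r`. -/
noncomputable def fourierMultiplier (m : V → ℝ) (f : V → ℂ) : V → ℂ :=
  𝓕⁻ fun ξ => (m ξ : ℂ) * 𝓕 f ξ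

theorem fourierMultiplier_const_mul (c : ℝ) (m : V → ℝ) (f : V → ℂ) (x : V) :
    fourierMultiplier (fun ξ => c * m ξ) f x = c * fourierMultiplier m f x := by
  simp only [fourierMultiplier, Complex.ofReal_mul, mul_assoc, fourierInv_const_mul_apply]

theorem fourierMultiplier_one (f : 𝓢(V, ℂ)) : fourierMultiplier (fun _ => 1) f = f := by
  simp only [fourierMultiplier, Complex.ofReal_one, one_mul]
  rw [← SchwartzMap.fourier_coe, ← SchwartzMap.fourierInv_coe,
    FourierTransform.fourierInv_fourier_eq]

theorem coe_fourierMultiplierCLM {m : V → ℝ} (hm : m.HasTemperateGrowth) (f : 𝓢(V, ℂ)) :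
    ⇑(SchwartzMap.fourierMultiplierCLM ℂ m f) = fourierMultiplier m f := by
  rw [SchwartzMap.fourierMultiplierCLM_apply, SchwartzMap.fourierInv_coe, fourierMultiplier]
  congr 1
  funext ξ
  rw [SchwartzMap.smulLeftCLM_apply_apply hm, SchwartzMap.fourier_coe, Complex.real_smul]

theorem fourier_fourierMultiplierCLM {m : V → ℝ} (hm : m.HasTemperateGrowth) (f : 𝓢(V, ℂ))
    (ξ : V) : 𝓕 (SchwartzMap.fourierMultiplierCLM ℂ m f) ξ = m ξ * 𝓕 (f : V → ℂ) ξ := by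
  rw [SchwartzMap.fourierMultiplierCLM_apply, FourierTransform.fourier_fourierInv_eq,
    SchwartzMap.smulLeftCLM_apply_apply hm, SchwartzMap.fourier_coe, Complex.real_smul]

theorem integrable_mul_fourier {m : V → ℝ} (hm : m.HasTemperateGrowth) (f : 𝓢(V, ℂ)) :
    Integrable (fun ξ => (m ξ : ℂ) * 𝓕 (f : V → ℂ) ξ) := by
  refine (SchwartzMap.smulLeftCLM ℂ m (𝓕 f)).integrable.congr (Eventually.of_forall fun ξ => ?_)
  simp only [SchwartzMap.smulLeftCLM_apply_apply hm, SchwartzMap.fourier_coe, Complex.real_smul]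

theorem fourierMultiplier_add {m m' : V → ℝ} (hm : m.HasTemperateGrowth)
    (hm' : m'.HasTemperateGrowth) (f : 𝓢(V, ℂ)) (x : V) :
    fourierMultiplier (fun ξ => m ξ + m' ξ) f x =
      fourierMultiplier m f x + fourierMultiplier m' f x := by
  simp only [fourierMultiplier, Complex.ofReal_add, add_mul]
  exact fourierInv_add_apply (integrable_mul_fourier hm f) (integrable_mul_fourier hm' f) x

theorem continuous_fourierMultiplier {m : V → ℝ} (hm : m.HasTemperateGrowth) (f : 𝓢(V, ℂ)) :
    Continuous (fourierMultiplier m f) := by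
  rw [← coe_fourierMultiplierCLM hm]
  exact SchwartzMap.continuous _

theorem exists_norm_fourierMultiplier_le {m : V → ℝ} (hm : m.HasTemperateGrowth) (f : 𝓢(V, ℂ))
    (a : ℝ) : ∃ C, 0 ≤ C ∧ ∀ x, ‖fourierMultiplier m f x‖ ≤ C * (1 + ‖x‖) ^ (-a) := by
  rw [← coe_fourierMultiplierCLM hm]
  exact exists_norm_schwartzMap_le _ a

theorem exists_norm_fourierMultiplier_comp_smul_le {m : V → ℝ} (hc : HasCompactSupport m)
    (hm : ContDiff ℝ ∞ m) (f : 𝓢(V, ℂ)) {a : ℝ} (ha : 0 ≤ a) :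
    ∃ C, 0 ≤ C ∧ ∀ r : ℝ, 1 ≤ r → ∀ x, ‖fourierMultiplier (fun ξ => m (r • ξ)) f x‖ ≤
      C * r ^ (a - finrank ℝ V) * (1 + ‖x‖) ^ (-a) := by
  obtain ⟨C, hC⟩ := exists_norm_fourierInv_comp_smul_le (toSchwartzComplex m hc hm) ha
  have hC0 : 0 ≤ C := by simpa using (norm_nonneg _).trans (hC 1 le_rfl 0)
  refine ⟨C * ∫ y, ‖f y‖ * (1 + ‖y‖) ^ a, mul_nonneg hC0 (integral_nonneg fun y => by positivity),
    fun r hr x => ?_⟩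
  have hint : Integrable fun ξ : V => toSchwartzComplex m hc hm (r • ξ) :=
    (toSchwartzComplex m hc hm).integrable.comp_smul (zero_lt_one.trans_le hr).ne'
  refine (norm_fourierInv_mul_fourier_le ha hint (hC r hr) f.integrable
    (integrable_norm_schwartzMap_mul_rpow f a) x).trans_eq ?_
  ring

theorem exists_norm_fourierMultiplier_comp_two_pow_smul_le {m : V → ℝ} (hc : HasCompactSupport m)
    (hm : ContDiff ℝ ∞ m) (f : 𝓢(V, ℂ)) {a : ℝ} (ha : 0 ≤ a) :
    ∃ C, 0 ≤ C ∧ ∀ (k : ℕ) (x : V),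
      ‖fourierMultiplier (fun ξ => m ((2 : ℝ) ^ k • ξ)) f x‖ ≤
        C * ((2 : ℝ) ^ (a - finrank ℝ V)) ^ k * (1 + ‖x‖) ^ (-a) := by
  obtain ⟨C, hC0, hC⟩ := exists_norm_fourierMultiplier_comp_smul_le hc hm f ha
  refine ⟨C, hC0, fun k x => (hC _ (one_le_pow₀ one_le_two) x).trans_eq ?_⟩
  rw [← Real.rpow_natCast, ← Real.rpow_natCast, ← Real.rpow_mul zero_le_two,
    ← Real.rpow_mul zero_le_two, mul_comm (k : ℝ)]

/-- The Fourier multiplier operator with real symbol `m` on real functions. Taking the real part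
discards nothing when `m` is even. -/
noncomputable def realFourierMultiplier (m : V → ℝ) (φ : V → ℝ) (x : V) : ℝ :=
  (fourierMultiplier m (fun y => (φ y : ℂ)) x).re

theorem ofReal_realFourierMultiplier {m : V → ℝ} (hm : ∀ ξ, m (-ξ) = m ξ) (φ : V → ℝ) (x : V) :
    (realFourierMultiplier m φ x : ℂ) = fourierMultiplier m (fun y => (φ y : ℂ)) x := by
  refine Complex.conj_eq_iff_re.1 ?_
  rw [fourierMultiplier, conj_fourierInv, Real.fourierInv_eq_fourier_comp_neg]
  simp only [map_mul, Complex.conj_ofReal, conj_fourier_ofReal, hm]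

theorem norm_realFourierMultiplier_le (m φ : V → ℝ) (x : V) :
    ‖realFourierMultiplier m φ x‖ ≤ ‖fourierMultiplier m (fun y => (φ y : ℂ)) x‖ :=
  Complex.abs_re_le_norm _

theorem continuous_realFourierMultiplier {m φ : V → ℝ} (hm : m.HasTemperateGrowth)
    (hc : HasCompactSupport φ) (hφ : ContDiff ℝ ∞ φ) : Continuous (realFourierMultiplier m φ) :=
  Complex.continuous_re.comp (continuous_fourierMultiplier hm (toSchwartzComplex φ hc hφ))

theorem exists_norm_realFourierMultiplier_le {m φ : V → ℝ} (hm : m.HasTemperateGrowth)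
    (hc : HasCompactSupport φ) (hφ : ContDiff ℝ ∞ φ) (a : ℝ) :
    ∃ C, ∀ x, ‖realFourierMultiplier m φ x‖ ≤ C * (1 + ‖x‖) ^ (-a) := by
  obtain ⟨C, -, hC⟩ := exists_norm_fourierMultiplier_le hm (toSchwartzComplex φ hc hφ) a
  exact ⟨C, fun x => (norm_realFourierMultiplier_le m φ x).trans (hC x)⟩

theorem WeightedIntegrable.integrable_mul_realFourierMultiplier {v m φ : V → ℝ} {a : ℝ}
    (hv : WeightedIntegrable a v volume) (hm : m.HasTemperateGrowth) (hc : HasCompactSupport φ)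
    (hφ : ContDiff ℝ ∞ φ) : Integrable fun x => v x * realFourierMultiplier m φ x := by
  obtain ⟨C, hC⟩ := exists_norm_realFourierMultiplier_le hm hc hφ a
  exact hv.integrable_smul (continuous_realFourierMultiplier hm hc hφ).aestronglyMeasurable hC

end FourierMultiplier

section HighFrequency

variable {V : Type*} [NormedAddCommGroup V] [InnerProductSpace ℝ V] [FiniteDimensional ℝ V]

theorem hasCompactSupport_highFreqPow_sub (b : ℝ) :
    HasCompactSupport fun ξ : V => highFreqPow b 1 ξ - highFreqPow b 0 ξ := by
  refine HasCompactSupport.intro (isCompact_closedBall (0 : V) 2) fun ξ hξ => ?_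
  rw [Metric.mem_closedBall, dist_zero_right, not_le] at hξ
  have hcut : ∀ k : ℕ, smoothCutoff ((2 : ℝ) ^ k • ξ) = 0 := fun k => smoothCutoff_eq_zero (by
    rw [norm_smul, norm_pow, Real.norm_of_nonneg zero_le_two]
    nlinarith [le_mul_of_one_le_left (norm_nonneg ξ) (one_le_pow₀ (n := k) one_le_two)])
  simp only [highFreqPow, hcut, sub_self]

variable [MeasurableSpace V] [BorelSpace V]

theorem fourierMultiplier_highFreqPow_succ (b : ℝ) (k : ℕ) (f : 𝓢(V, ℂ)) (x : V) :
    fourierMultiplier (highFreqPow b (k + 1)) f x = fourierMultiplier (highFreqPow b k) f x +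
      ((2 ^ (-(b * k)) : ℝ) : ℂ) * fourierMultiplier
        (fun ξ => highFreqPow b 1 ((2 : ℝ) ^ k • ξ) - highFreqPow b 0 ((2 : ℝ) ^ k • ξ)) f x := by
  have htemp : ∀ j, Function.HasTemperateGrowth fun ξ : V => highFreqPow b j ((2 : ℝ) ^ k • ξ) :=
    fun j => hasTemperateGrowth_comp_const_smul (hasTemperateGrowth_highFreqPow b j) _
  have hpiece : Function.HasTemperateGrowth fun ξ : V => (2 : ℝ) ^ (-(b * k)) *
      (highFreqPow b 1 ((2 : ℝ) ^ k • ξ) - highFreqPow b 0 ((2 : ℝ) ^ k • ξ)) :=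
    (Function.HasTemperateGrowth.const _).mul ((htemp 1).sub (htemp 0))
  rw [← fourierMultiplier_const_mul,
    ← fourierMultiplier_add (hasTemperateGrowth_highFreqPow b k) hpiece]
  congr 1
  funext ξ
  rw [mul_sub, ← highFreqPow_add_scale, ← highFreqPow_add_scale, zero_add, add_comm 1 k,
    add_sub_cancel]

/-- Passing from level `k` to `k + 1` adds a dyadic piece of size `O(ρ ^ k)` with
`ρ = 2 ^ (a - finrank ℝ V - b) < 1`. -/
theorem exists_norm_fourierMultiplier_highFreqPow_le (f : 𝓢(V, ℂ)) {a b : ℝ} (ha : 0 ≤ a)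
    (hab : a < finrank ℝ V + b) :
    ∃ C : ℝ, ∀ (k : ℕ) (x : V),
      ‖fourierMultiplier (highFreqPow b k) f x‖ ≤ C * (1 + ‖x‖) ^ (-a) := by
  obtain ⟨C₀, -, hC₀⟩ := exists_norm_fourierMultiplier_le (hasTemperateGrowth_highFreqPow b 0) f a
  obtain ⟨C₁, hC₁0, hC₁⟩ := exists_norm_fourierMultiplier_comp_two_pow_smul_le
    (hasCompactSupport_highFreqPow_sub b)
    ((hasTemperateGrowth_highFreqPow b 1).1.sub (hasTemperateGrowth_highFreqPow b 0).1) f ha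
  set ρ : ℝ := 2 ^ (a - finrank ℝ V - b) with hρ
  have hρ0 : 0 ≤ ρ := by positivity
  have hρ1 : ρ < 1 := Real.rpow_lt_one_of_one_lt_of_neg one_lt_two (by linarith)
  have hscale : ∀ k : ℕ, (2 : ℝ) ^ (-(b * k)) * ((2 : ℝ) ^ (a - finrank ℝ V)) ^ k = ρ ^ k := by
    intro k
    rw [hρ, Real.rpow_sub two_pos _ b, div_pow, Real.rpow_neg zero_le_two,
      Real.rpow_mul zero_le_two, Real.rpow_natCast, mul_comm, div_eq_mul_inv]
  have hpartial : ∀ (k : ℕ) (x : V), ‖fourierMultiplier (highFreqPow b k) f x‖ ≤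
      (C₀ + C₁ * ∑ j ∈ Finset.range k, ρ ^ j) * (1 + ‖x‖) ^ (-a) := by
    intro k x
    induction k with
    | zero => simpa using hC₀ x
    | succ k ih =>
      rw [fourierMultiplier_highFreqPow_succ]
      refine (norm_add_le _ _).trans ?_
      rw [norm_mul, Complex.norm_real, Real.norm_of_nonneg (by positivity)]
      calc _ ≤ (C₀ + C₁ * ∑ j ∈ Finset.range k, ρ ^ j) * (1 + ‖x‖) ^ (-a) + 2 ^ (-(b * k)) *
            (C₁ * ((2 : ℝ) ^ (a - finrank ℝ V)) ^ k * (1 + ‖x‖) ^ (-a)) := by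
            gcongr
            exact hC₁ k x
        _ = (C₀ + C₁ * (∑ j ∈ Finset.range k, ρ ^ j + 2 ^ (-(b * k)) *
            ((2 : ℝ) ^ (a - finrank ℝ V)) ^ k)) * (1 + ‖x‖) ^ (-a) := by ring
        _ = _ := by rw [hscale, Finset.sum_range_succ]
  refine ⟨C₀ + C₁ * (1 - ρ)⁻¹, fun k x => (hpartial k x).trans ?_⟩
  gcongr
  rw [← tsum_geometric_of_lt_one hρ0 hρ1]
  exact (summable_geometric_of_lt_one hρ0 hρ1).sum_le_tsum _ fun j _ => by positivity

theorem realFourierMultiplier_highFreqPow_zero_add {φ : V → ℝ} (hc : HasCompactSupport φ)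
    (hφ : ContDiff ℝ ∞ φ) (k : ℕ) (x : V) :
    realFourierMultiplier (highFreqPow 0 k) φ x +
      realFourierMultiplier (fun ξ => smoothCutoff ((2 : ℝ) ^ k • ξ)) φ x = φ x := by
  have h := fourierMultiplier_add (hasTemperateGrowth_highFreqPow 0 k)
    (hasTemperateGrowth_comp_const_smul hasTemperateGrowth_smoothCutoff ((2 : ℝ) ^ k))
    (toSchwartzComplex φ hc hφ) x
  simp only [highFreqPow_zero_exponent, sub_add_cancel, fourierMultiplier_one] at h
  exact (congrArg Complex.re h).symm

theorem tendsto_integral_mul_realFourierMultiplier_smoothCutoff {v φ : V → ℝ} {a : ℝ} (ha : 0 ≤ a)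
    (han : a < finrank ℝ V) (hv : WeightedIntegrable a v volume) (hc : HasCompactSupport φ)
    (hφ : ContDiff ℝ ∞ φ) :
    Tendsto (fun k : ℕ => ∫ x, v x *
      realFourierMultiplier (fun ξ => smoothCutoff ((2 : ℝ) ^ k • ξ)) φ x) atTop (𝓝 0) := by
  obtain ⟨C, -, hC⟩ := exists_norm_fourierMultiplier_comp_two_pow_smul_le
    hasCompactSupport_smoothCutoff contDiff_smoothCutoff (toSchwartzComplex φ hc hφ) ha
  have hlim : Tendsto (fun k : ℕ => C * ((2 : ℝ) ^ (a - finrank ℝ V)) ^ k *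
      ∫ x, ‖v x * (1 + ‖x‖) ^ (-a)‖) atTop (𝓝 0) := by
    simpa using ((tendsto_pow_atTop_nhds_zero_of_lt_one (by positivity)
      (Real.rpow_lt_one_of_one_lt_of_neg one_lt_two (sub_neg.2 han))).const_mul C).mul_const
        (∫ x, ‖v x * (1 + ‖x‖) ^ (-a)‖)
  refine squeeze_zero_norm (fun k => ?_) hlim
  rw [← integral_const_mul]
  exact norm_integral_le_of_norm_le (hv.norm.const_mul _) (Eventually.of_forall
    (norm_smul_le_of_norm_le v fun x => (norm_realFourierMultiplier_le _ φ x).trans (hC k x)))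

/-- The Fourier transform of `v` is supported at the origin, and `a < finrank ℝ V` excludes the
polynomials: in the pairing with a test function the low frequencies vanish in the limit. -/
theorem ae_eq_zero_of_integral_mul_highFreq_eq_zero {v : V → ℝ} {a : ℝ} (ha : 0 ≤ a)
    (han : a < finrank ℝ V) (hv : WeightedIntegrable a v volume)
    (h : ∀ φ : V → ℝ, ContDiff ℝ ∞ φ → HasCompactSupport φ → ∀ k : ℕ,
      ∫ x, v x * realFourierMultiplier (highFreqPow 0 k) φ x = 0) :
    v =ᵐ[volume] 0 := by
  refine ae_eq_zero_of_integral_contDiff_smul_eq_zero hv.locallyIntegrable fun φ hφ hc => ?_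
  have hlow (k : ℕ) :
      ∫ x, v x * realFourierMultiplier (fun ξ => smoothCutoff ((2 : ℝ) ^ k • ξ)) φ x =
        ∫ x, φ x • v x := by
    rw [← zero_add (∫ x, v x * _), ← h φ hφ hc k, ← integral_add
      (hv.integrable_mul_realFourierMultiplier (hasTemperateGrowth_highFreqPow 0 k) hc hφ)
      (hv.integrable_mul_realFourierMultiplier
        (hasTemperateGrowth_comp_const_smul hasTemperateGrowth_smoothCutoff _) hc hφ)]
    simp only [← mul_add, realFourierMultiplier_highFreqPow_zero_add hc hφ]
    simp only [smul_eq_mul, mul_comm]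
  exact tendsto_nhds_unique tendsto_const_nhds
    ((tendsto_integral_mul_realFourierMultiplier_smoothCutoff ha han hv hc hφ).congr hlow)

end HighFrequency

section Subordination

theorem integral_mul_eq_integral_integral_of_nonneg {X Y : Type*} [MeasurableSpace X]
    [MeasurableSpace Y] {μ : Measure X} [SFinite μ] {ν : Measure Y} [SFinite ν]
    {κ : X → Y → ℝ} {K : X → ℝ} (hκm : Measurable (Function.uncurry κ))
    (hκ0 : ∀ x, 0 ≤ᵐ[ν] κ x) (hκ : ∀ᵐ x ∂μ, Integrable (κ x) ν)
    (hK : ∀ᵐ x ∂μ, ∫ t, κ x t ∂ν = K x) {f : X → ℂ} (hf : AEStronglyMeasurable f μ)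
    (hKf : Integrable (fun x => (K x : ℂ) * f x) μ) :
    ∫ x, (K x : ℂ) * f x ∂μ = ∫ t, ∫ x, (κ x t : ℂ) * f x ∂μ ∂ν := by
  have hmeas : AEStronglyMeasurable (fun p : X × Y => (κ p.1 p.2 : ℂ) * f p.1) (μ.prod ν) :=
    (Complex.measurable_ofReal.comp hκm).aestronglyMeasurable.mul hf.comp_fst
  have hint : Integrable (fun p : X × Y => (κ p.1 p.2 : ℂ) * f p.1) (μ.prod ν) := by
    refine (integrable_prod_iff hmeas).2 ⟨hκ.mono fun x hx => hx.ofReal.mul_const (f x), ?_⟩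
    refine hKf.norm.congr (hK.mono fun x hx => ?_)
    beta_reduce
    rw [← hx, norm_mul, Complex.norm_real, Real.norm_of_nonneg (integral_nonneg_of_ae (hκ0 x)),
      ← integral_mul_const]
    refine integral_congr_ae ((hκ0 x).mono fun t ht => ?_)
    simp only [norm_mul, Complex.norm_real, Real.norm_of_nonneg ht]
  rw [← integral_integral_swap hint]
  refine integral_congr_ae (hK.mono fun x hx => ?_)
  simp only [integral_mul_const, integral_complex_ofReal, hx]

theorem integrableOn_rpow_mul_exp_neg_mul {a r : ℝ} (ha : 0 < a) (hr : 0 < r) :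
    IntegrableOn (fun t : ℝ => t ^ (a - 1) * Real.exp (-(r * t))) (Set.Ioi 0) := by
  simpa using integrableOn_rpow_mul_exp_neg_mul_rpow (s := a - 1) (by linarith) one_pos hr

theorem rpow_neg_sub_one_mul_exp_neg_div_eq {a r t : ℝ} (ht : 0 < t) :
    t ^ (-a - 1) * Real.exp (-(r / t)) =
      (|(-1 : ℝ)| * t ^ ((-1 : ℝ) - 1)) •
        ((t ^ (-1 : ℝ)) ^ (a - 1) * Real.exp (-(r * t ^ (-1 : ℝ)))) := by
  rw [smul_eq_mul, abs_neg, abs_one, one_mul, ← mul_assoc, ← Real.rpow_mul ht.le,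
    ← Real.rpow_add ht, Real.rpow_neg_one, ← div_eq_mul_inv]
  congr 2
  ring

theorem integrableOn_rpow_neg_mul_exp_neg_div {a r : ℝ} (ha : 0 < a) (hr : 0 < r) :
    IntegrableOn (fun t : ℝ => t ^ (-a - 1) * Real.exp (-(r / t))) (Set.Ioi 0) :=
  ((integrableOn_Ioi_comp_rpow_iff _ (neg_ne_zero.2 one_ne_zero)).2
    (integrableOn_rpow_mul_exp_neg_mul ha hr)).congr_fun
    (fun _ ht => (rpow_neg_sub_one_mul_exp_neg_div_eq ht).symm) measurableSet_Ioi

theorem integral_rpow_neg_mul_exp_neg_div {a r : ℝ} (ha : 0 < a) (hr : 0 < r) :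
    ∫ t in Set.Ioi 0, t ^ (-a - 1) * Real.exp (-(r / t)) = (1 / r) ^ a * Real.Gamma a := by
  rw [← Real.integral_rpow_mul_exp_neg_mul_Ioi ha hr, ← integral_comp_rpow_Ioi
    (fun t => t ^ (a - 1) * Real.exp (-(r * t))) (neg_ne_zero.2 one_ne_zero)]
  exact setIntegral_congr_fun measurableSet_Ioi fun t ht => rpow_neg_sub_one_mul_exp_neg_div_eq ht

variable {V : Type*} [NormedAddCommGroup V] [InnerProductSpace ℝ V] [FiniteDimensional ℝ V]
  [MeasurableSpace V] [BorelSpace V]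

theorem integrable_cexp_neg_mul_norm_sq {b : ℂ} (hb : 0 < b.re) :
    Integrable fun v : V => Complex.exp (-b * ‖v‖ ^ 2) := by
  simpa using GaussianFourier.integrable_cexp_neg_mul_sq_norm_add (V := V) hb 0 0

theorem integral_gaussian_mul_fourierInv {F : V → ℂ} (hF : Integrable F) {b : ℝ} (hb : 0 < b)
    (x : V) : ∫ y, ((Real.exp (-(‖x - y‖ ^ 2 * b)) : ℝ) : ℂ) * 𝓕⁻ F y =
      ∫ ξ, (((Real.pi / b) ^ ((finrank ℝ V : ℝ) / 2) *
        Real.exp (-(Real.pi ^ 2 * ‖ξ‖ ^ 2 / b)) : ℝ) : ℂ) *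
          (Real.fourierChar (inner ℝ ξ x) • F ξ) := by
  have hre : 0 < (b : ℂ).re := by simpa using hb
  have hfourier : ∀ ξ : V, 𝓕 (fun v : V => Complex.exp (-(b : ℂ) * ‖v‖ ^ 2)) ξ =
      (((Real.pi / b) ^ ((finrank ℝ V : ℝ) / 2) *
        Real.exp (-(Real.pi ^ 2 * ‖ξ‖ ^ 2 / b)) : ℝ) : ℂ) := by
    intro ξ
    rw [fourier_gaussian_innerProductSpace hre, Complex.ofReal_mul, Complex.ofReal_cpow
      (by positivity)]
    push_cast
    congr 2
    ring
  calc ∫ y, ((Real.exp (-(‖x - y‖ ^ 2 * b)) : ℝ) : ℂ) * 𝓕⁻ F y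
      = ∫ y, Complex.exp (-(b : ℂ) * ‖x - y‖ ^ 2) * 𝓕⁻ F (x - (x - y)) := by
        congr 1 with y
        rw [sub_sub_cancel]
        push_cast
        congr 2
        ring
    _ = ∫ y, Complex.exp (-(b : ℂ) * ‖y‖ ^ 2) * 𝓕⁻ F (x - y) :=
        integral_sub_left_eq_self (fun y => Complex.exp (-(b : ℂ) * ‖y‖ ^ 2) * 𝓕⁻ F (x - y))
          volume x
    _ = 𝓕⁻ (fun ξ => F ξ * 𝓕 (fun v : V => Complex.exp (-(b : ℂ) * ‖v‖ ^ 2)) ξ) x :=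
        (fourierInv_mul_fourier_eq_integral hF (integrable_cexp_neg_mul_norm_sq hre) x).symm
    _ = _ := by
        simp only [Real.fourierInv_eq, hfourier, mul_comm (F _), mul_smul_comm]

end Subordination

section RieszFourier

variable {d : ℕ} {α : ℝ}

local notation "E" => EuclideanSpace ℝ (Fin d)

/-- The constant `c` in `∫ b in Ioi 0, b ^ ((d - α) / 2 - 1) * exp (-(‖z‖ ^ 2 * b)) = c * I_α(z)`,
which writes the Riesz kernel as a superposition of Gaussians. -/
noncomputable def subordinationConst (d : ℕ) (α : ℝ) : ℝ :=
  Real.pi ^ ((d : ℝ) / 2) * 2 ^ α * Real.Gamma (α / 2)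

theorem ae_ne_of_pos_dim (hd : 0 < d) (z : E) : ∀ᵐ y : E, y ≠ z := by
  have : Nonempty (Fin d) := Fin.pos_iff_nonempty.1 hd
  simp [ae_iff, measure_singleton]

theorem rieszKernel_eq_integral (hα : 0 < α) (hαd : α < d) {z : E} (hz : z ≠ 0) :
    ∫ b in Set.Ioi 0, b ^ ((d - α) / 2 - 1) * Real.exp (-(‖z‖ ^ 2 * b)) =
      subordinationConst d α * rieszKernel d α z := by
  have hnorm : 0 < ‖z‖ := norm_pos_iff.2 hz
  have := Real.Gamma_pos_of_pos (half_pos hα)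
  have hpow : (1 / ‖z‖ ^ 2) ^ ((d - α) / 2) = ‖z‖ ^ (α - d) := by
    rw [one_div, Real.inv_rpow (by positivity), ← Real.rpow_natCast, ← Real.rpow_mul hnorm.le,
      ← Real.rpow_neg hnorm.le]
    congr 1
    push_cast
    ring
  rw [Real.integral_rpow_mul_exp_neg_mul_Ioi (by linarith) (by positivity), rieszKernel,
    subordinationConst, hpow]
  field_simp

theorem rpow_mul_pi_div_rpow_mul_exp_eq {b : ℝ} (hb : 0 < b) (ξ : E) :
    b ^ ((d - α) / 2 - 1) *
        ((Real.pi / b) ^ ((d : ℝ) / 2) * Real.exp (-(Real.pi ^ 2 * ‖ξ‖ ^ 2 / b))) =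
      Real.pi ^ ((d : ℝ) / 2) *
        (b ^ (-(α / 2) - 1) * Real.exp (-(Real.pi ^ 2 * ‖ξ‖ ^ 2 / b))) := by
  have hpow : b ^ (-(α / 2) - 1) = b ^ ((d - α) / 2 - 1) * b ^ (-((d : ℝ) / 2)) := by
    rw [← Real.rpow_add hb]
    congr 1
    ring
  rw [Real.div_rpow Real.pi_pos.le hb.le, div_eq_mul_inv (_ ^ _), ← Real.rpow_neg hb.le, hpow]
  ring

theorem integrableOn_rpow_mul_fourier_gaussian (hα : 0 < α) {ξ : E} (hξ : ξ ≠ 0) :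
    IntegrableOn (fun b => b ^ ((d - α) / 2 - 1) *
      ((Real.pi / b) ^ ((d : ℝ) / 2) * Real.exp (-(Real.pi ^ 2 * ‖ξ‖ ^ 2 / b)))) (Set.Ioi 0) := by
  have hpos : 0 < Real.pi ^ 2 * ‖ξ‖ ^ 2 := by
    have := norm_pos_iff.2 hξ
    positivity
  exact IntegrableOn.congr_fun
    ((integrableOn_rpow_neg_mul_exp_neg_div (half_pos hα) hpos).const_mul _)
    (fun b hb => (rpow_mul_pi_div_rpow_mul_exp_eq hb ξ).symm) measurableSet_Ioi

theorem integral_rpow_mul_fourier_gaussian (hα : 0 < α) {ξ : E} (hξ : ξ ≠ 0) :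
    ∫ b in Set.Ioi 0, b ^ ((d - α) / 2 - 1) *
        ((Real.pi / b) ^ ((d : ℝ) / 2) * Real.exp (-(Real.pi ^ 2 * ‖ξ‖ ^ 2 / b))) =
      subordinationConst d α * (2 * Real.pi * ‖ξ‖) ^ (-α) := by
  have := norm_pos_iff.2 hξ
  have hpow : (1 / (Real.pi ^ 2 * ‖ξ‖ ^ 2)) ^ (α / 2) = 2 ^ α * (2 * Real.pi * ‖ξ‖) ^ (-α) := by
    have hhalf : ((2 : ℕ) : ℝ) * (α / 2) = α := by push_cast; ring
    rw [one_div, ← mul_pow, Real.inv_rpow (by positivity), ← Real.rpow_natCast,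
      ← Real.rpow_mul (by positivity), hhalf, mul_assoc 2, Real.mul_rpow two_pos.le (by positivity),
      ← mul_assoc, ← Real.rpow_add two_pos, add_neg_cancel, Real.rpow_zero, one_mul,
      Real.rpow_neg (by positivity)]
  rw [setIntegral_congr_fun measurableSet_Ioi fun b hb => rpow_mul_pi_div_rpow_mul_exp_eq hb ξ,
    integral_const_mul, integral_rpow_neg_mul_exp_neg_div (half_pos hα) (by positivity), hpow,
    subordinationConst]
  ring

theorem integral_rieszKernel_mul_eq_integral_gaussian (hα : 0 < α) (hαd : α < d) {f : E → ℂ}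
    (hf : AEStronglyMeasurable f volume) (x : E)
    (hK : Integrable fun y => (rieszKernel d α (x - y) : ℂ) * f y) :
    (subordinationConst d α : ℂ) *
        ∫ y, (rieszKernel d α (x - y) : ℂ) * f y =
      ∫ b in Set.Ioi 0, ((b ^ ((d - α) / 2 - 1) : ℝ) : ℂ) *
        ∫ y, ((Real.exp (-(‖x - y‖ ^ 2 * b)) : ℝ) : ℂ) * f y := by
  have hne : ∀ᵐ y : E, x - y ≠ 0 :=
    (ae_ne_of_pos_dim (Nat.cast_pos.1 (hα.trans hαd)) x).mono fun y hy => sub_ne_zero.2 hy.symm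
  have hswap := integral_mul_eq_integral_integral_of_nonneg
    (ν := volume.restrict (Set.Ioi 0)) (f := f)
    (κ := fun y b => b ^ ((d - α) / 2 - 1) * Real.exp (-(‖x - y‖ ^ 2 * b))) (by fun_prop)
    (fun y => (ae_restrict_mem measurableSet_Ioi).mono fun b hb =>
      mul_nonneg (Real.rpow_nonneg (le_of_lt hb) _) (Real.exp_nonneg _))
    (hne.mono fun y hy => integrableOn_rpow_mul_exp_neg_mul (by linarith)
      (pow_pos (norm_pos_iff.2 hy) 2))
    (hne.mono fun y hy => rieszKernel_eq_integral hα hαd hy) hf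
    ((hK.const_mul (subordinationConst d α : ℂ)).congr (Eventually.of_forall fun y => by
      simp only [Complex.ofReal_mul, mul_assoc]))
  simp only [Complex.ofReal_mul, mul_assoc, integral_const_mul] at hswap ⊢
  exact hswap

theorem integral_norm_rpow_neg_mul_eq_integral_gaussian (hα : 0 < α) (hd : 0 < d) {f : E → ℂ}
    (hf : AEStronglyMeasurable f volume)
    (hK : Integrable fun ξ => (((2 * Real.pi * ‖ξ‖) ^ (-α) : ℝ) : ℂ) * f ξ) :
    (subordinationConst d α : ℂ) *
        ∫ ξ, (((2 * Real.pi * ‖ξ‖) ^ (-α) : ℝ) : ℂ) * f ξ =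
      ∫ b in Set.Ioi 0, ((b ^ ((d - α) / 2 - 1) : ℝ) : ℂ) *
        ∫ ξ, (((Real.pi / b) ^ ((d : ℝ) / 2) *
          Real.exp (-(Real.pi ^ 2 * ‖ξ‖ ^ 2 / b)) : ℝ) : ℂ) * f ξ := by
  have hswap := integral_mul_eq_integral_integral_of_nonneg
    (ν := volume.restrict (Set.Ioi 0)) (f := f)
    (κ := fun (ξ : E) b => b ^ ((d - α) / 2 - 1) *
      ((Real.pi / b) ^ ((d : ℝ) / 2) * Real.exp (-(Real.pi ^ 2 * ‖ξ‖ ^ 2 / b)))) (by fun_prop)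
    (fun ξ => (ae_restrict_mem measurableSet_Ioi).mono fun b (hb : 0 < b) => by
      simp only [Pi.zero_apply]
      positivity)
    ((ae_ne_of_pos_dim hd 0).mono fun ξ hξ => integrableOn_rpow_mul_fourier_gaussian hα hξ)
    ((ae_ne_of_pos_dim hd 0).mono fun ξ hξ => integral_rpow_mul_fourier_gaussian hα hξ) hf
    ((hK.const_mul (subordinationConst d α : ℂ)).congr (Eventually.of_forall fun y => by
      simp only [Complex.ofReal_mul, mul_assoc]))
  simp only [Complex.ofReal_mul, mul_assoc, integral_const_mul] at hswap ⊢
  exact hswap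

/-- Both kernels are superpositions of Gaussians, for which the identity is the convolution
theorem. -/
theorem integral_rieszKernel_mul_fourierInv (hα : 0 < α) (hαd : α < d) {F : E → ℂ}
    (hF : Integrable F)
    (hG : Integrable fun ξ => (((2 * Real.pi * ‖ξ‖) ^ (-α) : ℝ) : ℂ) * F ξ) (x : E)
    (hK : Integrable fun y => (rieszKernel d α (x - y) : ℂ) * 𝓕⁻ F y) :
    ∫ y, (rieszKernel d α (x - y) : ℂ) * 𝓕⁻ F y =
      𝓕⁻ (fun ξ => (((2 * Real.pi * ‖ξ‖) ^ (-α) : ℝ) : ℂ) * F ξ) x := by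
  have hconst : (subordinationConst d α : ℂ) ≠ 0 := by
    have := Real.Gamma_pos_of_pos (half_pos hα)
    rw [subordinationConst, Complex.ofReal_ne_zero]
    positivity
  have hcomm : ∀ ξ : E, Real.fourierChar (inner ℝ ξ x) •
      ((((2 * Real.pi * ‖ξ‖) ^ (-α) : ℝ) : ℂ) * F ξ) =
      (((2 * Real.pi * ‖ξ‖) ^ (-α) : ℝ) : ℂ) * (Real.fourierChar (inner ℝ ξ x) • F ξ) :=
    fun ξ => (mul_smul_comm _ _ _).symm
  refine mul_left_cancel₀ hconst ?_
  rw [integral_rieszKernel_mul_eq_integral_gaussian hα hαd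
    (continuous_fourierInv hF).aestronglyMeasurable x hK, Real.fourierInv_eq]
  simp only [hcomm]
  rw [integral_norm_rpow_neg_mul_eq_integral_gaussian hα (Nat.cast_pos.1 (hα.trans hαd))
    (integrable_fourierChar_smul hF x).aestronglyMeasurable]
  · refine setIntegral_congr_fun measurableSet_Ioi fun b hb => ?_
    beta_reduce
    rw [integral_gaussian_mul_fourierInv hF hb, finrank_euclideanSpace_fin]
  · simpa only [hcomm] using integrable_fourierChar_smul hG x

end RieszFourier

section FourierL2

variable {V : Type*} [NormedAddCommGroup V] [InnerProductSpace ℝ V] [FiniteDimensional ℝ V]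
  [MeasurableSpace V] [BorelSpace V]

theorem integral_fourierInv_mul_eq_flip {f g : V → ℂ} (hf : Integrable f) (hg : Integrable g) :
    ∫ ξ, 𝓕⁻ f ξ * g ξ = ∫ x, f x * 𝓕⁻ g x := by
  rw [Real.fourierInv_eq_fourier_comp_neg, integral_fourier_mul_eq_flip hf.comp_neg hg,
    ← integral_neg_eq_self]
  simp only [neg_neg, Real.fourierInv_eq_fourier_neg]

theorem coeFn_fourierInv_toLp_ae_eq {g : V → ℂ} (hg : Integrable g) (hg2 : MemLp g 2) :
    (𝓕⁻ (hg2.toLp g) : Lp ℂ 2 (volume : Measure V)) =ᵐ[volume] 𝓕⁻ g := by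
  refine ae_eq_of_integral_contDiff_smul_eq ((Lp.memLp _).locallyIntegrable one_le_two)
    (continuous_fourierInv hg).locallyIntegrable fun φ hφ hc => ?_
  let f := toSchwartzComplex φ hc hφ
  have hdist := congrArg (fun S : 𝓢'(V, ℂ) => S f)
    (Lp.fourierInv_toTemperedDistribution_eq (hg2.toLp g))
  simp only [TemperedDistribution.fourierInv_apply, Lp.toTemperedDistribution_apply,
    smul_eq_mul] at hdist
  calc ∫ x, φ x • (𝓕⁻ (hg2.toLp g) : Lp ℂ 2 (volume : Measure V)) x
      = ∫ x, f x * (𝓕⁻ (hg2.toLp g) : Lp ℂ 2 (volume : Measure V)) x := rfl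
    _ = ∫ ξ, 𝓕⁻ (f : V → ℂ) ξ * g ξ := by
        rw [← hdist]
        refine integral_congr_ae (hg2.coeFn_toLp.mono fun ξ hξ => ?_)
        simp only [hξ, SchwartzMap.fourierInv_coe]
    _ = ∫ x, f x * 𝓕⁻ g x := integral_fourierInv_mul_eq_flip f.integrable hg
    _ = ∫ x, φ x • 𝓕⁻ g x := rfl

theorem eLpNorm_fourierInv {g : V → ℂ} (hg : Integrable g) (hg2 : MemLp g 2) :
    eLpNorm (𝓕⁻ g) 2 volume = eLpNorm g 2 volume := by
  rw [← eLpNorm_congr_ae (coeFn_fourierInv_toLp_ae_eq hg hg2), ← eLpNorm_congr_ae hg2.coeFn_toLp,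
    ← Lp.enorm_def, ← Lp.enorm_def, ← ofReal_norm, ← ofReal_norm]
  congr 1
  rw [← Lp.norm_fourier_eq, FourierTransform.fourier_fourierInv_eq]

end FourierL2

section PowerWeights

variable {V : Type*} [NormedAddCommGroup V] [MeasurableSpace V] [BorelSpace V]

theorem measurable_two_pi_norm_rpow (r : ℝ) : Measurable fun ξ : V => (2 * Real.pi * ‖ξ‖) ^ r :=
  (measurable_norm.const_mul _).pow_const _

variable [InnerProductSpace ℝ V] [FiniteDimensional ℝ V]

theorem integrableOn_ball_two_pi_norm_rpow (hV : 1 ≤ finrank ℝ V) {r : ℝ}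
    (hr : -(finrank ℝ V : ℝ) < r) (R : ℝ) :
    IntegrableOn (fun ξ : V => (2 * Real.pi * ‖ξ‖) ^ r) (Metric.ball 0 R) := by
  refine IntegrableOn.congr_fun ((integrableOn_ball_norm_rpow_neg volume hV
    (neg_lt.1 hr) R).const_mul ((2 * Real.pi) ^ r)) (fun ξ _ => ?_) measurableSet_ball
  rw [Real.mul_rpow (by positivity) (norm_nonneg _), neg_neg]

theorem setIntegral_ball_two_pi_norm_rpow (r : ℝ) {A : ℝ} (hA : 0 < A) :
    ∫ ξ in Metric.ball (0 : V) A, (2 * Real.pi * ‖ξ‖) ^ r =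
      A ^ (r + finrank ℝ V) * ∫ ξ in Metric.ball (0 : V) 1, (2 * Real.pi * ‖ξ‖) ^ r := by
  have hscale (ξ : V) : (2 * Real.pi * ‖A • ξ‖) ^ r = A ^ r * (2 * Real.pi * ‖ξ‖) ^ r := by
    rw [norm_smul, Real.norm_of_nonneg hA.le, ← Real.mul_rpow hA.le (by positivity),
      mul_left_comm]
  have hball := Measure.setIntegral_comp_smul_of_pos (volume : Measure V)
    (fun ξ => (2 * Real.pi * ‖ξ‖) ^ r) (Metric.ball 0 1) hA
  simp only [smul_unitBall_of_pos hA, hscale, integral_const_mul, smul_eq_mul] at hball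
  rw [Real.rpow_add hA, Real.rpow_natCast, mul_right_comm, hball]
  field_simp

theorem integrable_two_pi_norm_rpow_mul_norm_schwartzMap (hV : 1 ≤ finrank ℝ V) {r : ℝ}
    (hr : -(finrank ℝ V : ℝ) < r) (φ : 𝓢(V, ℂ)) :
    Integrable fun ξ => (2 * Real.pi * ‖ξ‖) ^ r * ‖φ ξ‖ := by
  obtain ⟨C, -, hφ⟩ := exists_norm_schwartzMap_le φ 0
  have hnear : Integrable fun ξ : V =>
      (Metric.ball 0 1).indicator (fun ξ => (2 * Real.pi * ‖ξ‖) ^ r) ξ * C :=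
    ((integrable_indicator_iff measurableSet_ball).2
      (integrableOn_ball_two_pi_norm_rpow hV hr 1)).mul_const C
  have hfar := (integrable_norm_schwartzMap_mul_rpow φ |r|).const_mul ((2 * Real.pi) ^ r)
  refine (hnear.add hfar).mono' ((measurable_two_pi_norm_rpow r).aestronglyMeasurable.mul
    φ.continuous.norm.aestronglyMeasurable) (Eventually.of_forall fun ξ => ?_)
  rw [Real.norm_of_nonneg (by positivity), Pi.add_apply]
  by_cases hξ : ξ ∈ Metric.ball 0 1
  · rw [Set.indicator_of_mem hξ]
    refine le_add_of_le_of_nonneg ?_ (by positivity)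
    gcongr
    simpa using hφ ξ
  · have hone : 1 ≤ ‖ξ‖ := by simpa using hξ
    rw [Set.indicator_of_notMem hξ, zero_mul, zero_add, mul_comm ‖φ ξ‖, ← mul_assoc,
      Real.mul_rpow (by positivity) (norm_nonneg _)]
    gcongr
    exact (Real.rpow_le_rpow_of_exponent_le hone (le_abs_self r)).trans (by gcongr; linarith)

end PowerWeights

section SobolevWeight

variable {d : ℕ} {s : ℝ}

local notation "E" => EuclideanSpace ℝ (Fin d)

theorem aestronglyMeasurable_sobolevWeight (s : ℝ) {g : E → ℂ}
    (hg : AEStronglyMeasurable g volume) :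
    AEStronglyMeasurable (sobolevWeight s g) volume :=
  (Complex.measurable_ofReal.comp (measurable_two_pi_norm_rpow s)).aestronglyMeasurable.mul hg

theorem enorm_sobolevWeight (s : ℝ) (g : E → ℂ) (ξ : E) :
    ‖sobolevWeight s g ξ‖ₑ = ENNReal.ofReal ((2 * Real.pi * ‖ξ‖) ^ s) * ‖g ξ‖ₑ := by
  rw [sobolevWeight, enorm_mul, ← ofReal_norm, Complex.norm_real,
    Real.norm_of_nonneg (by positivity)]

theorem sobolevWeight_sobolevWeight_neg (s : ℝ) (G : E → ℂ) {ξ : E} (hξ : ξ ≠ 0) :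
    sobolevWeight s (sobolevWeight (-s) G) ξ = G ξ := by
  have hpos : 0 < 2 * Real.pi * ‖ξ‖ := by positivity
  rw [sobolevWeight, sobolevWeight, ← mul_assoc, ← Complex.ofReal_mul, ← Real.rpow_add hpos]
  simp

theorem ae_eq_zero_of_sobolevWeight_ae_eq_zero (hd : 0 < d) {g : E → ℂ}
    (hg : sobolevWeight s g =ᵐ[volume] 0) : g =ᵐ[volume] 0 := by
  filter_upwards [hg, ae_ne_of_pos_dim hd 0] with ξ hξ hξ0
  have hpos : 0 < (2 * Real.pi * ‖ξ‖) ^ s := by positivity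
  exact (mul_eq_zero.1 hξ).resolve_left (Complex.ofReal_ne_zero.2 hpos.ne')

theorem memLp_sobolevWeight_schwartzMap (hd : 0 < d) (hs : -(d : ℝ) < 2 * s) (φ : 𝓢(E, ℂ)) :
    MemLp (sobolevWeight s φ) 2 volume := by
  obtain ⟨C, -, hφ⟩ := exists_norm_schwartzMap_le φ 0
  have hmeas := aestronglyMeasurable_sobolevWeight s φ.continuous.aestronglyMeasurable
  rw [memLp_two_iff_integrable_sq_norm hmeas]
  refine ((integrable_two_pi_norm_rpow_mul_norm_schwartzMap (by simpa) (by simpa)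
    φ).const_mul C).mono' (hmeas.norm.pow 2) (Eventually.of_forall fun ξ => ?_)
  have hpow : ((2 * Real.pi * ‖ξ‖) ^ s) ^ 2 = (2 * Real.pi * ‖ξ‖) ^ (2 * s) := by
    rw [← Real.rpow_mul_natCast (by positivity), Nat.cast_ofNat, mul_comm s]
  rw [Real.norm_of_nonneg (by positivity), sobolevWeight, norm_mul, Complex.norm_real,
    Real.norm_of_nonneg (by positivity), mul_pow, hpow, sq ‖φ ξ‖, mul_left_comm]
  gcongr
  simpa using hφ ξ

theorem integrable_sobolevWeight_neg_mul_schwartzMap (hd : 0 < d) (hsd : 2 * s < d) {G : E → ℂ}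
    (hG : MemLp G 2) (φ : 𝓢(E, ℂ)) : Integrable fun ξ => sobolevWeight (-s) G ξ * φ ξ := by
  refine (hG.integrable_mul
    (memLp_sobolevWeight_schwartzMap hd (by linarith : -(d : ℝ) < 2 * -s) φ)).congr ?_
  exact Eventually.of_forall fun ξ => by
    simp only [Pi.mul_apply, sobolevWeight]
    ring

end SobolevWeight

section LevelSets

theorem lintegral_Ioi_indicator_rpow {r b : ℝ} (hr : -1 < r) (hb : 0 ≤ b) :
    ∫⁻ t in Set.Ioi (0 : ℝ), (Set.Iic b).indicator (fun t => ENNReal.ofReal (t ^ r)) t =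
      ENNReal.ofReal (b ^ (r + 1) / (r + 1)) := by
  rw [lintegral_indicator measurableSet_Iic, Measure.restrict_restrict measurableSet_Iic,
    Set.Iic_inter_Ioi, ← ofReal_integral_eq_lintegral_ofReal,
    ← intervalIntegral.integral_of_le hb, integral_rpow (Or.inl hr),
    Real.zero_rpow (by linarith), sub_zero]
  · exact (intervalIntegrable_iff_integrableOn_Ioc_of_le hb).1
      (intervalIntegral.intervalIntegrable_rpow' hr)
  · filter_upwards [ae_restrict_mem measurableSet_Ioc] with t ht
    exact Real.rpow_nonneg ht.1.le _

theorem lintegral_Ioi_rpow_mul_setLIntegral {Y : Type*} [MeasurableSpace Y] {ν : Measure Y}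
    [SFinite ν] {L : Y → ℝ} (hL : Measurable L) (hL0 : ∀ y, 0 ≤ L y) {w : Y → ℝ≥0∞}
    (hw : AEMeasurable w ν) {r : ℝ} (hr : -1 < r) :
    ∫⁻ t in Set.Ioi (0 : ℝ), ENNReal.ofReal (t ^ r) * ∫⁻ y in {y | t ≤ L y}, w y ∂ν =
      ∫⁻ y, ENNReal.ofReal (L y ^ (r + 1) / (r + 1)) * w y ∂ν := by
  let k (t : ℝ) (y : Y) : ℝ≥0∞ := (Set.Iic (L y)).indicator (fun t => ENNReal.ofReal (t ^ r)) t
  have hk : Measurable (Function.uncurry k) :=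
    Measurable.indicator (f := fun z : ℝ × Y => ENNReal.ofReal (z.1 ^ r))
      (measurable_fst.pow_const _).ennreal_ofReal
      (measurableSet_le measurable_fst (hL.comp measurable_snd))
  have hslice (t : ℝ) : ENNReal.ofReal (t ^ r) * ∫⁻ y in {y | t ≤ L y}, w y ∂ν =
      ∫⁻ y, k t y * w y ∂ν := by
    rw [← lintegral_indicator (measurableSet_le measurable_const hL),
      ← lintegral_const_mul' _ _ ENNReal.ofReal_ne_top]
    refine lintegral_congr fun y => ?_
    by_cases hy : t ≤ L y <;> simp [k, hy]
  simp only [hslice]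
  rw [lintegral_lintegral_swap (hk.aemeasurable.mul hw.comp_snd)]
  refine lintegral_congr fun y => ?_
  rw [lintegral_mul_const _ hk.of_uncurry_right, lintegral_Ioi_indicator_rpow hr (hL0 y)]

theorem lintegral_enorm_rpow_le_of_meas_lt_le {X Y F : Type*} [MeasurableSpace X]
    [MeasurableSpace Y] [NormedAddCommGroup F] {μ : Measure X} {ν : Measure Y} [SFinite ν]
    {f : X → F} (hf : AEStronglyMeasurable f μ) {L : Y → ℝ} (hL : Measurable L)
    (hL0 : ∀ y, 0 ≤ L y) {w : Y → ℝ≥0∞} (hw : AEMeasurable w ν) {p : ℝ} (hp : 2 < p)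
    (h : ∀ t : ℝ, 0 < t → μ {x | t < ‖f x‖} ≤
      ENNReal.ofReal (4 * t ^ (-2 : ℝ)) * ∫⁻ y in {y | t ≤ L y}, w y ∂ν) :
    ∫⁻ x, ‖f x‖ₑ ^ p ∂μ ≤
      ENNReal.ofReal (4 * p) * ∫⁻ y, ENNReal.ofReal (L y ^ (p - 2) / (p - 2)) * w y ∂ν := by
  have hp0 : 0 < p := by linarith
  have hslice (t : ℝ) (ht : 0 < t) : μ {x | t < ‖f x‖} * ENNReal.ofReal (t ^ (p - 1)) ≤
      4 * (ENNReal.ofReal (t ^ (p - 3)) * ∫⁻ y in {y | t ≤ L y}, w y ∂ν) := by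
    have hpow : t ^ (-2 : ℝ) * t ^ (p - 1) = t ^ (p - 3) := by
      rw [← Real.rpow_add ht]
      ring_nf
    refine (mul_le_mul_left (h t ht) _).trans_eq ?_
    rw [mul_right_comm, ← ENNReal.ofReal_mul (by positivity), mul_assoc 4, hpow,
      ENNReal.ofReal_mul (by norm_num), ENNReal.ofReal_ofNat, mul_assoc]
  calc ∫⁻ x, ‖f x‖ₑ ^ p ∂μ = ∫⁻ x, ENNReal.ofReal (‖f x‖ ^ p) ∂μ := by
        simp only [← ENNReal.ofReal_rpow_of_nonneg (norm_nonneg _) hp0.le, ofReal_norm]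
    _ = ENNReal.ofReal p *
          ∫⁻ t in Set.Ioi 0, μ {x | t < ‖f x‖} * ENNReal.ofReal (t ^ (p - 1)) :=
        lintegral_rpow_eq_lintegral_meas_lt_mul μ (Eventually.of_forall fun x => norm_nonneg _)
          hf.norm.aemeasurable hp0
    _ ≤ ENNReal.ofReal p * ∫⁻ t in Set.Ioi 0,
          4 * (ENNReal.ofReal (t ^ (p - 3)) * ∫⁻ y in {y | t ≤ L y}, w y ∂ν) :=
        mul_le_mul_right (setLIntegral_mono' measurableSet_Ioi hslice) _
    _ = ENNReal.ofReal (4 * p) *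
          ∫⁻ y, ENNReal.ofReal (L y ^ (p - 3 + 1) / (p - 3 + 1)) * w y ∂ν := by
        rw [lintegral_const_mul' _ _ (by norm_num),
          lintegral_Ioi_rpow_mul_setLIntegral hL hL0 hw (by linarith), ← mul_assoc,
          ENNReal.ofReal_mul (by norm_num), ENNReal.ofReal_ofNat, mul_comm (4 : ℝ≥0∞)]
    _ = _ := by rw [show p - 3 + 1 = p - 2 by ring]

end LevelSets

section SobolevEmbedding

variable {d : ℕ} {s : ℝ}

local notation "E" => EuclideanSpace ℝ (Fin d)

theorem norm_fourierInv_indicator_le {V : Type*} [NormedAddCommGroup V] [InnerProductSpace ℝ V]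
    [FiniteDimensional ℝ V] [MeasurableSpace V] [BorelSpace V] {g : V → ℂ}
    (hg : AEStronglyMeasurable g) {S : Set V} (hS : MeasurableSet S) {b : ℝ} (hb : 0 ≤ b)
    (h : ∫⁻ ξ in S, ‖g ξ‖ₑ ≤ ENNReal.ofReal b) (x : V) : ‖𝓕⁻ (S.indicator g) x‖ ≤ b := by
  refine (norm_fourierInv_le _ x).trans ?_
  simp only [norm_indicator_eq_indicator_norm]
  rw [integral_indicator hS, integral_norm_eq_lintegral_enorm hg.restrict]
  exact ENNReal.toReal_le_of_le_ofReal hb h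

theorem lintegral_enorm_rpow_two {X F : Type*} [MeasurableSpace X] [NormedAddCommGroup F]
    {μ : Measure X} (f : X → F) : ∫⁻ x, ‖f x‖ₑ ^ (2 : ℝ) ∂μ = eLpNorm f 2 μ ^ (2 : ℝ) := by
  rw [eLpNorm_eq_lintegral_rpow_enorm_toReal (by norm_num) (by norm_num), ENNReal.toReal_ofNat,
    ← ENNReal.rpow_mul, one_div, inv_mul_cancel₀ (by norm_num), ENNReal.rpow_one]

/-- Chebyshev and Plancherel for the part of `g` off `S`: the part on `S` contributes at most
`t / 2` to `𝓕⁻ g`. -/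
theorem measure_lt_norm_fourierInv_le {V : Type*} [NormedAddCommGroup V] [InnerProductSpace ℝ V]
    [FiniteDimensional ℝ V] [MeasurableSpace V] [BorelSpace V] {g : V → ℂ} (hg : Integrable g)
    (hg2 : MemLp g 2) {S : Set V} (hS : MeasurableSet S) {t : ℝ} (ht : 0 < t)
    (hlow : ∫⁻ ξ in S, ‖g ξ‖ₑ ≤ ENNReal.ofReal (t / 2)) :
    volume {x | t < ‖𝓕⁻ g x‖} ≤
      ENNReal.ofReal (4 * t ^ (-2 : ℝ)) * ∫⁻ ξ in Sᶜ, ‖g ξ‖ₑ ^ (2 : ℝ) := by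
  have hh : Integrable (Sᶜ.indicator g) := hg.indicator hS.compl
  have hsub : {x | t < ‖𝓕⁻ g x‖} ⊆ {x | ENNReal.ofReal (t / 2) ≤ ‖𝓕⁻ (Sᶜ.indicator g) x‖ₑ} := by
    intro x (hx : t < ‖𝓕⁻ g x‖)
    have hsplit : 𝓕⁻ g x = 𝓕⁻ (S.indicator g) x + 𝓕⁻ (Sᶜ.indicator g) x := by
      rw [← fourierInv_add_apply (hg.indicator hS) hh]
      exact congrArg (fun f : V → ℂ => 𝓕⁻ f x) (Set.indicator_self_add_compl S g).symm
    rw [hsplit] at hx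
    have hnorm : t / 2 ≤ ‖𝓕⁻ (Sᶜ.indicator g) x‖ := by
      linarith [norm_add_le (𝓕⁻ (S.indicator g) x) (𝓕⁻ (Sᶜ.indicator g) x),
        norm_fourierInv_indicator_le hg.1 hS (by positivity) hlow x]
    rw [Set.mem_ofPred_eq, ← ofReal_norm]
    gcongr
  have hplancherel : eLpNorm (𝓕⁻ (Sᶜ.indicator g)) 2 volume ^ (2 : ℝ) =
      ∫⁻ ξ in Sᶜ, ‖g ξ‖ₑ ^ (2 : ℝ) := by
    rw [eLpNorm_fourierInv hh (hg2.indicator hS.compl),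
      eLpNorm_indicator_eq_eLpNorm_restrict hS.compl, lintegral_enorm_rpow_two]
  have hconst : ENNReal.ofReal (4 * t ^ (-2 : ℝ)) = (ENNReal.ofReal (t / 2))⁻¹ ^ (2 : ℝ) := by
    rw [← ENNReal.ofReal_inv_of_pos (by positivity),
      ENNReal.ofReal_rpow_of_nonneg (by positivity) (by norm_num), Real.rpow_neg ht.le,
      Real.rpow_two, Real.rpow_two]
    congr 1
    field_simp
    norm_num
  rw [← hplancherel, hconst]
  refine (measure_mono hsub).trans ?_
  simpa using meas_ge_le_mul_pow_eLpNorm_enorm volume two_ne_zero ENNReal.ofNat_ne_top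
    (continuous_fourierInv hh).aestronglyMeasurable
    (ENNReal.ofReal_pos.2 (half_pos ht)).ne' (fun h => absurd h ENNReal.ofReal_ne_top)

theorem lintegral_ball_two_pi_norm_rpow_neg_rpow_two (hd : 0 < d) (hsd : 2 * s < d) {A : ℝ}
    (hA : 0 < A) :
    ∫⁻ ξ in Metric.ball (0 : E) A, ENNReal.ofReal ((2 * Real.pi * ‖ξ‖) ^ (-s)) ^ (2 : ℝ) =
      ENNReal.ofReal
        (A ^ (d - 2 * s) * ∫ ξ in Metric.ball (0 : E) 1, (2 * Real.pi * ‖ξ‖) ^ (-(2 * s))) := by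
  have hscale := setIntegral_ball_two_pi_norm_rpow (V := E) (-(2 * s)) hA
  rw [finrank_euclideanSpace_fin, neg_add_eq_sub] at hscale
  rw [← hscale, ofReal_integral_eq_lintegral_ofReal
    (integrableOn_ball_two_pi_norm_rpow (by simpa) (by simpa) A)
    (Eventually.of_forall fun ξ => by positivity)]
  refine lintegral_congr fun ξ => ?_
  rw [ENNReal.ofReal_rpow_of_nonneg (by positivity) (by norm_num), ← Real.rpow_mul (by positivity)]
  ring_nf

theorem exists_lintegral_ball_enorm_le (hd : 0 < d) (hsd : 2 * s < d) :
    ∃ B : ℝ, 0 < B ∧ ∀ g : E → ℂ, AEStronglyMeasurable g volume → ∀ A : ℝ, 0 < A →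
      ∫⁻ ξ in Metric.ball 0 A, ‖g ξ‖ₑ ≤
        ENNReal.ofReal (B * A ^ ((d - 2 * s) / 2)) * eLpNorm (sobolevWeight s g) 2 volume := by
  set J : ℝ := ∫ ξ in Metric.ball (0 : E) 1, (2 * Real.pi * ‖ξ‖) ^ (-(2 * s))
  have hJ : 0 ≤ J := setIntegral_nonneg measurableSet_ball fun ξ _ => by positivity
  refine ⟨J ^ (1 / 2 : ℝ) + 1, by positivity, fun g hg A hA => ?_⟩
  let w (ξ : E) : ℝ≥0∞ := ENNReal.ofReal ((2 * Real.pi * ‖ξ‖) ^ (-s))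
  have hweight : (∫⁻ ξ in Metric.ball 0 A, w ξ ^ (2 : ℝ)) ^ (1 / 2 : ℝ) ≤
      ENNReal.ofReal ((J ^ (1 / 2 : ℝ) + 1) * A ^ ((d - 2 * s) / 2)) := by
    rw [lintegral_ball_two_pi_norm_rpow_neg_rpow_two hd hsd hA,
      ENNReal.ofReal_rpow_of_nonneg (by positivity) (by norm_num), Real.mul_rpow (by positivity) hJ,
      ← Real.rpow_mul hA.le, mul_one_div, mul_comm]
    gcongr
    linarith
  calc ∫⁻ ξ in Metric.ball 0 A, ‖g ξ‖ₑ
      = ∫⁻ ξ in Metric.ball 0 A, (w * fun ξ => ‖sobolevWeight s g ξ‖ₑ) ξ := by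
        refine lintegral_congr_ae (ae_restrict_of_ae ?_)
        filter_upwards [ae_ne_of_pos_dim hd 0] with ξ hξ
        have hpos : 0 < 2 * Real.pi * ‖ξ‖ := by positivity
        rw [Pi.mul_apply, enorm_sobolevWeight, ← mul_assoc, ← ENNReal.ofReal_mul (by positivity),
          ← Real.rpow_add hpos, neg_add_cancel, Real.rpow_zero, ENNReal.ofReal_one, one_mul]
    _ ≤ (∫⁻ ξ in Metric.ball 0 A, w ξ ^ (2 : ℝ)) ^ (1 / 2 : ℝ) *
          (∫⁻ ξ in Metric.ball 0 A, ‖sobolevWeight s g ξ‖ₑ ^ (2 : ℝ)) ^ (1 / 2 : ℝ) :=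
        ENNReal.lintegral_mul_le_Lp_mul_Lq _ Real.HolderConjugate.two_two
          (measurable_two_pi_norm_rpow (-s)).ennreal_ofReal.aemeasurable
          (aestronglyMeasurable_sobolevWeight s hg).enorm.restrict
    _ ≤ _ := by
        refine mul_le_mul' hweight ?_
        rw [lintegral_enorm_rpow_two, ← ENNReal.rpow_mul, mul_one_div, div_self two_ne_zero,
          ENNReal.rpow_one]
        exact eLpNorm_mono_measure _ Measure.restrict_le_self

theorem measure_lt_norm_fourierInv_le_superlevel (hsd : 2 * s < d) {g : E → ℂ}
    (hg : Integrable g) (hg2 : MemLp g 2) {c : ℝ} (hc : 0 < c)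
    (hlow : ∀ A : ℝ, 0 < A → ∫⁻ ξ in Metric.ball 0 A, ‖g ξ‖ₑ ≤
      ENNReal.ofReal (c / 2 * A ^ ((d - 2 * s) / 2))) {t : ℝ} (ht : 0 < t) :
    volume {x | t < ‖𝓕⁻ g x‖} ≤ ENNReal.ofReal (4 * t ^ (-2 : ℝ)) *
      ∫⁻ ξ in {ξ | t ≤ c * ‖ξ‖ ^ ((d - 2 * s) / 2)}, ‖g ξ‖ₑ ^ (2 : ℝ) := by
  have hγ : 0 < (d - 2 * s) / 2 := by linarith
  have hset : {ξ : E | t ≤ c * ‖ξ‖ ^ ((d - 2 * s) / 2)} =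
      (Metric.ball 0 ((t / c) ^ ((d - 2 * s) / 2)⁻¹))ᶜ := by
    ext ξ
    rw [Set.mem_compl_iff, mem_ball_zero_iff, Real.lt_rpow_inv_iff_of_pos (norm_nonneg _)
      (by positivity) hγ, not_lt, div_le_iff₀' hc, Set.mem_ofPred_eq]
  rw [hset]
  refine measure_lt_norm_fourierInv_le hg hg2 measurableSet_ball ht
    ((hlow _ (by positivity)).trans_eq ?_)
  rw [← Real.rpow_mul (by positivity), inv_mul_cancel₀ hγ.ne', Real.rpow_one]
  field_simp

theorem two_lt_two_mul_div_sub (hs : 0 < s) (hsd : 2 * s < d) :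
    2 < 2 * (d : ℝ) / (d - 2 * s) := by
  rw [lt_div_iff₀ (by linarith)]
  linarith

theorem one_le_sobolevExponent (hs : 0 < s) (hsd : 2 * s < d) : 1 ≤ sobolevExponent d s := by
  simpa [sobolevExponent] using (one_lt_two.trans (two_lt_two_mul_div_sub hs hsd)).le

theorem lintegral_enorm_fourierInv_rpow_le (hs : 0 < s) (hsd : 2 * s < d) {g : E → ℂ}
    (hg : Integrable g) (hg2 : MemLp g 2) {c : ℝ} (hc : 0 < c)
    (hlow : ∀ A : ℝ, 0 < A → ∫⁻ ξ in Metric.ball 0 A, ‖g ξ‖ₑ ≤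
      ENNReal.ofReal (c / 2 * A ^ ((d - 2 * s) / 2))) {p : ℝ} (hp : p = 2 * d / (d - 2 * s)) :
    ∫⁻ x, ‖𝓕⁻ g x‖ₑ ^ p ≤
      ENNReal.ofReal (4 * p * (c ^ (p - 2) * (2 * Real.pi) ^ (-(2 * s)) / (p - 2))) *
        eLpNorm (sobolevWeight s g) 2 volume ^ (2 : ℝ) := by
  have hp2 : 2 < p := hp ▸ two_lt_two_mul_div_sub hs hsd
  have hexp : (d - 2 * s) / 2 * (p - 2) = 2 * s := by
    have hne : (d : ℝ) - 2 * s ≠ 0 := by linarith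
    rw [hp]
    field_simp
    ring
  have hweight (ξ : E) :
      ENNReal.ofReal ((c * ‖ξ‖ ^ ((d - 2 * s) / 2)) ^ (p - 2) / (p - 2)) * ‖g ξ‖ₑ ^ (2 : ℝ) =
        ENNReal.ofReal (c ^ (p - 2) * (2 * Real.pi) ^ (-(2 * s)) / (p - 2)) *
          ‖sobolevWeight s g ξ‖ₑ ^ (2 : ℝ) := by
    rw [enorm_sobolevWeight, ENNReal.mul_rpow_of_nonneg _ _ zero_le_two, ← mul_assoc,
      ENNReal.ofReal_rpow_of_nonneg (by positivity) zero_le_two,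
      ← ENNReal.ofReal_mul (by have := sub_pos.2 hp2; positivity), ← Real.rpow_mul (by positivity),
      mul_comm s 2, Real.mul_rpow hc.le (by positivity), ← Real.rpow_mul (norm_nonneg _), hexp,
      Real.mul_rpow (by positivity) (norm_nonneg _), Real.rpow_neg (by positivity)]
    congr 2
    field_simp
  refine (lintegral_enorm_rpow_le_of_meas_lt_le (continuous_fourierInv hg).aestronglyMeasurable
    ((measurable_norm.pow_const _).const_mul c) (fun ξ => by positivity) (hg.1.enorm.pow_const _)
    hp2 fun t ht => measure_lt_norm_fourierInv_le_superlevel hsd hg hg2 hc hlow ht).trans_eq ?_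
  simp only [hweight]
  rw [lintegral_const_mul' _ _ ENNReal.ofReal_ne_top, lintegral_enorm_rpow_two, ← mul_assoc,
    ← ENNReal.ofReal_mul (by linarith)]

theorem eLpNorm_ofReal_le_of_lintegral_rpow_le {X F : Type*} [MeasurableSpace X]
    [NormedAddCommGroup F] {μ : Measure X} {f : X → F} {p K N : ℝ} (hp : 0 < p) (hK : 0 ≤ K)
    (hN : 0 ≤ N) (h : ∫⁻ x, ‖f x‖ₑ ^ p ∂μ ≤ ENNReal.ofReal (K * N ^ p)) :
    eLpNorm f (ENNReal.ofReal p) μ ≤ ENNReal.ofReal (K ^ (1 / p)) * ENNReal.ofReal N := by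
  rw [eLpNorm_eq_lintegral_rpow_enorm_toReal (by simpa using hp) ENNReal.ofReal_ne_top,
    ENNReal.toReal_ofReal hp.le, ← ENNReal.ofReal_mul (by positivity)]
  refine (ENNReal.rpow_le_rpow h (by positivity)).trans_eq ?_
  rw [ENNReal.ofReal_rpow_of_nonneg (by positivity) (by positivity),
    Real.mul_rpow hK (by positivity), ← Real.rpow_mul hN, mul_one_div_cancel hp.ne', Real.rpow_one]

theorem exists_eLpNorm_fourierInv_le (hs : 0 < s) (hsd : 2 * s < d) :
    ∃ K : ℝ, ∀ g : E → ℂ, Integrable g → MemLp g 2 →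
      MemLp (sobolevWeight s g) 2 volume → eLpNorm (𝓕⁻ g) (sobolevExponent d s) volume ≤
        ENNReal.ofReal K * eLpNorm (sobolevWeight s g) 2 volume := by
  have hd : 0 < d := Nat.cast_pos.1 (by linarith : (0 : ℝ) < d)
  obtain ⟨B, hB, hlow⟩ := exists_lintegral_ball_enorm_le hd hsd
  set p : ℝ := 2 * d / (d - 2 * s) with hp
  have hp2 : 0 < p - 2 := sub_pos.2 (two_lt_two_mul_div_sub hs hsd)
  have hp0 : 0 < p := by linarith
  set K : ℝ := 4 * p * ((2 * B) ^ (p - 2) * (2 * Real.pi) ^ (-(2 * s)) / (p - 2)) with hK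
  refine ⟨K ^ (1 / p), fun g hg hg2 hgs => ?_⟩
  obtain ⟨N, hN0, hN⟩ : ∃ N : ℝ, 0 ≤ N ∧ eLpNorm (sobolevWeight s g) 2 volume = ENNReal.ofReal N :=
    ⟨_, ENNReal.toReal_nonneg, (ENNReal.ofReal_toReal hgs.2.ne).symm⟩
  rcases hN0.eq_or_lt with rfl | hNpos
  · have hg0 : g =ᵐ[volume] 0 := ae_eq_zero_of_sobolevWeight_ae_eq_zero hd
      ((eLpNorm_eq_zero_iff hgs.1 two_ne_zero).1 (by simpa using hN))
    have hzero : 𝓕⁻ g = 0 := funext fun x => norm_le_zero_iff.1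
      ((norm_fourierInv_le g x).trans_eq (integral_eq_zero_of_ae (by
        filter_upwards [hg0] with ξ hξ
        simp [hξ])))
    simp [hzero]
  have hconst : 4 * p * ((2 * B * N) ^ (p - 2) * (2 * Real.pi) ^ (-(2 * s)) / (p - 2)) *
      N ^ (2 : ℝ) = K * N ^ p := by
    have hpow : N ^ p = N ^ (p - 2) * N ^ (2 : ℝ) := by
      rw [← Real.rpow_add hNpos, sub_add_cancel]
    rw [hK, hpow, Real.mul_rpow (by positivity) hN0]
    ring
  have hbound := lintegral_enorm_fourierInv_rpow_le hs hsd hg hg2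
    (by positivity : 0 < 2 * B * N) (fun A hA => (hlow g hg.1 A hA).trans_eq (by
      rw [hN, ← ENNReal.ofReal_mul (by positivity)]
      ring_nf)) hp
  rw [hN, ENNReal.ofReal_rpow_of_nonneg hN0 zero_le_two, ← ENNReal.ofReal_mul (by positivity),
    hconst] at hbound
  rw [hN]
  exact eLpNorm_ofReal_le_of_lintegral_rpow_le hp0 (by positivity) hN0 hbound

end SobolevEmbedding

section SobolevExtension

variable {V : Type*} [NormedAddCommGroup V]

/-- The annulus `1 / (k + 1) ≤ ‖ξ‖ ≤ k + 1`, to which functions of the frequency are restricted in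
order to make them integrable. -/
def freqAnnulus (V : Type*) [NormedAddCommGroup V] (k : ℕ) : Set V :=
  {ξ | 1 / ((k : ℝ) + 1) ≤ ‖ξ‖ ∧ ‖ξ‖ ≤ k + 1}

theorem eventually_mem_freqAnnulus {ξ : V} (hξ : ξ ≠ 0) :
    ∀ᶠ k : ℕ in atTop, ξ ∈ freqAnnulus V k := by
  have hlower := (tendsto_one_div_add_atTop_nhds_zero_nat (𝕜 := ℝ)).eventually_lt_const
    (norm_pos_iff.2 hξ)
  have hupper := (tendsto_natCast_atTop_atTop (R := ℝ)).eventually_ge_atTop ‖ξ‖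
  filter_upwards [hlower, hupper] with k hk hk'
  exact ⟨hk.le, by linarith⟩

theorem measurableSet_freqAnnulus [MeasurableSpace V] [OpensMeasurableSpace V] (k : ℕ) :
    MeasurableSet (freqAnnulus V k) :=
  (measurableSet_le measurable_const measurable_norm).inter
    (measurableSet_le measurable_norm measurable_const)

variable {d : ℕ} {s : ℝ} {G : EuclideanSpace ℝ (Fin d) → ℂ}

local notation "E" => EuclideanSpace ℝ (Fin d)

theorem tendsto_eLpNorm_indicator_freqAnnulus_sub (hd : 0 < d) (hG : MemLp G 2) :
    Tendsto (fun k => eLpNorm ((freqAnnulus E k).indicator G - G) 2 volume) atTop (𝓝 0) := by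
  have hG2 : ∫⁻ ξ, ‖G ξ‖ₑ ^ (2 : ℝ) < ⊤ := by
    simpa using (eLpNorm_lt_top_iff_lintegral_rpow_enorm_lt_top two_ne_zero (by simp)).1 hG.2
  have hlim : Tendsto (fun k => ∫⁻ ξ, ‖((freqAnnulus E k).indicator G - G) ξ‖ₑ ^ (2 : ℝ)) atTop
      (𝓝 (∫⁻ _ : E, 0)) := by
    refine tendsto_lintegral_of_dominated_convergence' (fun ξ => ‖G ξ‖ₑ ^ (2 : ℝ))
      (fun k => (((hG.1.indicator (measurableSet_freqAnnulus k)).sub hG.1).enorm).pow_const _)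
      (fun k => Eventually.of_forall fun ξ => ?_) hG2.ne ?_
    · by_cases hξ : ξ ∈ freqAnnulus E k <;> simp [hξ]
    · filter_upwards [ae_ne_of_pos_dim hd 0] with ξ hξ
      refine tendsto_const_nhds.congr' ?_
      filter_upwards [eventually_mem_freqAnnulus hξ] with k hk
      simp [hk]
  have hroot := hlim.ennrpow_const (1 / 2 : ℝ)
  rw [lintegral_zero, ENNReal.zero_rpow_of_pos (by norm_num)] at hroot
  refine hroot.congr fun k => ?_
  rw [eLpNorm_eq_lintegral_rpow_enorm_toReal (by norm_num) (by norm_num), ENNReal.toReal_ofNat]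

theorem memLp_indicator_freqAnnulus_sobolevWeight_neg (hs : 0 ≤ s) (hG : MemLp G 2) (k : ℕ) :
    MemLp ((freqAnnulus E k).indicator (sobolevWeight (-s) G)) 2 := by
  have hmeas := (aestronglyMeasurable_sobolevWeight (-s) hG.1).indicator
    (measurableSet_freqAnnulus k)
  refine hG.of_le_mul (c := (2 * Real.pi * (1 / ((k : ℝ) + 1))) ^ (-s)) hmeas
    (Eventually.of_forall fun ξ => ?_)
  by_cases hξ : ξ ∈ freqAnnulus E k
  · rw [Set.indicator_of_mem hξ, sobolevWeight, norm_mul, Complex.norm_real,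
      Real.norm_of_nonneg (by positivity)]
    have hle := hξ.1
    exact mul_le_mul_of_nonneg_right (Real.rpow_le_rpow_of_nonpos (by positivity) (by gcongr)
      (by linarith)) (norm_nonneg _)
  · rw [Set.indicator_of_notMem hξ, norm_zero]
    positivity

theorem integrable_indicator_freqAnnulus_sobolevWeight_neg (hs : 0 ≤ s) (hG : MemLp G 2) (k : ℕ) :
    Integrable ((freqAnnulus E k).indicator (sobolevWeight (-s) G)) := by
  have hmem := (memLp_indicator_iff_restrict (measurableSet_freqAnnulus k)).1
    (memLp_indicator_freqAnnulus_sobolevWeight_neg hs hG k)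
  have hfin : volume (freqAnnulus E k) < ⊤ :=
    (measure_mono fun ξ hξ => mem_closedBall_zero_iff.2 hξ.2).trans_lt
      (measure_closedBall_lt_top (x := (0 : E)) (r := (k : ℝ) + 1))
  have : IsFiniteMeasure (volume.restrict (freqAnnulus E k)) := ⟨by simpa using hfin⟩
  exact (integrable_indicator_iff (measurableSet_freqAnnulus k)).2 (hmem.integrable one_le_two)

theorem sobolevWeight_indicator_freqAnnulus (s : ℝ) (G : E → ℂ) (k : ℕ) :
    sobolevWeight s ((freqAnnulus E k).indicator (sobolevWeight (-s) G)) =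
      (freqAnnulus E k).indicator G := by
  ext ξ
  by_cases hξ : ξ ∈ freqAnnulus E k
  · have hξ0 : ξ ≠ 0 := norm_pos_iff.1 (lt_of_lt_of_le (by positivity) hξ.1)
    have hinv := sobolevWeight_sobolevWeight_neg s G hξ0
    rw [sobolevWeight] at hinv ⊢
    rw [Set.indicator_of_mem hξ, Set.indicator_of_mem hξ, hinv]
  · simp [sobolevWeight, hξ]

theorem tendsto_integral_mul_of_tendsto_eLpNorm {X : Type*} [MeasurableSpace X] {μ : Measure X}
    {p q : ℝ≥0∞} [p.HolderTriple q 1] {f : ℕ → X → ℂ} {u v : X → ℂ} (hf : ∀ k, MemLp (f k) p μ)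
    (hu : MemLp u p μ) (hv : MemLp v q μ)
    (h : Tendsto (fun k => eLpNorm (f k - u) p μ) atTop (𝓝 0)) :
    Tendsto (fun k => ∫ x, f k x * v x ∂μ) atTop (𝓝 (∫ x, u x * v x ∂μ)) := by
  refine tendsto_integral_of_L1' _ (hu.1.mul hv.1)
    (Eventually.of_forall fun k => (hf k).integrable_mul hv) ?_
  have hprod : Tendsto (fun k => eLpNorm (f k - u) p μ * eLpNorm v q μ) atTop (𝓝 0) := by
    simpa using ENNReal.Tendsto.mul_const h (Or.inr hv.2.ne)
  refine tendsto_of_tendsto_of_tendsto_of_le_of_le tendsto_const_nhds hprod (fun k => zero_le)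
    fun k => ?_
  refine le_trans (le_of_eq ?_) (eLpNorm_smul_le_mul_eLpNorm (p := p) (q := q) (r := 1) hv.1
    ((hf k).1.sub hu.1))
  congr 1
  ext x
  simp [sub_mul]

theorem tendsto_integral_indicator_freqAnnulus (hd : 0 < d) {f : E → ℂ} (hf : Integrable f) :
    Tendsto (fun k => ∫ ξ, (freqAnnulus E k).indicator f ξ) atTop (𝓝 (∫ ξ, f ξ)) := by
  refine tendsto_integral_of_dominated_convergence (fun ξ => ‖f ξ‖)
    (fun k => hf.1.indicator (measurableSet_freqAnnulus k)) hf.norm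
    (fun k => Eventually.of_forall fun ξ => norm_indicator_le_norm_self f ξ) ?_
  filter_upwards [ae_ne_of_pos_dim hd 0] with ξ hξ
  refine tendsto_const_nhds.congr' ?_
  filter_upwards [eventually_mem_freqAnnulus hξ] with k hk
  rw [Set.indicator_of_mem hk]

theorem cauchySeq_of_edist_le_mul {α β : Type*} [PseudoEMetricSpace α] [PseudoEMetricSpace β]
    {u : ℕ → α} {v : ℕ → β} {K : ℝ} (hv : CauchySeq v)
    (h : ∀ m n, edist (u m) (u n) ≤ ENNReal.ofReal K * edist (v m) (v n)) : CauchySeq u := by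
  refine EMetric.cauchySeq_iff.2 fun ε hε => ?_
  obtain ⟨N, hN⟩ := EMetric.cauchySeq_iff.1 hv (ε / (ENNReal.ofReal K + 1))
    (ENNReal.div_pos hε.ne' (by simp))
  refine ⟨N, fun m hm n hn => (h m n).trans_lt ?_⟩
  refine (mul_le_mul_left le_self_add _).trans_lt (?_ : (ENNReal.ofReal K + 1) * _ < ε)
  exact ENNReal.mul_lt_of_lt_div' (hN m hm n hn)

theorem exists_tendsto_eLpNorm_fourierInv_indicator_sub (hs : 0 < s) (hsd : 2 * s < d)
    (hG : MemLp G 2) :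
    ∃ u : E → ℂ, MemLp u (sobolevExponent d s) volume ∧
      (∀ k, MemLp (𝓕⁻ ((freqAnnulus E k).indicator (sobolevWeight (-s) G)))
        (sobolevExponent d s)) ∧
      Tendsto (fun k => eLpNorm (𝓕⁻ ((freqAnnulus E k).indicator (sobolevWeight (-s) G)) - u)
        (sobolevExponent d s) volume) atTop (𝓝 0) := by
  have hd : 0 < d := Nat.cast_pos.1 (by linarith : (0 : ℝ) < d)
  obtain ⟨K, hK⟩ := exists_eLpNorm_fourierInv_le hs hsd
  have hp : Fact (1 ≤ sobolevExponent d s) := ⟨one_le_sobolevExponent hs hsd⟩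
  set g : ℕ → E → ℂ := fun k => (freqAnnulus E k).indicator (sobolevWeight (-s) G)
  have hg : ∀ k, Integrable (g k) := integrable_indicator_freqAnnulus_sobolevWeight_neg hs.le hG
  have hg2 : ∀ k, MemLp (g k) 2 := memLp_indicator_freqAnnulus_sobolevWeight_neg hs.le hG
  have hGk (k : ℕ) : MemLp ((freqAnnulus E k).indicator G) 2 :=
    hG.indicator (measurableSet_freqAnnulus k)
  have hweight (k : ℕ) : sobolevWeight s (g k) = (freqAnnulus E k).indicator G :=
    sobolevWeight_indicator_freqAnnulus s G k
  have hmem (k : ℕ) : MemLp (𝓕⁻ (g k)) (sobolevExponent d s) :=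
    ⟨(continuous_fourierInv (hg k)).aestronglyMeasurable,
      (hK _ (hg k) (hg2 k) (hweight k ▸ hGk k)).trans_lt
        (ENNReal.mul_lt_top ENNReal.ofReal_lt_top (hweight k ▸ (hGk k).2))⟩
  have hcauchyG : CauchySeq fun k => (hGk k).toLp :=
    ((Lp.tendsto_Lp_iff_tendsto_eLpNorm'' _ hGk _ hG).2
      (tendsto_eLpNorm_indicator_freqAnnulus_sub hd hG)).cauchySeq
  have hcauchy : CauchySeq fun k => (hmem k).toLp := by
    refine cauchySeq_of_edist_le_mul (K := K) hcauchyG fun m n => ?_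
    have hsub : 𝓕⁻ (g m) - 𝓕⁻ (g n) = 𝓕⁻ (g m - g n) := by
      ext x
      rw [Pi.sub_apply, sub_eq_iff_eq_add, ← fourierInv_add_apply ((hg m).sub (hg n)) (hg n) x]
      simp only [Pi.sub_apply, sub_add_cancel]
    have hweight_sub : sobolevWeight s (g m - g n) =
        (freqAnnulus E m).indicator G - (freqAnnulus E n).indicator G := by
      rw [← hweight, ← hweight]
      ext ξ
      simp only [sobolevWeight, Pi.sub_apply, mul_sub]
    have hbound := hK _ ((hg m).sub (hg n)) ((hg2 m).sub (hg2 n))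
      (hweight_sub ▸ (hGk m).sub (hGk n))
    rwa [Lp.edist_toLp_toLp, Lp.edist_toLp_toLp, hsub, ← hweight_sub]
  obtain ⟨u, hu⟩ := cauchySeq_tendsto_of_complete hcauchy
  exact ⟨u, Lp.memLp u, hmem, (Lp.tendsto_Lp_iff_tendsto_eLpNorm'' _ hmem _ (Lp.memLp u)).1
    (by rwa [Lp.toLp_coeFn])⟩

theorem exists_memLp_integral_mul_fourier_eq (hs : 0 < s) (hsd : 2 * s < d) (hG : MemLp G 2) :
    ∃ u : E → ℂ, MemLp u (sobolevExponent d s) volume ∧ ∀ φ : 𝓢(E, ℂ),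
      Integrable (fun x => u x * φ x) ∧
        ∫ ξ, sobolevWeight (-s) G ξ * φ ξ = ∫ x, u x * 𝓕 φ x := by
  have hd : 0 < d := Nat.cast_pos.1 (by linarith : (0 : ℝ) < d)
  obtain ⟨u, hu, hmem, hlim⟩ := exists_tendsto_eLpNorm_fourierInv_indicator_sub hs hsd hG
  have := ENNReal.HolderConjugate.conjExponent (one_le_sobolevExponent hs hsd)
  refine ⟨u, hu, fun φ =>
    ⟨hu.integrable_mul (φ.memLp (sobolevExponent d s).conjExponent), ?_⟩⟩
  have hlim_space := tendsto_integral_mul_of_tendsto_eLpNorm hmem hu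
    ((𝓕 φ).memLp (sobolevExponent d s).conjExponent) hlim
  have hlim_freq := tendsto_integral_indicator_freqAnnulus hd
    (integrable_sobolevWeight_neg_mul_schwartzMap hd hsd hG φ)
  refine tendsto_nhds_unique hlim_freq (hlim_space.congr fun k => ?_)
  rw [integral_fourierInv_mul_eq_flip
    (integrable_indicator_freqAnnulus_sobolevWeight_neg hs.le hG k) (𝓕 φ).integrable,
    ← SchwartzMap.fourierInv_coe, FourierTransform.fourierInv_fourier_eq]
  exact integral_congr_ae (Eventually.of_forall fun ξ => by
    simp only [Set.indicator_mul_left])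

end SobolevExtension

section HermitianPart

variable {V : Type*} [NormedAddCommGroup V] [InnerProductSpace ℝ V]

/-- The Schwartz function `x ↦ conj (φ (-x))`, whose Fourier transform is the conjugate of `𝓕 φ`. -/
noncomputable def schwartzConjNeg (φ : 𝓢(V, ℂ)) : 𝓢(V, ℂ) :=
  (SchwartzMap.compCLMOfContinuousLinearEquiv ℝ (ContinuousLinearEquiv.neg ℝ) φ).postcompCLM
    (𝕜 := ℝ) (Complex.conjCLE : ℂ →L[ℝ] ℂ)

@[simp]
theorem schwartzConjNeg_apply (φ : 𝓢(V, ℂ)) (x : V) :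
    schwartzConjNeg φ x = (starRingEnd ℂ) (φ (-x)) := rfl

variable [FiniteDimensional ℝ V] [MeasurableSpace V] [BorelSpace V]

theorem fourier_schwartzConjNeg (φ : 𝓢(V, ℂ)) (x : V) :
    𝓕 (schwartzConjNeg φ) x = (starRingEnd ℂ) (𝓕 φ x) := by
  rw [SchwartzMap.fourier_coe, SchwartzMap.fourier_coe, conj_fourier,
    Real.fourierInv_eq_fourier_comp_neg]
  rfl

theorem integral_conj_neg_mul_eq {g u : V → ℂ}
    (h : ∀ φ : 𝓢(V, ℂ), ∫ ξ, g ξ * φ ξ = ∫ x, u x * 𝓕 φ x) (φ : 𝓢(V, ℂ)) :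
    ∫ ξ, (starRingEnd ℂ) (g (-ξ)) * φ ξ = ∫ x, (starRingEnd ℂ) (u x) * 𝓕 φ x := by
  have hconj := congrArg (starRingEnd ℂ) (h (schwartzConjNeg φ))
  rw [← integral_conj, ← integral_conj, ← integral_neg_eq_self] at hconj
  simpa [fourier_schwartzConjNeg] using hconj

theorem integrable_conj_neg_mul {g : V → ℂ} (h : ∀ φ : 𝓢(V, ℂ), Integrable fun ξ => g ξ * φ ξ)
    (φ : 𝓢(V, ℂ)) : Integrable fun ξ => (starRingEnd ℂ) (g (-ξ)) * φ ξ := by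
  simpa using ((Complex.conjCLE : ℂ →L[ℝ] ℂ).integrable_comp (h (schwartzConjNeg φ))).comp_neg

theorem locallyIntegrable_of_integrable_mul_schwartzMap {g : V → ℂ}
    (h : ∀ φ : 𝓢(V, ℂ), Integrable fun ξ => g ξ * φ ξ) : LocallyIntegrable g volume := by
  intro ξ₀
  set R : ℝ := ‖ξ₀‖ + 1 with hR
  have hR0 : 0 < R := by positivity
  have hc : HasCompactSupport fun ξ : V => smoothCutoff (R⁻¹ • ξ) :=
    hasCompactSupport_smoothCutoff.comp_smul (inv_ne_zero hR0.ne')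
  have hsmooth : ContDiff ℝ ∞ fun ξ : V => smoothCutoff (R⁻¹ • ξ) :=
    contDiff_smoothCutoff.comp (contDiff_const_smul _)
  refine ⟨Metric.ball 0 R, Metric.isOpen_ball.mem_nhds (by simp [hR]), ?_⟩
  refine ((h (toSchwartzComplex _ hc hsmooth)).integrableOn (s := Metric.ball 0 R)).congr_fun
    (fun ξ hξ => ?_) measurableSet_ball
  have hξR : ‖ξ‖ < R := by simpa using hξ
  beta_reduce
  rw [toSchwartzComplex_apply, smoothCutoff_eq_one]
  · simp
  · rw [norm_smul, norm_inv, Real.norm_of_nonneg hR0.le, sq_le_one_iff₀ (by positivity),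
      inv_mul_le_one₀ hR0]
    exact hξR.le

/-- The part of `g` satisfying `g (-ξ) = conj (g ξ)`; on the Fourier side this is the projection
onto the transforms of real functions. -/
noncomputable def hermitianPart (g : V → ℂ) (ξ : V) : ℂ := (g ξ + (starRingEnd ℂ) (g (-ξ))) / 2

theorem memLp_hermitianPart {G : V → ℂ} {p : ℝ≥0∞} (hG : MemLp G p volume) :
    MemLp (hermitianPart G) p volume := by
  have hneg : MemLp (fun ξ => (starRingEnd ℂ) (G (-ξ))) p volume :=
    (hG.comp_measurePreserving (Measure.measurePreserving_neg _)).star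
  exact ((hG.add hneg).const_mul (2⁻¹ : ℂ)).ae_eq
    (Eventually.of_forall fun ξ => (div_eq_inv_mul _ _).symm)

theorem integral_re_hermitianPart_mul_conj {G h : V → ℂ} (hG : MemLp G 2 volume)
    (hh : MemLp h 2 volume) :
    ∫ ξ, (hermitianPart G ξ * (starRingEnd ℂ) (h ξ)).re =
      ∫ ξ, (G ξ * (starRingEnd ℂ) (hermitianPart h ξ)).re := by
  have hGneg : MemLp (fun ξ => (starRingEnd ℂ) (G (-ξ))) 2 volume :=
    (hG.comp_measurePreserving (Measure.measurePreserving_neg _)).star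
  have hhneg : MemLp (fun ξ => h (-ξ)) 2 volume :=
    hh.comp_measurePreserving (Measure.measurePreserving_neg _)
  have hGh : Integrable fun ξ => (G ξ * (starRingEnd ℂ) (h ξ)).re :=
    (hG.integrable_mul hh.star).re
  have hGneg_h : Integrable fun ξ => ((starRingEnd ℂ) (G (-ξ)) * (starRingEnd ℂ) (h ξ)).re :=
    (hGneg.integrable_mul hh.star).re
  have hG_hneg : Integrable fun ξ => (G ξ * h (-ξ)).re := (hG.integrable_mul hhneg).re
  have hflip : ∫ ξ, ((starRingEnd ℂ) (G (-ξ)) * (starRingEnd ℂ) (h ξ)).re =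
      ∫ ξ, (G ξ * h (-ξ)).re := by
    rw [← integral_neg_eq_self]
    simp only [neg_neg, ← map_mul, Complex.conj_re]
  calc ∫ ξ, (hermitianPart G ξ * (starRingEnd ℂ) (h ξ)).re
      = ∫ ξ, ((G ξ * (starRingEnd ℂ) (h ξ)).re +
          ((starRingEnd ℂ) (G (-ξ)) * (starRingEnd ℂ) (h ξ)).re) / 2 := by
        congr 1 with ξ
        rw [hermitianPart, ← Complex.add_re, ← add_mul, div_mul_eq_mul_div, Complex.div_ofNat_re]
    _ = ∫ ξ, ((G ξ * (starRingEnd ℂ) (h ξ)).re + (G ξ * h (-ξ)).re) / 2 := by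
        rw [integral_div, integral_div, integral_add hGh hGneg_h, integral_add hGh hG_hneg, hflip]
    _ = ∫ ξ, (G ξ * (starRingEnd ℂ) (hermitianPart h ξ)).re := by
        congr 1 with ξ
        rw [hermitianPart, map_div₀, map_add, Complex.conj_conj, map_ofNat, ← Complex.add_re,
          ← mul_add, mul_div_assoc', Complex.div_ofNat_re]

end HermitianPart

section HomSobolevSpace

variable {d : ℕ} {s : ℝ}

local notation "E" => EuclideanSpace ℝ (Fin d)

theorem hermitianPart_sobolevWeight (s : ℝ) (g : E → ℂ) :
    hermitianPart (sobolevWeight s g) = sobolevWeight s (hermitianPart g) := by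
  ext ξ
  simp only [hermitianPart, sobolevWeight, map_mul, Complex.conj_ofReal, norm_neg]
  ring

theorem isFourierTransformOf_hermitianPart_re {g u : E → ℂ}
    (hgφ : ∀ φ : 𝓢(E, ℂ), Integrable fun ξ => g ξ * φ ξ)
    (huφ : ∀ φ : 𝓢(E, ℂ), Integrable fun x => u x * φ x)
    (h : ∀ φ : 𝓢(E, ℂ), ∫ ξ, g ξ * φ ξ = ∫ x, u x * 𝓕 φ x) :
    IsFourierTransformOf (hermitianPart g) fun x => (u x).re := by
  have hu : LocallyIntegrable u volume := locallyIntegrable_of_integrable_mul_schwartzMap huφ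
  have hconj (φ : 𝓢(E, ℂ)) : Integrable fun x => (starRingEnd ℂ) (u x) * φ x :=
    (huφ φ).mono (hu.aestronglyMeasurable.star.mul φ.continuous.aestronglyMeasurable)
      (Eventually.of_forall fun x => by simp)
  have hre (x : E) (z : ℂ) : ((u x).re : ℂ) * z = (u x * z + (starRingEnd ℂ) (u x) * z) / 2 := by
    rw [← add_mul, Complex.add_conj]
    push_cast
    ring
  have hherm (ξ : E) (z : ℂ) :
      hermitianPart g ξ * z = (g ξ * z + (starRingEnd ℂ) (g (-ξ)) * z) / 2 := by
    rw [hermitianPart]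
    ring
  have hhermφ (φ : 𝓢(E, ℂ)) : Integrable fun ξ => hermitianPart g ξ * φ ξ := by
    simp only [hherm]
    exact ((hgφ φ).add (integrable_conj_neg_mul hgφ φ)).div_const 2
  refine ⟨fun x => (hu x).imp fun _ h => ⟨h.1, h.2.re⟩,
    locallyIntegrable_of_integrable_mul_schwartzMap hhermφ, fun φ => ?_, hhermφ, fun φ => ?_⟩
  · simp only [hre]
    exact ((huφ φ).add (hconj φ)).div_const 2
  · simp only [hre, hherm]
    rw [integral_div, integral_div, integral_add (hgφ φ) (integrable_conj_neg_mul hgφ φ),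
      integral_add (huφ _) (hconj _), h, integral_conj_neg_mul_eq h]

theorem IsFourierTransformOf.hermitianPart_ae_eq {g : E → ℂ} {u : E → ℝ}
    (H : IsFourierTransformOf g u) : hermitianPart g =ᵐ[volume] g :=
  (isFourierTransformOf_hermitianPart_re H.integrable_mul H.integrable_fun_mul
    H.integral_eq).ae_eq H

theorem IsFourierTransformOf.ae_eq_zero {g : E → ℂ} {u : E → ℝ} (H : IsFourierTransformOf g u)
    (hg : g =ᵐ[volume] 0) : u =ᵐ[volume] 0 := by
  refine ae_eq_zero_of_integral_contDiff_smul_eq_zero H.locallyIntegrable_fun fun φ hφ hc => ?_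
  have h := H.integral_eq (𝓕⁻ (toSchwartzComplex φ hc hφ))
  rw [FourierTransform.fourier_fourierInv_eq, integral_eq_zero_of_ae] at h
  · rw [← Complex.ofReal_inj, ← integral_complex_ofReal, Complex.ofReal_zero, h]
    congr 1 with x
    simp [mul_comm]
  · filter_upwards [hg] with ξ hξ
    simp [hξ]

namespace HomSobolev

theorem ext_ae {u v : HomSobolev d s} (h : u =ᵐ[volume] v) : u = v :=
  Subtype.ext (Lp.ext h)

theorem eq_zero_of_sobolevWeight_ae_eq_zero (hd : 0 < d) {u : HomSobolev d s}
    (hu : sobolevWeight s u.fourier =ᵐ[volume] 0) : u = 0 :=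
  ext_ae ((u.isFourierTransformOf.ae_eq_zero (ae_eq_zero_of_sobolevWeight_ae_eq_zero hd hu)).trans
    (Lp.coeFn_zero _ _ _).symm)

theorem hermitianPart_sobolevWeight_fourier (u : HomSobolev d s) :
    hermitianPart (sobolevWeight s u.fourier) =ᵐ[volume] sobolevWeight s u.fourier := by
  rw [hermitianPart_sobolevWeight]
  filter_upwards [u.isFourierTransformOf.hermitianPart_ae_eq] with ξ hξ
  rw [sobolevWeight, sobolevWeight, hξ]

theorem exists_ae_eq_of_isFourierTransformOf {g : E → ℂ} {u : E → ℝ}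
    (H : IsFourierTransformOf g u) (hu : MemLp u (sobolevExponent d s) volume)
    (hg : MemLp (sobolevWeight s g) 2 volume) :
    ∃ U : HomSobolev d s, U =ᵐ[volume] u ∧ U.fourier =ᵐ[volume] g := by
  have HU := H.congr_fun hu.coeFn_toLp.symm
  let U : HomSobolev d s := ⟨hu.toLp u, g, HU, hg⟩
  exact ⟨U, hu.coeFn_toLp, U.isFourierTransformOf.ae_eq HU⟩

theorem exists_sobolevWeight_fourier_ae_eq (hs : 0 < s) (hsd : 2 * s < d) {G : E → ℂ}
    (hG : MemLp G 2) :
    ∃ U : HomSobolev d s, sobolevWeight s U.fourier =ᵐ[volume] hermitianPart G := by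
  have hd : 0 < d := Nat.cast_pos.1 (by linarith : (0 : ℝ) < d)
  obtain ⟨u, hu, huφ⟩ := exists_memLp_integral_mul_fourier_eq hs hsd hG
  have H := isFourierTransformOf_hermitianPart_re
    (integrable_sobolevWeight_neg_mul_schwartzMap hd hsd hG) (fun φ => (huφ φ).1)
    fun φ => (huφ φ).2
  have hweight : sobolevWeight s (hermitianPart (sobolevWeight (-s) G)) =ᵐ[volume]
      hermitianPart G := by
    filter_upwards [ae_ne_of_pos_dim hd 0] with ξ hξ
    rw [hermitianPart_sobolevWeight, sobolevWeight_sobolevWeight_neg s _ hξ]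
  obtain ⟨U, -, hU⟩ := exists_ae_eq_of_isFourierTransformOf H hu.re
    ((memLp_congr_ae hweight).2 (memLp_hermitianPart hG))
  refine ⟨U, ?_⟩
  filter_upwards [hU, hweight] with ξ hUξ hξ
  rw [← hξ, sobolevWeight, sobolevWeight, hUξ]

theorem inner_eq (u v : HomSobolev d s) : inner ℝ u v =
    ∫ ξ, (sobolevWeight s u.fourier ξ * (starRingEnd ℂ) (sobolevWeight s v.fourier ξ)).re := rfl

/-- The isometry `u ↦ (2π|ξ|)^s 𝓕 u` into `L²`, as a linear map. -/
noncomputable def toL2 (d : ℕ) (s : ℝ) :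
    HomSobolev d s →ₗ[ℝ] Lp ℂ 2 (volume : Measure (EuclideanSpace ℝ (Fin d))) where
  toFun u := u.memLp_sobolevWeight.toLp _
  map_add' u v := by
    rw [← MemLp.toLp_add, MemLp.toLp_eq_toLp_iff]
    filter_upwards [fourier_add u v] with ξ hξ
    simp [sobolevWeight, hξ, mul_add]
  map_smul' c u := by
    rw [RingHom.id_apply, ← MemLp.toLp_const_smul, MemLp.toLp_eq_toLp_iff]
    filter_upwards [fourier_smul c u] with ξ hξ
    simp [sobolevWeight, hξ, mul_left_comm]

theorem coeFn_toL2 (u : HomSobolev d s) : toL2 d s u =ᵐ[volume] sobolevWeight s u.fourier :=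
  u.memLp_sobolevWeight.coeFn_toLp

theorem inner_toL2 (G : Lp ℂ 2 (volume : Measure E)) (u : HomSobolev d s) :
    inner ℝ G (toL2 d s u) = ∫ ξ, (G ξ * (starRingEnd ℂ) (sobolevWeight s u.fourier ξ)).re := by
  rw [L2.inner_def]
  refine integral_congr_ae ?_
  filter_upwards [u.coeFn_toL2] with ξ hξ
  rw [hξ, Complex.inner, ← Complex.conj_re, map_mul, Complex.conj_conj, mul_comm]

theorem norm_toL2 (u : HomSobolev d s) : ‖toL2 d s u‖ = ‖u‖ := by
  have hinner : inner ℝ (toL2 d s u) (toL2 d s u) = inner ℝ u u := by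
    rw [inner_toL2, inner_eq]
    refine integral_congr_ae ?_
    filter_upwards [u.coeFn_toL2] with ξ hξ
    rw [hξ]
  rw [real_inner_self_eq_norm_sq, real_inner_self_eq_norm_sq] at hinner
  exact (sq_eq_sq₀ (norm_nonneg _) (norm_nonneg _)).1 hinner

theorem eq_zero_of_norm_eq_zero (hd : 0 < d) {u : HomSobolev d s} (hu : ‖u‖ = 0) : u = 0 := by
  rw [← norm_toL2, norm_eq_zero] at hu
  exact eq_zero_of_sobolevWeight_ae_eq_zero hd
    (u.coeFn_toL2.symm.trans (hu ▸ Lp.coeFn_zero ℂ 2 volume))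

theorem inner_eq_inner_toL2 {G : Lp ℂ 2 (volume : Measure E)} {U : HomSobolev d s}
    (hU : sobolevWeight s U.fourier =ᵐ[volume] hermitianPart G) (u : HomSobolev d s) :
    inner ℝ U u = inner ℝ G (toL2 d s u) := by
  rw [inner_toL2, inner_eq]
  calc ∫ ξ, (sobolevWeight s U.fourier ξ * (starRingEnd ℂ) (sobolevWeight s u.fourier ξ)).re
      = ∫ ξ, (hermitianPart G ξ * (starRingEnd ℂ) (sobolevWeight s u.fourier ξ)).re := by
        refine integral_congr_ae ?_
        filter_upwards [hU] with ξ hξ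
        rw [hξ]
    _ = ∫ ξ, (G ξ * (starRingEnd ℂ) (hermitianPart (sobolevWeight s u.fourier) ξ)).re :=
        integral_re_hermitianPart_mul_conj (Lp.memLp G) u.memLp_sobolevWeight
    _ = ∫ ξ, (G ξ * (starRingEnd ℂ) (sobolevWeight s u.fourier ξ)).re := by
        refine integral_congr_ae ?_
        filter_upwards [u.hermitianPart_sobolevWeight_fourier] with ξ hξ
        rw [hξ]

end HomSobolev

theorem exists_inner_eq_of_norm_le {F H : Type*} [AddCommGroup F] [Module ℝ F]
    [NormedAddCommGroup H] [InnerProductSpace ℝ H] [CompleteSpace H] {f : F →ₗ[ℝ] ℝ}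
    {ι : F →ₗ[ℝ] H} (h : ∃ C, ∀ u, ‖f u‖ ≤ C * ‖ι u‖) : ∃ G : H, ∀ u, f u = inner ℝ G (ι u) := by
  obtain ⟨F', hF', -⟩ := exists_extension_norm_eq _ (f.compLeftInverse ι)
  refine ⟨(InnerProductSpace.toDual ℝ H).symm F', fun u => ?_⟩
  rw [InnerProductSpace.toDual_symm_apply, hF' ⟨ι u, u, rfl⟩]
  exact (LinearMap.compLeftInverse_apply_of_bdd f ι h u _ rfl).symm

theorem existsUnique_isWeakSolution (hs : 0 < s) (hsd : 2 * s < d)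
    (τ : StrongDual ℝ (HomSobolev d s)) : ∃! U : HomSobolev d s, IsWeakSolution τ U := by
  have hd : 0 < d := Nat.cast_pos.1 (by linarith : (0 : ℝ) < d)
  obtain ⟨G, hG⟩ := exists_inner_eq_of_norm_le (f := τ.toLinearMap) (ι := HomSobolev.toL2 d s)
    ⟨‖τ‖, fun u => (τ.le_opNorm u).trans_eq (by rw [HomSobolev.norm_toL2])⟩
  obtain ⟨U, hU⟩ := HomSobolev.exists_sobolevWeight_fourier_ae_eq hs hsd (Lp.memLp G)
  have hweak : IsWeakSolution τ U := fun φ =>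
    (hG φ).trans (HomSobolev.inner_eq_inner_toL2 hU φ).symm
  refine ⟨U, hweak, fun W hW => sub_eq_zero.1 (HomSobolev.eq_zero_of_norm_eq_zero hd ?_)⟩
  rw [← sq_eq_zero_iff, ← real_inner_self_eq_norm_sq, inner_sub_left, ← hW, ← hweak, sub_self]

end HomSobolevSpace

section SpatialTruncation

variable {V : Type*} [NormedAddCommGroup V] [InnerProductSpace ℝ V]

theorem tendsto_smoothCutoff_inv_two_pow_smul (x : V) :
    Tendsto (fun k : ℕ => smoothCutoff (((2 : ℝ) ^ k)⁻¹ • x)) atTop (𝓝 1) := by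
  have hscale : Tendsto (fun k : ℕ => ((2 : ℝ) ^ k)⁻¹) atTop (𝓝 0) :=
    tendsto_inv_atTop_zero.comp (tendsto_pow_atTop_atTop_of_one_lt one_lt_two)
  have hcut := (contDiff_smoothCutoff.continuous.tendsto _).comp (hscale.smul_const x)
  rwa [smoothCutoff_eq_one (by simp)] at hcut

theorem contDiff_smoothCutoff_smul_mul {f : V → ℝ} (hf : ContDiff ℝ ∞ f) (k : ℕ) :
    ContDiff ℝ ∞ fun x => smoothCutoff (((2 : ℝ) ^ k)⁻¹ • x) * f x :=
  (contDiff_smoothCutoff.comp (contDiff_const_smul _)).mul hf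

variable [FiniteDimensional ℝ V]

theorem hasCompactSupport_smoothCutoff_smul_mul (f : V → ℝ) (k : ℕ) :
    HasCompactSupport fun x => smoothCutoff (((2 : ℝ) ^ k)⁻¹ • x) * f x :=
  (hasCompactSupport_smoothCutoff.comp_smul (by positivity)).mul_right

variable [MeasurableSpace V] [BorelSpace V]

theorem integral_norm_fourierInv_comp_smul_le {F : V → ℂ} {a r : ℝ} (ha : 0 ≤ a)
    (hF : Integrable fun y => ‖𝓕⁻ F y‖ * (1 + ‖y‖) ^ a) (hr : 0 < r) (hr1 : r ≤ 1) :
    ∫ y, ‖𝓕⁻ (fun ξ => F (r • ξ)) y‖ * (1 + ‖y‖) ^ a ≤ ∫ y, ‖𝓕⁻ F y‖ * (1 + ‖y‖) ^ a := by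
  have hdil (y : V) : ‖𝓕⁻ (fun ξ => F (r • ξ)) y‖ * (1 + ‖y‖) ^ a =
      r ^ (-(finrank ℝ V : ℝ)) * (‖𝓕⁻ F (r⁻¹ • y)‖ * (1 + ‖r • r⁻¹ • y‖) ^ a) := by
    rw [fourierInv_comp_smul F hr, norm_smul, Real.norm_of_nonneg (by positivity),
      smul_inv_smul₀ hr.ne', mul_assoc]
  have hjac : r ^ (-(finrank ℝ V : ℝ)) * (r⁻¹ ^ finrank ℝ V)⁻¹ = 1 := by
    rw [Real.rpow_neg hr.le, Real.rpow_natCast, inv_pow, inv_inv]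
    exact inv_mul_cancel₀ (by positivity)
  simp only [hdil]
  rw [integral_const_mul, Measure.integral_comp_smul_of_nonneg (volume : Measure V)
    (fun y => ‖𝓕⁻ F y‖ * (1 + ‖r • y‖) ^ a) r⁻¹ (hR := by positivity), smul_eq_mul, ← mul_assoc,
    hjac, one_mul]
  refine integral_mono_of_nonneg (Eventually.of_forall fun y => by positivity) hF
    (Eventually.of_forall fun y => ?_)
  have hle : ‖r • y‖ ≤ ‖y‖ := by
    rw [norm_smul, Real.norm_of_nonneg hr.le]
    exact mul_le_of_le_one_left (norm_nonneg _) hr1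
  beta_reduce
  gcongr

theorem exists_norm_fourier_comp_smul_mul_le (M Φ : 𝓢(V, ℂ)) {a : ℝ} (ha : 0 ≤ a) :
    ∃ C : ℝ, ∀ r : ℝ, 0 < r → r ≤ 1 → ∀ ξ,
      ‖𝓕 (fun x => M (r • x) * Φ x) ξ‖ ≤ C * (1 + ‖ξ‖) ^ (-a) := by
  obtain ⟨D, hD0, hD⟩ := exists_norm_schwartzMap_le (𝓕⁻ Φ) a
  refine ⟨D * ∫ y, ‖𝓕⁻ (M : V → ℂ) y‖ * (1 + ‖y‖) ^ a, fun r hr hr1 ξ => ?_⟩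
  rw [SchwartzMap.fourierInv_coe] at hD
  let Mr : 𝓢(V, ℂ) := SchwartzMap.compCLMOfContinuousLinearEquiv ℝ
    (ContinuousLinearEquiv.smulLeft (Units.mk0 r hr.ne') : V ≃L[ℝ] V) M
  have hMr (x : V) : 𝓕 ((𝓕⁻ Mr : 𝓢(V, ℂ)) : V → ℂ) x = M (r • x) := by
    rw [← SchwartzMap.fourier_coe, FourierTransform.fourier_fourierInv_eq]
    rfl
  have hprod : 𝓕 (fun x => M (r • x) * Φ x) ξ =
      𝓕⁻ (fun x => Φ x * 𝓕 ((𝓕⁻ Mr : 𝓢(V, ℂ)) : V → ℂ) x) (-ξ) := by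
    simp only [Real.fourierInv_eq_fourier_neg, neg_neg, hMr, mul_comm]
  rw [hprod]
  refine (norm_fourierInv_mul_fourier_le ha Φ.integrable hD (𝓕⁻ Mr).integrable
    (integrable_norm_schwartzMap_mul_rpow _ a) (-ξ)).trans ?_
  rw [norm_neg]
  have hM := integrable_norm_schwartzMap_mul_rpow (𝓕⁻ M) a
  rw [SchwartzMap.fourierInv_coe] at hM ⊢
  exact mul_le_mul_of_nonneg_right (mul_le_mul_of_nonneg_left
    (integral_norm_fourierInv_comp_smul_le ha hM hr hr1) hD0) (by positivity)

theorem tendsto_fourier_of_dominated {F : ℕ → V → ℂ} {G : V → ℂ} {bound : V → ℝ}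
    (hF : ∀ k, AEStronglyMeasurable (F k) volume) (hbound : Integrable bound)
    (hle : ∀ k, ∀ᵐ x, ‖F k x‖ ≤ bound x)
    (hlim : ∀ᵐ x, Tendsto (fun k => F k x) atTop (𝓝 (G x))) (ξ : V) :
    Tendsto (fun k => 𝓕 (F k) ξ) atTop (𝓝 (𝓕 G ξ)) := by
  simpa only [Real.fourierInv_eq_fourier_neg, neg_neg] using
    tendsto_fourierInv_of_dominated hF hbound hle hlim (-ξ)

theorem exists_norm_fourier_smoothCutoff_smul_mul_le (Φ : 𝓢(V, ℂ)) {a : ℝ} (ha : 0 ≤ a) :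
    ∃ C : ℝ, ∀ (k : ℕ) (ξ : V),
      ‖𝓕 (fun x => (smoothCutoff (((2 : ℝ) ^ k)⁻¹ • x) : ℂ) * Φ x) ξ‖ ≤ C * (1 + ‖ξ‖) ^ (-a) := by
  obtain ⟨C, hC⟩ := exists_norm_fourier_comp_smul_mul_le
    (toSchwartzComplex smoothCutoff hasCompactSupport_smoothCutoff contDiff_smoothCutoff) Φ ha
  exact ⟨C, fun k => hC _ (by positivity) (inv_le_one_of_one_le₀ (one_le_pow₀ one_le_two))⟩

theorem tendsto_fourier_smoothCutoff_smul_mul (Φ : 𝓢(V, ℂ)) (ξ : V) :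
    Tendsto (fun k : ℕ => 𝓕 (fun x => (smoothCutoff (((2 : ℝ) ^ k)⁻¹ • x) : ℂ) * Φ x) ξ) atTop
      (𝓝 (𝓕 (Φ : V → ℂ) ξ)) := by
  refine tendsto_fourier_of_dominated (bound := fun x => ‖Φ x‖) (fun k => ?_) Φ.integrable.norm
    (fun k => Eventually.of_forall fun x => ?_) (Eventually.of_forall fun x => ?_) ξ
  · exact ((Complex.continuous_ofReal.comp (contDiff_smoothCutoff.continuous.comp
      (continuous_const_smul _))).mul Φ.continuous).aestronglyMeasurable
  · rw [norm_mul, Complex.norm_real, Real.norm_of_nonneg (smoothCutoff_nonneg _)]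
    exact mul_le_of_le_one_left (norm_nonneg _) (smoothCutoff_le_one _)
  · simpa using (tendsto_smoothCutoff_inv_two_pow_smul x).ofReal.mul_const (Φ x)

theorem WeightedIntegrable.tendsto_integral_mul_smoothCutoff_smul_mul {v f : V → ℝ} {a C : ℝ}
    (hv : WeightedIntegrable a v volume) (hf : Continuous f)
    (hC : ∀ x, ‖f x‖ ≤ C * (1 + ‖x‖) ^ (-a)) :
    Tendsto (fun k : ℕ => ∫ x, v x * (smoothCutoff (((2 : ℝ) ^ k)⁻¹ • x) * f x)) atTop
      (𝓝 (∫ x, v x * f x)) := by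
  refine hv.tendsto_integral_smul (C := C) (fun k => ?_) (fun k x => ?_) fun x => ?_
  · exact ((contDiff_smoothCutoff.continuous.comp
      (continuous_const_smul _)).mul hf).aestronglyMeasurable
  · rw [norm_mul, Real.norm_of_nonneg (smoothCutoff_nonneg _)]
    exact (mul_le_of_le_one_left (norm_nonneg _) (smoothCutoff_le_one _)).trans (hC x)
  · simpa using (tendsto_smoothCutoff_inv_two_pow_smul x).mul_const (f x)

end SpatialTruncation

section WeakSolution

variable {d : ℕ} {s : ℝ}

local notation "E" => EuclideanSpace ℝ (Fin d)

theorem isFourierTransformOf_schwartzMap (Φ : 𝓢(E, ℂ)) {f : E → ℝ} (hΦ : ∀ x, Φ x = f x) :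
    IsFourierTransformOf (𝓕 (Φ : E → ℂ)) f := by
  have hf : f = fun x => (Φ x).re := funext fun x => by rw [hΦ, Complex.ofReal_re]
  have hmul (φ : 𝓢(E, ℂ)) : Integrable fun ξ => 𝓕 (Φ : E → ℂ) ξ * φ ξ :=
    ((𝓕 Φ).memLp 2).integrable_mul (φ.memLp 2)
  refine ⟨hf ▸ Φ.integrable.re.locallyIntegrable,
    locallyIntegrable_of_integrable_mul_schwartzMap hmul, fun φ => ?_, hmul, fun φ => ?_⟩
  · simp only [← hΦ]
    exact (Φ.memLp 2).integrable_mul (φ.memLp 2)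
  · simp only [← hΦ]
    exact integral_fourier_mul_eq_flip Φ.integrable φ.integrable

theorem memLp_two_pi_norm_rpow_mul_one_add_norm_rpow (hs : 0 ≤ s) :
    MemLp (fun ξ : E => (2 * Real.pi * ‖ξ‖) ^ s * (1 + ‖ξ‖) ^ (-(s + d + 1))) 2 volume := by
  have hdecay := memLp_one_add_norm_rpow_neg (volume : Measure E) (a := d + 1) (p := 2)
    two_pos (by simpa using by nlinarith [(Nat.cast_nonneg d : (0 : ℝ) ≤ d)])
  rw [ENNReal.ofReal_ofNat] at hdecay
  refine (hdecay.const_mul ((2 * Real.pi) ^ s)).mono ?_ (Eventually.of_forall fun ξ => ?_)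
  · exact ((measurable_two_pi_norm_rpow s).mul
      (continuous_one_add_norm_rpow _).measurable).aestronglyMeasurable
  rw [Real.norm_of_nonneg (by positivity), Real.norm_of_nonneg (by positivity),
    Real.mul_rpow (by positivity) (norm_nonneg _), mul_assoc,
    show -((d : ℝ) + 1) = s + -(s + d + 1) by ring, Real.rpow_add (by positivity)]
  gcongr
  exact le_add_of_nonneg_left zero_le_one

namespace HomSobolev

theorem exists_of_schwartz (hs : 0 < s) (hsd : 2 * s < d) (Φ : 𝓢(E, ℂ)) {f : E → ℝ}
    (hΦ : ∀ x, Φ x = f x) :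
    ∃ u : HomSobolev d s, u =ᵐ[volume] f ∧ u.fourier =ᵐ[volume] 𝓕 (Φ : E → ℂ) := by
  have hd : 0 < d := Nat.cast_pos.1 (by linarith : (0 : ℝ) < d)
  have hf : f = fun x => (Φ x).re := funext fun x => by rw [hΦ, Complex.ofReal_re]
  exact exists_ae_eq_of_isFourierTransformOf (isFourierTransformOf_schwartzMap Φ hΦ)
    (hf ▸ (Φ.memLp _).re) (memLp_sobolevWeight_schwartzMap hd (by linarith) (𝓕 Φ))

theorem tendsto_inner_of_dominated (U : HomSobolev d s) {u : ℕ → HomSobolev d s}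
    {v : HomSobolev d s} {bound : E → ℝ} (hbound : MemLp bound 2 volume)
    (hle : ∀ k, ∀ᵐ ξ, ‖sobolevWeight s (u k).fourier ξ‖ ≤ bound ξ)
    (hlim : ∀ᵐ ξ, Tendsto (fun k => (u k).fourier ξ) atTop (𝓝 (v.fourier ξ))) :
    Tendsto (fun k => inner ℝ U (u k)) atTop (𝓝 (inner ℝ U v)) := by
  simp only [inner_eq]
  refine tendsto_integral_of_dominated_convergence
    (fun ξ => ‖sobolevWeight s U.fourier ξ‖ * bound ξ) (fun k => ?_)
    (U.memLp_sobolevWeight.norm.integrable_mul hbound) (fun k => ?_) ?_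
  · exact (U.memLp_sobolevWeight.integrable_mul
      (u k).memLp_sobolevWeight.star).aestronglyMeasurable.re
  · filter_upwards [hle k] with ξ hξ
    refine (Complex.abs_re_le_norm _).trans ?_
    rw [norm_mul, RCLike.norm_conj]
    gcongr
  · filter_upwards [hlim] with ξ hξ
    have hweight : Tendsto (fun k => sobolevWeight s (u k).fourier ξ) atTop
        (𝓝 (sobolevWeight s v.fourier ξ)) := hξ.const_mul _
    exact (Complex.continuous_re.tendsto _).comp
      (((Complex.continuous_conj.tendsto _).comp hweight).const_mul _)

theorem exists_truncation_tendsto_inner (hs : 0 < s) (hsd : 2 * s < d) (Φ : 𝓢(E, ℂ)) {f : E → ℝ}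
    (hΦ : ∀ x, Φ x = f x) (hf : ContDiff ℝ ∞ f) {v : HomSobolev d s} (hv : v =ᵐ[volume] f) :
    ∃ u : ℕ → HomSobolev d s,
      (∀ k, u k =ᵐ[volume] fun x => smoothCutoff (((2 : ℝ) ^ k)⁻¹ • x) * f x) ∧
      ∀ U : HomSobolev d s, Tendsto (fun k => inner ℝ U (u k)) atTop (𝓝 (inner ℝ U v)) := by
  obtain ⟨C, hC⟩ := exists_norm_fourier_smoothCutoff_smul_mul_le Φ (a := s + d + 1) (by positivity)
  choose u hu hfourier using fun k => exists_of_schwartz hs hsd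
    (toSchwartzComplex _ (hasCompactSupport_smoothCutoff_smul_mul f k)
      (contDiff_smoothCutoff_smul_mul hf k)) fun _ => rfl
  have hfourier' (k : ℕ) : (u k).fourier =ᵐ[volume]
      𝓕 (fun x => (smoothCutoff (((2 : ℝ) ^ k)⁻¹ • x) : ℂ) * Φ x) := by
    refine (hfourier k).trans (Eventually.of_forall fun ξ => ?_)
    refine congrArg (fun g : E → ℂ => 𝓕 g ξ) (funext fun x => ?_)
    rw [toSchwartzComplex_apply, hΦ, Complex.ofReal_mul]
  obtain ⟨w, hw, hwfourier⟩ := exists_of_schwartz hs hsd Φ hΦ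
  obtain rfl : v = w := ext_ae (hv.trans hw.symm)
  refine ⟨u, hu, fun U => U.tendsto_inner_of_dominated
    ((memLp_two_pi_norm_rpow_mul_one_add_norm_rpow hs.le).const_mul C) (fun k => ?_) ?_⟩
  · filter_upwards [hfourier' k] with ξ hξ
    rw [sobolevWeight, norm_mul, Complex.norm_real, Real.norm_of_nonneg (by positivity), hξ,
      mul_left_comm]
    gcongr
    exact hC k ξ
  · filter_upwards [ae_all_iff.2 hfourier', hwfourier] with ξ hξ hwξ
    simpa only [hξ, hwξ] using tendsto_fourier_smoothCutoff_smul_mul Φ ξ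

theorem integral_mul_eq_inner (hs : 0 ≤ s) (U u : HomSobolev d s) (P : 𝓢(E, ℂ)) {p : E → ℝ}
    (hP : ∀ x, P x = p x)
    (hPu : 𝓕 (P : E → ℂ) =ᵐ[volume] fun ξ => ((2 * Real.pi * ‖ξ‖) ^ (2 * s) : ℝ) * u.fourier ξ) :
    ∫ x, U x * p x = inner ℝ U u := by
  have hconj (ξ : E) : (𝓕⁻ P) ξ = (starRingEnd ℂ) (𝓕 (P : E → ℂ) ξ) := by
    rw [SchwartzMap.fourierInv_coe, funext hP, conj_fourier]
    simp only [Complex.conj_ofReal]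
  have hpair := U.isFourierTransformOf.integral_eq (𝓕⁻ P)
  rw [FourierTransform.fourier_fourierInv_eq] at hpair
  have hfreq : ∫ ξ, U.fourier ξ * (𝓕⁻ P) ξ = ∫ ξ, sobolevWeight s U.fourier ξ *
      (starRingEnd ℂ) (sobolevWeight s u.fourier ξ) := by
    refine integral_congr_ae ?_
    filter_upwards [hPu] with ξ hξ
    rw [hconj, hξ, sobolevWeight, sobolevWeight, two_mul s,
      Real.rpow_add_of_nonneg (by positivity) hs hs]
    simp only [map_mul, Complex.conj_ofReal, Complex.ofReal_mul]
    ring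
  have hprod : Integrable fun ξ => sobolevWeight s U.fourier ξ *
      (starRingEnd ℂ) (sobolevWeight s u.fourier ξ) :=
    U.memLp_sobolevWeight.integrable_mul u.memLp_sobolevWeight.star
  calc ∫ x, U x * p x = (∫ x, (U x : ℂ) * P x).re := by
        simp only [hP, ← Complex.ofReal_mul, integral_complex_ofReal, Complex.ofReal_re]
    _ = (∫ ξ, sobolevWeight s U.fourier ξ *
          (starRingEnd ℂ) (sobolevWeight s u.fourier ξ)).re := by rw [← hpair, hfreq]
    _ = inner ℝ U u := (integral_re hprod).symm

theorem weightedIntegrable (hs : 0 < s) (hsd : 2 * s < d) (U : HomSobolev d s) {a : ℝ}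
    (ha : (d : ℝ) / 2 + s < a) : WeightedIntegrable a U volume := by
  refine weightedIntegrable_of_memLp (p := 2 * (d : ℝ) / (d - 2 * s)) (Lp.memLp U.toLp)
    (one_lt_two.trans (two_lt_two_mul_div_sub hs hsd)) ?_
  have hd : 0 < (d : ℝ) := by linarith
  have hexp : (d : ℝ) * (1 - 1 / (2 * (d : ℝ) / (d - 2 * s))) = d / 2 + s := by
    field_simp
    ring
  rwa [finrank_euclideanSpace_fin, hexp]

end HomSobolev

theorem IsRegularDistribution.apply_eq_integral_of_schwartz (hs : 0 < s) (hsd : 2 * s < d)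
    {τ : StrongDual ℝ (HomSobolev d s)} {T : E → ℝ} {c : ℝ} (hτ : IsRegularDistribution τ T)
    (hT : WeightedIntegrable c T volume) (Φ : 𝓢(E, ℂ)) {f : E → ℝ} (hΦ : ∀ x, Φ x = f x)
    {u : HomSobolev d s} (hu : u =ᵐ[volume] f) : τ u = ∫ x, T x * f x := by
  have hf : ContDiff ℝ ∞ f := by
    rw [show f = fun x => (Φ x).re from funext fun x => by rw [hΦ, Complex.ofReal_re]]
    exact Complex.reCLM.contDiff.comp Φ.smooth'
  obtain ⟨C, -, hC⟩ := exists_norm_schwartzMap_le Φ c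
  have hfC (x : E) : ‖f x‖ ≤ C * (1 + ‖x‖) ^ (-c) := by
    rw [← Complex.norm_real, ← hΦ]
    exact hC x
  obtain ⟨U, hU, -⟩ := existsUnique_isWeakSolution hs hsd τ
  obtain ⟨v, hv, hlim⟩ := HomSobolev.exists_truncation_tendsto_inner hs hsd Φ hΦ hf hu
  have hvk (k : ℕ) : inner ℝ U (v k) =
      ∫ x, T x * (smoothCutoff (((2 : ℝ) ^ k)⁻¹ • x) * f x) := by
    rw [← hU, hτ _ _ (contDiff_smoothCutoff_smul_mul hf k)
      (hasCompactSupport_smoothCutoff_smul_mul f k) (hv k)]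
  rw [hU]
  exact tendsto_nhds_unique (hlim U) ((hT.tendsto_integral_mul_smoothCutoff_smul_mul
    hf.continuous hfC).congr fun k => (hvk k).symm)

section HighFrequency

variable {φ : EuclideanSpace ℝ (Fin d) → ℝ} (hc : HasCompactSupport φ) (hφ : ContDiff ℝ ∞ φ)
include hc hφ

theorem fourierMultiplierCLM_eq_realFourierMultiplier {m : E → ℝ} (hm : m.HasTemperateGrowth)
    (hneg : ∀ ξ, m (-ξ) = m ξ) (x : E) :
    SchwartzMap.fourierMultiplierCLM ℂ m (toSchwartzComplex φ hc hφ) x =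
      realFourierMultiplier m φ x := by
  rw [coe_fourierMultiplierCLM hm, ofReal_realFourierMultiplier hneg]
  rfl

theorem HomSobolev.exists_integral_mul_highFreq_eq_inner (hs : 0 < s) (hsd : 2 * s < d) (r : ℝ)
    (k : ℕ) : ∃ u : HomSobolev d s,
      u =ᵐ[volume] realFourierMultiplier (highFreqPow r k) φ ∧
      u.fourier =ᵐ[volume] (fun ξ => highFreqPow r k ξ * 𝓕 (fun x => (φ x : ℂ)) ξ) ∧
      ∀ U : HomSobolev d s,
        ∫ x, U x * realFourierMultiplier (highFreqPow (2 * s + r) k) φ x = inner ℝ U u := by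
  have hmult (t : ℝ) := fourierMultiplierCLM_eq_realFourierMultiplier hc hφ
    (hasTemperateGrowth_highFreqPow t k) (highFreqPow_neg t k)
  have hfourier (t : ℝ) := fourier_fourierMultiplierCLM (hasTemperateGrowth_highFreqPow t k)
    (toSchwartzComplex φ hc hφ)
  obtain ⟨u, hu, hufourier⟩ := HomSobolev.exists_of_schwartz hs hsd _ (hmult r)
  rw [← SchwartzMap.fourier_coe, funext (hfourier r)] at hufourier
  refine ⟨u, hu, hufourier, fun U => U.integral_mul_eq_inner hs.le u _ (hmult (2 * s + r)) ?_⟩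
  filter_upwards [hufourier] with ξ hξ
  rw [← SchwartzMap.fourier_coe, hfourier, hξ, highFreqPow_add, Complex.ofReal_mul, mul_assoc]

theorem integral_mul_highFreq_eq_of_isWeakSolution (hs : 0 < s) (hsd : 2 * s < d)
    {τ : StrongDual ℝ (HomSobolev d s)} {T : E → ℝ} {c : ℝ} (hτ : IsRegularDistribution τ T)
    (hT : WeightedIntegrable c T volume) {U : HomSobolev d s} (hU : IsWeakSolution τ U) (k : ℕ) :
    ∫ x, U x * realFourierMultiplier (highFreqPow 0 k) φ x =
      ∫ x, T x * realFourierMultiplier (highFreqPow (-(2 * s)) k) φ x := by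
  obtain ⟨u, hu, -, hinner⟩ :=
    HomSobolev.exists_integral_mul_highFreq_eq_inner hc hφ hs hsd (-(2 * s)) k
  rw [← add_neg_cancel (2 * s), hinner, ← hU]
  exact hτ.apply_eq_integral_of_schwartz hs hsd hT _
    (fourierMultiplierCLM_eq_realFourierMultiplier hc hφ (hasTemperateGrowth_highFreqPow _ k)
      (highFreqPow_neg _ k)) hu

theorem integral_rieszKernel_mul_highFreq {α : ℝ} (hα : 0 < α) (hαd : α < d) (k : ℕ) (x : E) :
    ∫ y, rieszKernel d α (x - y) * realFourierMultiplier (highFreqPow 0 k) φ y =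
      realFourierMultiplier (highFreqPow (-α) k) φ x := by
  let Φ := toSchwartzComplex φ hc hφ
  have htemp (t : ℝ) : (highFreqPow t k : E → ℝ).HasTemperateGrowth :=
    hasTemperateGrowth_highFreqPow t k
  have hsymbol (ξ : E) : (((2 * Real.pi * ‖ξ‖) ^ (-α) : ℝ) : ℂ) *
      (highFreqPow 0 k ξ * 𝓕 (Φ : E → ℂ) ξ) = highFreqPow (-α) k ξ * 𝓕 (Φ : E → ℂ) ξ := by
    rw [← mul_assoc, ← Complex.ofReal_mul, ← highFreqPow_add, add_zero]
  obtain ⟨C, -, hC⟩ := exists_norm_fourierMultiplier_le (htemp 0) Φ (d : ℝ)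
  have hint : Integrable fun y => (rieszKernel d α (x - y) : ℂ) *
      fourierMultiplier (highFreqPow 0 k) Φ y := by
    simp only [rieszKernel_sub_comm x]
    exact integrable_rieszKernel_mul_of_norm_le hα hαd hαd
      (continuous_fourierMultiplier (htemp 0) Φ).aestronglyMeasurable hC x
  have hriesz := integral_rieszKernel_mul_fourierInv hα hαd (integrable_mul_fourier (htemp 0) Φ)
    (by simpa only [hsymbol] using integrable_mul_fourier (htemp (-α)) Φ) x hint
  simp only [hsymbol] at hriesz
  apply Complex.ofReal_injective
  rw [← integral_complex_ofReal, ofReal_realFourierMultiplier (highFreqPow_neg _ k)]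
  simp only [Complex.ofReal_mul, ofReal_realFourierMultiplier (highFreqPow_neg _ k)]
  exact hriesz

theorem integral_rieszPotential_mul_highFreq {α c : ℝ} (hα : 0 < α) (hαd : α < d) (hc0 : 0 ≤ c)
    (hcα : c + α ≤ d) {T : E → ℝ} (hT : WeightedIntegrable c T volume) (k : ℕ) :
    ∫ x, rieszPotential α T x * realFourierMultiplier (highFreqPow 0 k) φ x =
      ∫ x, T x * realFourierMultiplier (highFreqPow (-α) k) φ x := by
  have htemp : (highFreqPow 0 k : E → ℝ).HasTemperateGrowth := hasTemperateGrowth_highFreqPow 0 k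
  obtain ⟨C, hC⟩ := exists_norm_realFourierMultiplier_le htemp hc hφ (c + α + 1)
  rw [integral_rieszPotential_mul hα hαd hc0 (lt_add_one _) hcα hT
    (continuous_realFourierMultiplier htemp hc hφ).aestronglyMeasurable hC]
  simp only [fun x y : E => rieszKernel_sub_comm (α := α) x y,
    integral_rieszKernel_mul_highFreq hc hφ hα hαd k]

end HighFrequency

theorem IsWeakSolution.ae_eq_rieszPotential (hs : 0 < s) (hsd : 2 * s < d)
    {τ : StrongDual ℝ (HomSobolev d s)} {U : HomSobolev d s} (hU : IsWeakSolution τ U) {T : E → ℝ}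
    (hτ : IsRegularDistribution τ T) {c : ℝ} (hc : 0 ≤ c) (hcs : c + 2 * s < d)
    (hT : WeightedIntegrable c T volume) : U =ᵐ[volume] rieszPotential (2 * s) T := by
  have hα : 0 < 2 * s := by positivity
  obtain ⟨a, ha, had⟩ := exists_between (max_lt (by linarith : (d : ℝ) / 2 + s < d) hcs)
  obtain ⟨hsa, hca⟩ := max_lt_iff.1 ha
  have hUa := U.weightedIntegrable hs hsd hsa
  have hRa := weightedIntegrable_rieszPotential hα hsd hc hca hcs.le hT
  refine (ae_eq_zero_of_integral_mul_highFreq_eq_zero (hc.trans (by linarith)) (by simpa using had)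
    (hUa.sub hRa) fun φ hφ hφc k => ?_).mono fun x hx => sub_eq_zero.1 hx
  have htemp : (highFreqPow 0 k : E → ℝ).HasTemperateGrowth := hasTemperateGrowth_highFreqPow 0 k
  simp only [sub_mul]
  rw [integral_sub (hUa.integrable_mul_realFourierMultiplier htemp hφc hφ)
    (hRa.integrable_mul_realFourierMultiplier htemp hφc hφ),
    integral_mul_highFreq_eq_of_isWeakSolution hφc hφ hs hsd hτ hT hU,
    integral_rieszPotential_mul_highFreq hφc hφ hα hsd hc hcs.le hT, sub_self]

end WeakSolution

section FracLaplacian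

variable {d : ℕ} {s : ℝ}

local notation "E" => EuclideanSpace ℝ (Fin d)

theorem tendsto_realFourierMultiplier_highFreqPow (hd : 0 < d) {r : ℝ} (hr : -(d : ℝ) < r)
    {φ : E → ℝ} (hc : HasCompactSupport φ) (hφ : ContDiff ℝ ∞ φ) (x : E) :
    Tendsto (fun k => realFourierMultiplier (highFreqPow r k) φ x) atTop
      (𝓝 (realFourierMultiplier (fun ξ => (2 * Real.pi * ‖ξ‖) ^ r) φ x)) := by
  let Φ := toSchwartzComplex φ hc hφ
  refine (Complex.continuous_re.tendsto _).comp (tendsto_fourierInv_of_dominated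
    (bound := fun ξ => (2 * Real.pi * ‖ξ‖) ^ r * ‖(𝓕 Φ) ξ‖) (fun k => ?_) ?_
    (fun k => Eventually.of_forall fun ξ => ?_) ?_ x)
  · exact (integrable_mul_fourier (hasTemperateGrowth_highFreqPow r k) Φ).aestronglyMeasurable
  · rw [← finrank_euclideanSpace_fin (𝕜 := ℝ) (n := d)] at hd hr
    exact integrable_two_pi_norm_rpow_mul_norm_schwartzMap hd hr _
  · rw [norm_mul, Complex.norm_real, Real.norm_of_nonneg (highFreqPow_nonneg r k ξ)]
    exact mul_le_mul_of_nonneg_right (highFreqPow_le r k ξ) (norm_nonneg _)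
  · filter_upwards [ae_ne_of_pos_dim hd 0] with ξ hξ
    exact (tendsto_highFreqPow r hξ).ofReal.mul_const _

theorem WeightedIntegrable.tendsto_integral_mul_highFreqPow (hd : 0 < d) {v : E → ℝ} {a r : ℝ}
    (ha : 0 ≤ a) (hr : -(d : ℝ) < r) (har : a < d + r) (hv : WeightedIntegrable a v volume)
    {φ : E → ℝ} (hc : HasCompactSupport φ) (hφ : ContDiff ℝ ∞ φ) :
    Tendsto (fun k => ∫ x, v x * realFourierMultiplier (highFreqPow r k) φ x) atTop
      (𝓝 (∫ x, v x * realFourierMultiplier (fun ξ => (2 * Real.pi * ‖ξ‖) ^ r) φ x)) := by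
  obtain ⟨C, hC⟩ := exists_norm_fourierMultiplier_highFreqPow_le (toSchwartzComplex φ hc hφ) ha
    (by simpa using har)
  exact hv.tendsto_integral_smul
    (fun k => (continuous_realFourierMultiplier (hasTemperateGrowth_highFreqPow r k) hc
      hφ).aestronglyMeasurable)
    (fun k x => (norm_realFourierMultiplier_le _ φ x).trans (hC k x))
    (tendsto_realFourierMultiplier_highFreqPow hd hr hc hφ)

theorem HomSobolev.integral_mul_fracLaplacian (hs : 0 < s) (hsd : 2 * s < d)
    (U : HomSobolev d s) {u : HomSobolev d s} {φ : E → ℝ} (hc : HasCompactSupport φ)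
    (hφ : ContDiff ℝ ∞ φ) (hu : u =ᵐ[volume] φ) :
    ∫ x, U x * fracLaplacian s φ x = inner ℝ U u := by
  have hd : 0 < d := Nat.cast_pos.1 (by linarith : (0 : ℝ) < d)
  obtain ⟨w, hw, hwfourier⟩ := exists_of_schwartz hs hsd (toSchwartzComplex φ hc hφ) fun _ => rfl
  obtain rfl : u = w := ext_ae (hu.trans hw.symm)
  choose v _ hvfourier hvinner using exists_integral_mul_highFreq_eq_inner hc hφ hs hsd 0
  simp only [add_zero] at hvinner
  have hspace : Tendsto (fun k => inner ℝ U (v k)) atTop (𝓝 (∫ x, U x * fracLaplacian s φ x)) :=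
    ((U.weightedIntegrable hs hsd (a := d) (by linarith)).tendsto_integral_mul_highFreqPow hd
      d.cast_nonneg (by linarith) (by linarith) hc hφ).congr fun k => hvinner k U
  refine tendsto_nhds_unique hspace (U.tendsto_inner_of_dominated u.memLp_sobolevWeight.norm
    (fun k => ?_) ?_)
  · filter_upwards [hvfourier k, hwfourier] with ξ hvξ hwξ
    rw [sobolevWeight, sobolevWeight, hvξ, hwξ, mul_left_comm, norm_mul, Complex.norm_real,
      Real.norm_of_nonneg (highFreqPow_nonneg 0 k ξ)]
    exact mul_le_of_le_one_left (norm_nonneg _) (by simpa using highFreqPow_le 0 k ξ)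
  · filter_upwards [ae_all_iff.2 hvfourier, hwfourier, ae_ne_of_pos_dim hd 0] with ξ hvξ hwξ hξ
    have hlim := (tendsto_highFreqPow 0 hξ).ofReal.mul_const
      (𝓕 (toSchwartzComplex φ hc hφ : E → ℂ) ξ)
    rw [Real.rpow_zero, Complex.ofReal_one, one_mul] at hlim
    rw [hwξ]
    exact hlim.congr fun k => (hvξ k).symm

theorem isRegularDistribution_innerSL_iff (hs : 0 < s) (hsd : 2 * s < d) {U : HomSobolev d s}
    {T : E → ℝ} :
    IsRegularDistribution (innerSL ℝ U) T ↔ ∀ φ : E → ℝ, ContDiff ℝ ∞ φ → HasCompactSupport φ →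
      ∫ x, U x * fracLaplacian s φ x = ∫ x, T x * φ x := by
  refine ⟨fun h φ hφ hc => ?_, fun h φ u hφ hc hu => ?_⟩
  · obtain ⟨u, hu, -⟩ := HomSobolev.exists_of_schwartz hs hsd (toSchwartzComplex φ hc hφ)
      fun _ => rfl
    rw [U.integral_mul_fracLaplacian hs hsd hc hφ hu, ← h φ u hφ hc hu, innerSL_apply_apply]
  · rw [innerSL_apply_apply, ← U.integral_mul_fracLaplacian hs hsd hc hφ hu, h φ hφ hc]

theorem IsWeakSolution.eq_innerSL {τ : StrongDual ℝ (HomSobolev d s)} {U : HomSobolev d s}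
    (hU : IsWeakSolution τ U) : τ = innerSL ℝ U :=
  ContinuousLinearMap.ext hU

theorem IsDistributionalSolution.ae_eq_rieszPotential (hs : 0 < s) (hsd : 2 * s < d)
    {U : HomSobolev d s} {T : E → ℝ} (hU : IsDistributionalSolution s T U) {c : ℝ} (hc : 0 ≤ c)
    (hcs : c + 2 * s < d) (hT : WeightedIntegrable c T volume) :
    U =ᵐ[volume] rieszPotential (2 * s) T :=
  IsWeakSolution.ae_eq_rieszPotential (τ := innerSL ℝ U) hs hsd (fun _ => rfl)
    ((isRegularDistribution_innerSL_iff hs hsd).2 hU.integral_eq) hc hcs hT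

theorem IsWeakSolution.isDistributionalSolution_rieszPotential (hs : 0 < s) (hsd : 2 * s < d)
    {τ : StrongDual ℝ (HomSobolev d s)} {U : HomSobolev d s} (hU : IsWeakSolution τ U) {T : E → ℝ}
    (hτ : IsRegularDistribution τ T) {c : ℝ} (hc : 0 ≤ c) (hcs : c + 2 * s < d)
    (hT : WeightedIntegrable c T volume) :
    IsDistributionalSolution s T (rieszPotential (2 * s) T) := by
  have hα : 0 < 2 * s := by positivity
  have hR : WeightedIntegrable (d + 2 * s) (rieszPotential (2 * s) T) volume :=
    weightedIntegrable_rieszPotential hα hsd hc (by linarith) hcs.le hT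
  refine ⟨hR.locallyIntegrable, hR.integrable_abs_div, fun φ hφ hφc => ?_⟩
  rw [← (isRegularDistribution_innerSL_iff hs hsd).1 (hU.eq_innerSL ▸ hτ) φ hφ hφc]
  exact integral_congr_ae ((hU.ae_eq_rieszPotential hs hsd hτ hc hcs hT).symm.mul .rfl)

theorem exists_weightedIntegrable_of_memLp {q : ℝ} (hs : 0 < s) (hq : 1 < q)
    (hqd : q < (d : ℝ) / (2 * s)) {T : E → ℝ} (hT : MemLp T (ENNReal.ofReal q) volume) :
    ∃ c, c + 2 * s < d ∧ WeightedIntegrable c T volume := by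
  have hq0 : 0 < q := one_pos.trans hq
  have hexp : (d : ℝ) * (1 - 1 / q) < d - 2 * s := by
    rw [lt_div_iff₀ (by positivity), mul_comm, ← lt_div_iff₀ hq0] at hqd
    rw [mul_sub, mul_one, mul_one_div]
    linarith
  obtain ⟨c, hc, hcs⟩ := exists_between hexp
  exact ⟨c, by linarith, weightedIntegrable_of_memLp hT hq (by simpa using hc)⟩

end FracLaplacian

theorem corollary5p5_general {d : ℕ} {s c : ℝ} (hs : 0 < s) (hsd : 2 * s < d)
    (hcs : c + 2 * s < d) {T : EuclideanSpace ℝ (Fin d) → ℝ} (hT : WeightedIntegrable c T volume)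
    {τ : StrongDual ℝ (HomSobolev d s)} (hτ : IsRegularDistribution τ T) :
    (∀ᵐ x ∂(volume : Measure (EuclideanSpace ℝ (Fin d))),
      ConvolutionExistsAt (rieszKernel d (2 * s)) T x (ContinuousLinearMap.mul ℝ ℝ) volume) ∧
    (∃! U : HomSobolev d s, IsWeakSolution τ U) ∧
    (∀ U : HomSobolev d s, IsWeakSolution τ U → U =ᵐ[volume] rieszPotential (2 * s) T) ∧
    IsDistributionalSolution s T (rieszPotential (2 * s) T) ∧
    (∀ U : HomSobolev d s, IsDistributionalSolution s T U →
      U =ᵐ[volume] rieszPotential (2 * s) T) := by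
  have hb : 0 ≤ max c 0 := le_max_right c 0
  have hbs : max c 0 + 2 * s < d := by
    rw [← max_add_add_right, zero_add]
    exact max_lt hcs hsd
  have hTb : WeightedIntegrable (max c 0) T volume := hT.mono (le_max_left c 0)
  have hex := existsUnique_isWeakSolution hs hsd τ
  exact ⟨ae_convolutionExistsAt_rieszKernel (by positivity) hsd hb hbs hTb, hex,
    fun U hU => hU.ae_eq_rieszPotential hs hsd hτ hb hbs hTb,
    hex.exists.elim fun U hU => hU.isDistributionalSolution_rieszPotential hs hsd hτ hb hbs hTb,
    fun U hU => hU.ae_eq_rieszPotential hs hsd hb hbs hTb⟩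

theorem corollary5p5 (d : ℕ) (hd : 2 ≤ d) (s : ℝ) (hs : 0 < s) (hsd : s < (d : ℝ) / 2)
    (q : ℝ) (hq : 1 < q) (hqd : q < (d : ℝ) / (2 * s))
    (T : EuclideanSpace ℝ (Fin d) → ℝ) (hT : MemLp T (ENNReal.ofReal q) volume)
    (τ : StrongDual ℝ (HomSobolev d s)) (hτ : IsRegularDistribution τ T) :
    (∀ᵐ x ∂(volume : Measure (EuclideanSpace ℝ (Fin d))),
      ConvolutionExistsAt (rieszKernel d (2 * s)) T x (ContinuousLinearMap.mul ℝ ℝ) volume) ∧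
    (∃! U : HomSobolev d s, IsWeakSolution τ U) ∧
    (∀ U : HomSobolev d s, IsWeakSolution τ U → U =ᵐ[volume] rieszPotential (2 * s) T) ∧
    IsDistributionalSolution s T (rieszPotential (2 * s) T) ∧
    (∀ U : HomSobolev d s, IsDistributionalSolution s T U →
      U =ᵐ[volume] rieszPotential (2 * s) T) := by
  obtain ⟨c, hcs, hTc⟩ := exists_weightedIntegrable_of_memLp hs hq hqd hT
  exact corollary5p5_general hs (by linarith) hcs hTc hτ
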